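/- **Setting.** There are $n$ customer types and $L$ resources. A type $i$ customer requests $A_{ij}\in[0,\bar a]$ units of resource $j$ ($\bar a>0$ is a known bound) and pays $r_i\ge 0$. The horizon is $T$ and the capacities are $m_j=\rho_jT$ with constants $\rho_j>0$. Arrivals in different periods are independent: in each period the customer has type $i$ with probability $\lambda_i$, and nobody arrives with probability $1-\sum_i\lambda_i\ge 0$. Let $\Lambda_i(T)$ be the number of type $i$ arrivals. The hindsight optimum is $\mathrm{Rev}^\star=\max\{\sum_i r_ix_i:\ \sum_iA_{ij}x_i\le m_j\ \forall j,\ 0\le x_i\le\Lambda_i(T)\ \forall i\}$, and the regret of an algorithm is $\mathbb E[\mathrm{Rev}^\star]$ minus its expected revenue. **Fairness.** An algorithm is $(\alpha,\delta)$-fair if on every arrival sequence and for every type $i$ there is an event $E$ of the algorithm's internal randomness with $\mathbb P(E)\ge 1-\delta$ such that, for the $u$-th and $v$-th type $i$ customers, for all $u,v$, $\mathbb P(E\cap\{v\text{ is accepted and }u\text{ is rejected}\})\le\alpha|u-v|$. **BPC-OGD** with horizon $H$, capacities $\rho_jH$ and parameters $G,D,\bar\theta>0$. Start from prices $\theta=0$.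 In each period, stop for good (rejecting everybody from then on) if the remaining capacities $m_j(t)$ do not suffice for some customer type. Otherwise accept an arriving type $i$ customer iff $r_i>\sum_j\theta_jA_{ij}$; let $y_t\in\{0,1\}$ be the decision ($y_t=0$ if nobody arrives). Then replace each $\theta_j$ by the projection to $[0,\bar\theta]$ of $\theta_j-\frac{D}{G\sqrt H}(b_j-y_tA_{ij})$. Here the budget $b_j$ is, throughout, either $m_j(t)/H$ or the initial capacity divided by $H$, i.e. $\rho_j$; the theorem holds for both variants. **GP-Enhanced-BPC-OGD** with horizon $T$ and parameters $\alpha,\delta$. Let $N=\lfloor T^{2/3}\rfloor$ and $\gamma=\log_{1-\alpha}\delta$. 1. Reject everybody in the first $N$ periods. Let $\Lambda_i$ be the number of type $i$ arrivals in them, and $u_i$ the number of type $i$ customers that BPC-OGD with horizon $N$ (capacities $\rho_jN$) accepts on these arrivals. The estimates are $\hat\lambda_i=\Lambda_i/N$ and $\hat x_i=u_i/N$. 2. Cut the remaining periods into consecutive segments of length $N$ (the last one is cut off at $T$). At the beginning of each segment draw independently $y_i=z_i+\mathrm{Bin}(N\hat\lambda_i,\hat x_i/\hat\lambda_i)=z_i+\mathrm{Bin}(\Lambda_i,u_i/\Lambda_i)$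 for each $i$, where $z_i$ is the number of rejections among the first $y_i$ (the previous draw) type $i$ customers of the preceding segment, and $z_i=0$ for the first segment. 3. The $k$-th type $i$ customer of a segment is in an increasing grace period if $k<y_i-\bar an\gamma$ and in a decreasing one if $k\ge y_i-\bar an\gamma$. As soon as $\min_jm_j(t)\le\bar an\gamma$, all types are in a decreasing grace period until the end of the horizon. 4. In an increasing grace period a customer is accepted if the previous customer of the same type was accepted, and with probability $\alpha$ otherwise. In a decreasing one it is accepted with probability $1-\alpha$ if the previous customer of the same type was accepted, and rejected otherwise. If a type has had no previous customer, the previous decision counts as a rejection. A customer whose request exceeds the remaining capacity is rejected. **Theorem.** Suppose that the inputs are in general position (for every price vector $p\in\mathbb R^L$ at most $L$ types satisfy $r_i=\sum_jp_jA_{ij}$), and that BPC-OGD with horizon and capacities $T,\ \rho_jT$ has regret $O(\sqrt T)$ as $T\to\infty$. Let $\alpha\in(0,1)$ and $\delta=1/T$. Then GP-Enhanced-BPC-OGD (i) is $(\alpha,\delta)$-fair for all sufficiently large $T$, and (ii) has regret $O(T^{2/3}\log T)$. -/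

import Mathlib

open MeasureTheory Filter Asymptotics

noncomputable section

namespace NetworkRM

/-- The arrival in one period: `some i` is a customer of type `i`, `none` means no arrival. -/
abbrev Arrival (n : ℕ) : Type := Option (Fin n)

instance instMeasurableSpaceArrival (n : ℕ) : MeasurableSpace (Arrival n) := ⊤

instance instDiscreteArrival (n : ℕ) : DiscreteMeasurableSpace (Arrival n) := ⟨fun _ => trivial⟩

/-- A network revenue management problem with `n` customer types and `L` resources.  At horizon `T`
resource `j` has capacity `ρ j * T`, so that all capacities scale linearly with `T`. -/
structure Problem (n L : ℕ) where
  /-- `A i j` is the number of units of resource `j` requested by a customer of type `i`. -/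
  A : Fin n → Fin L → ℝ
  /-- `r i` is the revenue of accepting a customer of type `i`. -/
  r : Fin n → ℝ
  /-- `lam i` is the probability that the customer of a given period has type `i`. -/
  lam : Fin n → ℝ
  /-- capacity per period -/
  ρ : Fin L → ℝ
  /-- the known upper bound on the entries of `A` -/
  abar : ℝ
  A_nonneg : ∀ i j, 0 ≤ A i j
  A_le : ∀ i j, A i j ≤ abar
  abar_pos : 0 < abar
  r_nonneg : ∀ i, 0 ≤ r i
  lam_nonneg : ∀ i, 0 ≤ lam i
  lam_sum : ∑ i, lam i ≤ 1
  ρ_pos : ∀ j, 0 < ρ j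

variable {n L : ℕ}

namespace Problem

/-- Non-degeneracy (the inputs are in general position): for every price vector `p`, at most `L`
customer types `i` satisfy `∑ j, p j * A i j = r i`. -/
def GeneralPosition (I : Problem n L) : Prop :=
  ∀ p : Fin L → ℝ, {i : Fin n | ∑ j, p j * I.A i j = I.r i}.ncard ≤ L

/-- Probability of each outcome of a single period; no arrival has probability `1 - ∑ i, lam i`. -/
def arrivalWeight (I : Problem n L) : Arrival n → ℝ
  | none => 1 - ∑ i, I.lam i
  | some i => I.lam i

theorem arrivalWeight_sum (I : Problem n L) :
    ∑ x : Arrival n, ENNReal.ofReal (I.arrivalWeight x) = 1 := by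
  have h0 : ∀ x : Arrival n, 0 ≤ I.arrivalWeight x := by
    intro x
    cases x with
    | none => simpa [arrivalWeight] using I.lam_sum
    | some i => exact I.lam_nonneg i
  rw [← ENNReal.ofReal_sum_of_nonneg (fun x _ => h0 x), Fintype.sum_option]
  simp [arrivalWeight]

/-- The law of the arrival in one period. -/
def arrivalPMF (I : Problem n L) : PMF (Arrival n) :=
  PMF.ofFintype (fun x => ENNReal.ofReal (I.arrivalWeight x)) I.arrivalWeight_sum

/-- The arrivals in periods `0, 1, 2, …` are independent and identically distributed. -/
def arrivalLaw (I : Problem n L) : Measure (ℕ → Arrival n) :=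
  Measure.infinitePi fun _ : ℕ => I.arrivalPMF.toMeasure

end Problem

/-- `numArrivals a i T` is the number of type `i` customers in periods `0, …, T - 1`. -/
def numArrivals (a : ℕ → Arrival n) (i : Fin n) (T : ℕ) : ℕ :=
  Nat.count (fun t => a t = some i) T

/-- Internal randomness of an algorithm: a family of numbers in `[0, 1]`. The coordinate `inl t` is
used for the decision in period `t`; the coordinates `inr (k, i, l)` are used for the binomial
sample of segment `k` and type `i`. -/
abbrev Coins (n : ℕ) : Type := ℕ ⊕ (ℕ × Fin n × ℕ) → unitInterval

/-- The coins are independent and uniform on `[0, 1]`. -/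
def coinLaw (n : ℕ) : Measure (Coins n) :=
  Measure.infinitePi fun _ : ℕ ⊕ (ℕ × Fin n × ℕ) => (volume : Measure unitInterval)

/-- The decisions of an algorithm: `alg a c t = true` if, on the arrival sequence `a` and with the
coins `c`, the algorithm accepts the customer (if any) of period `t`. -/
abbrev Algorithm (n : ℕ) : Type := (ℕ → Arrival n) → Coins n → ℕ → Bool

/-- Revenue collected in periods `0, …, T - 1` on the arrivals `a` by the decisions `acc`. -/
def revenue (I : Problem n L) (a : ℕ → Arrival n) (acc : ℕ → Bool) (T : ℕ) : ℝ :=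
  ∑ t ∈ Finset.range T,
    match a t with
    | none => 0
    | some i => if acc t then I.r i else 0

/-- The hindsight optimum: the optimal value of the linear program in which the number of arrivals
of each type during the horizon `T` is known. -/
def hindsight (I : Problem n L) (a : ℕ → Arrival n) (T : ℕ) : ℝ :=
  sSup {v | ∃ x : Fin n → ℝ,
    (∀ i, 0 ≤ x i ∧ x i ≤ numArrivals a i T) ∧
    (∀ j, ∑ i, I.A i j * x i ≤ I.ρ j * T) ∧
    v = ∑ i, I.r i * x i}

/-- Expected hindsight optimum minus expected revenue of the algorithm. -/
def regret (I : Problem n L) (alg : Algorithm n) (T : ℕ) : ℝ :=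
  (∫ a, hindsight I a T ∂I.arrivalLaw) -
    ∫ q : (ℕ → Arrival n) × Coins n, revenue I q.1 (alg q.1 q.2) T ∂(I.arrivalLaw.prod (coinLaw n))

/-- The period in which the `u`-th customer of type `i` (counted from `0`) arrives. -/
def arrivalTime (a : ℕ → Arrival n) (i : Fin n) (u : ℕ) : ℕ :=
  Nat.nth (fun t => a t = some i) u

/-- `(α, δ)`-fairness at horizon `T`. On every arrival sequence and for each type `i`, with
probability at least `1 - δ` (that is, on an event `E` of at least this probability), for any two
customers `u`, `v` of type `i` the probability that `v` is accepted and `u` is rejected is at most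
`α * |u - v|`. -/
def IsFair (alg : Algorithm n) (T : ℕ) (α δ : ℝ) : Prop :=
  ∀ (a : ℕ → Arrival n) (i : Fin n), ∃ E : Set (Coins n),
    MeasurableSet E ∧ 1 - δ ≤ (coinLaw n).real E ∧
    ∀ u v : ℕ, u < numArrivals a i T → v < numArrivals a i T →
      (coinLaw n).real
          (E ∩ {c | alg a c (arrivalTime a i v) = true ∧ alg a c (arrivalTime a i u) = false})
        ≤ α * |(u : ℝ) - (v : ℝ)|

/-! ### Bid price control with online gradient descent -/

/-- Budget per period in the subgradient: remaining capacity over the horizon, `m_j(t) / T`, or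
initial capacity over the horizon, `m_j / T`. -/
inductive BudgetRule
  | remaining
  | initial

/-- Parameters of the input BPC-OGD algorithm. -/
structure OGDParams where
  G : ℝ
  D : ℝ
  thetaBar : ℝ
  G_pos : 0 < G
  D_pos : 0 < D
  thetaBar_pos : 0 < thetaBar
  rule : BudgetRule

/-- State of BPC-OGD before a period: dual prices and remaining capacity. -/
structure BPCState (L : ℕ) where
  theta : Fin L → ℝ
  cap : Fin L → ℝ

/-- BPC-OGD goes on as long as the remaining capacity suffices for every customer type. -/
def bpcRunning (I : Problem n L) (s : BPCState L) : Bool :=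
  decide (∀ i j, I.A i j ≤ s.cap j)

/-- The indicator `y_t`: the revenue of the arriving customer exceeds the aggregated bid price. -/
def bpcBid (I : Problem n L) (s : BPCState L) : Arrival n → Bool
  | none => false
  | some i => decide (∑ j, s.theta j * I.A i j < I.r i)

/-- The amount `y_t * A i j` of resource `j` sold in a period. -/
def bpcUse (I : Problem n L) (s : BPCState L) (x : Arrival n) (j : Fin L) : ℝ :=
  match x with
  | none => 0
  | some i => if bpcBid I s (some i) then I.A i j else 0

/-- Budget per period of resource `j` used in the subgradient at horizon `H`. -/
def bpcBudget (I : Problem n L) (P : OGDParams) (H : ℕ) (s : BPCState L) (j : Fin L) : ℝ :=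
  match P.rule with
  | BudgetRule.remaining => s.cap j / H
  | BudgetRule.initial => I.ρ j * H / H

/-- One period of BPC-OGD with horizon `H`: the subgradient of
`g_t(θ) = ∑ j, θ j * (budget j - y_t * A i j)` is followed with step size `D / (G * √H)`, and the
prices are projected to `[0, thetaBar]`. -/
def bpcStep (I : Problem n L) (P : OGDParams) (H : ℕ) (x : Arrival n) (s : BPCState L) :
    BPCState L :=
  if bpcRunning I s then
    { theta := fun j =>
        min (max 0 (s.theta j - P.D / (P.G * √(H : ℝ)) * (bpcBudget I P H s j - bpcUse I s x j)))
          P.thetaBar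
      cap := fun j => s.cap j - bpcUse I s x j }
  else s

/-- State of BPC-OGD with horizon `H` before period `t`. -/
def bpcState (I : Problem n L) (P : OGDParams) (H : ℕ) (a : ℕ → Arrival n) : ℕ → BPCState L
  | 0 => { theta := fun _ => 0, cap := fun j => I.ρ j * H }
  | t + 1 => bpcStep I P H (a t) (bpcState I P H a t)

/-- BPC-OGD with horizon `H` (capacities `ρ j * H`), a deterministic algorithm. -/
def bpcOGD (I : Problem n L) (P : OGDParams) (H : ℕ) : Algorithm n := fun a _ t =>
  bpcRunning I (bpcState I P H a t) && bpcBid I (bpcState I P H a t) (a t)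

/-! ### GP-Enhanced-BPC-OGD -/

/-- Length `T ^ (2/3)` (rounded down) of the estimation phase and of each segment. -/
def segLen (T : ℕ) : ℕ := ⌊(T : ℝ) ^ (2 / 3 : ℝ)⌋₊

/-- `γ = log_{1-α} δ`. -/
def graceLen (α δ : ℝ) : ℝ := Real.logb (1 - α) δ

/-- Number `u_i` of type `i` customers accepted by the auxiliary run of BPC-OGD on the first
`segLen T` periods. -/
def auxAccepted (I : Problem n L) (P : OGDParams) (T : ℕ) (a : ℕ → Arrival n) (i : Fin n) : ℕ :=
  {t ∈ Finset.range (segLen T) |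
    a t = some i ∧
      (bpcRunning I (bpcState I P (segLen T) a t) &&
        bpcBid I (bpcState I P (segLen T) a t) (a t)) = true}.card

/-- Sample of the binomial distribution with `N * λ_i = Λ_i` trials and success probability
`x_i / λ_i = u_i / Λ_i`, where `N = segLen T`, `λ_i = Λ_i / N` and `x_i = u_i / N` are the estimates
made in the first `N` periods; segment `k` uses its own independent coins. -/
def segSample (I : Problem n L) (P : OGDParams) (T : ℕ) (a : ℕ → Arrival n) (c : Coins n)
    (k : ℕ) (i : Fin n) : ℕ :=
  {l ∈ Finset.range (numArrivals a i (segLen T)) |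
    (c (Sum.inr (k, i, l)) : ℝ) <
      (auxAccepted I P T a i : ℝ) / (numArrivals a i (segLen T) : ℝ)}.card

/-- State of the algorithm before a period. -/
structure GPState (n L : ℕ) where
  /-- remaining capacities `m_j(t)` -/
  cap : Fin L → ℝ
  /-- decision on the most recent customer of each type (rejection if there was none) -/
  prev : Fin n → Bool
  /-- the target `y_i` of the current segment -/
  quota : Fin n → ℕ
  /-- number of type `i` customers that have arrived in the current segment -/
  seen : Fin n → ℕ
  /-- number of rejections among the first `y_i` type `i` customers of the current segment -/
  rej : Fin n → ℕ
  /-- whether the decreasing grace period until the end of the horizon has started -/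
  closing : Bool

/-- Bookkeeping at the beginning of period `t`: if a new segment starts, draw `y_i` as the sum of
the number of rejections recorded in the previous segment and a fresh binomial sample; start the
closing grace period if some remaining capacity is at most `abar * n * γ`. -/
def gpOpen (I : Problem n L) (P : OGDParams) (α δ : ℝ) (T : ℕ) (a : ℕ → Arrival n) (c : Coins n)
    (t : ℕ) (s : GPState n L) : GPState n L :=
  let s' : GPState n L :=
    if segLen T ∣ t then
      { s with
        quota := fun i => s.rej i + segSample I P T a c (t / segLen T) i
        seen := fun _ => 0
        rej := fun _ => 0 }
    else s
  { s' with
    closing := s'.closing || decide (∃ j, s'.cap j - I.abar * n * graceLen α δ ≤ 0) }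

/-- Decision on a customer of type `i`, given the state `s` after the bookkeeping and a uniform
number `z`. The customer is in a decreasing grace period if the closing grace period has started or
if it is the `k`-th type `i` customer of the segment with `k ≥ y_i - abar * n * γ`; otherwise it is
in an increasing grace period. A customer can be accepted only if the capacities suffice. -/
def gpDecide (I : Problem n L) (α δ : ℝ) (z : ℝ) (s : GPState n L) (i : Fin n) : Bool :=
  let decreasing : Bool :=
    s.closing ||
      decide ((s.quota i : ℝ) - I.abar * n * graceLen α δ ≤ ((s.seen i + 1 : ℕ) : ℝ))
  (if decreasing then s.prev i && decide (z < 1 - α) else s.prev i || decide (z < α)) &&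
    decide (∀ j, I.A i j ≤ s.cap j)

/-- Update after the decision `acc` on the arrival `x`. -/
def gpUpdate (I : Problem n L) (s : GPState n L) (x : Arrival n) (acc : Bool) : GPState n L :=
  match x with
  | none => s
  | some i =>
    { s with
      cap := fun j => if acc then s.cap j - I.A i j else s.cap j
      prev := Function.update s.prev i acc
      seen := Function.update s.seen i (s.seen i + 1)
      rej := Function.update s.rej i
        (if acc = false ∧ s.seen i + 1 ≤ s.quota i then s.rej i + 1 else s.rej i) }

/-- Decision in period `t` in the state `s` before the period. -/
def gpAccept (I : Problem n L) (P : OGDParams) (α δ : ℝ) (T : ℕ) (a : ℕ → Arrival n) (c : Coins n)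
    (t : ℕ) (s : GPState n L) : Bool :=
  match a t with
  | none => false
  | some i => gpDecide I α δ (c (Sum.inl t)) (gpOpen I P α δ T a c t s) i

/-- State before period `t`. In the first `segLen T` periods everybody is rejected. -/
def gpState (I : Problem n L) (P : OGDParams) (α δ : ℝ) (T : ℕ) (a : ℕ → Arrival n) (c : Coins n) :
    ℕ → GPState n L
  | 0 =>
    { cap := fun j => I.ρ j * T
      prev := fun _ => false
      quota := fun _ => 0
      seen := fun _ => 0
      rej := fun _ => 0
      closing := false }
  | t + 1 =>
    if t < segLen T then gpState I P α δ T a c t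
    else
      gpUpdate I (gpOpen I P α δ T a c t (gpState I P α δ T a c t)) (a t)
        (gpAccept I P α δ T a c t (gpState I P α δ T a c t))

/-- GP-Enhanced-BPC-OGD at horizon `T` with fairness parameters `α`, `δ`. -/
def gpEnhancedBPCOGD (I : Problem n L) (P : OGDParams) (α δ : ℝ) (T : ℕ) : Algorithm n :=
  fun a c t => decide (segLen T ≤ t) && gpAccept I P α δ T a c t (gpState I P α δ T a c t)

end NetworkRM

end

/-! Fairness. Fix a type. By the grace period rules, an acceptance after a rejection needs a coin
below `α`, and a rejection after an acceptance needs a coin that is at least `1 - α`. Each such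
change has probability at most `α`, and if two customers are treated differently, a change occurs at
one of the customers between them, so a union bound gives `α * |u - v|`. The only other cause of a
rejection is a lack of capacity, which can occur only in the closing grace period. That period
starts with more than `graceWidth - abar` units of every resource. During it a rejection of a type
is final, so a type gets more than `M` acceptances with probability at most `(1 - α) ^ M`. On the
event `shortRuns` all other types stay within `M` acceptances, and type `i` runs out of capacity
only if its own first `m` closing customers were all accepted. This extra rejection probability is
paid for exactly: in the same situation the previous customer is, with high probability, already
rejected, and then no change to a rejection is possible (`real_shortRuns_inter_le`). The width `abar
* n * γ` leaves room for `M` slightly above `γ`, which absorbs the union bound over the types and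
keeps the exceptional probability below `1 / T`.

Regret. Write `N = segLen T` and `K = T / N`. The auxiliary run is BPC-OGD at horizon `N`, so by
assumption its revenue is within `O(√N)` of the hindsight optimum for `N` periods, and a scaled
solution of the linear program shows that the optimum for `T` periods is at most `T / N` times the
one for `N` periods, up to fluctuations of order `√N` per segment (`hindsight_le_scaled`). It
remains to show, path by path, that the algorithm collects `T / N` times the auxiliary revenue up to
`lostRevenue` (`le_accepted_add_lostRevenue`). Two potential arguments compare acceptances with the
sum of the binomial samples: `accepted_add_le` shows that capacity is not used up too early,
`le_accepted_add` that targets are met while the closing period has not begun. The errors are sample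
and arrival fluctuations (`√N` per segment), grace periods (`graceWidth + 1` per segment), and
waiting times for a change of decision, which have mean at most `1 / α` per segment because every
wait ends at the first favourable coin. In total this is `N + K * (√N + log T)` up to constants, and
`N = T ^ (2/3)` balances the terms. -/

noncomputable section

namespace NetworkRM

/-! ### One-step dynamics of the algorithm and capacity bookkeeping. -/

section Dynamics

variable {n L : ℕ} (I : Problem n L) (P : OGDParams) (α δ : ℝ) (T : ℕ) (a : ℕ → Arrival n)

/-- State in period `t` after the bookkeeping at its beginning. -/
def opened (c : Coins n) (t : ℕ) : GPState n L :=
  gpOpen I P α δ T a c t (gpState I P α δ T a c t)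

/-- Decision in period `t` (after the first `segLen T` periods). -/
def decision (c : Coins n) (t : ℕ) : Bool :=
  gpAccept I P α δ T a c t (gpState I P α δ T a c t)

/-- Length `abar * n * γ` of a decreasing grace period. -/
def graceWidth : ℝ := I.abar * n * graceLen α δ

/-- Number of rejections among the first `y_i` customers after period `t`. -/
def rejNext (c : Coins n) (t : ℕ) (i : Fin n) : ℕ :=
  if a t = some i ∧ decision I P α δ T a c t = false ∧
      (opened I P α δ T a c t).seen i + 1 ≤ (opened I P α δ T a c t).quota i
    then (opened I P α δ T a c t).rej i + 1 else (opened I P α δ T a c t).rej i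

local notation "𝒪" => opened I P α δ T a
local notation "𝒟" => decision I P α δ T a
local notation "𝒢" => graceWidth I α δ

theorem gpState_of_le (c : Coins n) {t : ℕ} (ht : t ≤ segLen T) :
    gpState I P α δ T a c t = gpState I P α δ T a c 0 := by
  induction t with
  | zero => rfl
  | succ t ih =>
    rw [gpState.eq_def]
    simp only
    rw [if_pos (by omega), ih (by omega)]

theorem gpState_succ (c : Coins n) {t : ℕ} (ht : segLen T ≤ t) :
    gpState I P α δ T a c (t + 1) = gpUpdate I (𝒪 c t) (a t) (𝒟 c t) := by
  rw [gpState, if_neg (by omega)]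
  rfl

theorem decision_none (c : Coins n) {t : ℕ} (h : a t = none) : 𝒟 c t = false := by
  simp [decision, gpAccept, h]

theorem decision_some (c : Coins n) {t : ℕ} {i : Fin n} (h : a t = some i) :
    𝒟 c t = gpDecide I α δ (c (Sum.inl t)) (𝒪 c t) i := by
  simp [decision, gpAccept, h, opened]

theorem decision_iff (c : Coins n) {t : ℕ} {i : Fin n} (h : a t = some i) :
    𝒟 c t = true ↔
      (if (𝒪 c t).closing = true ∨ ((𝒪 c t).quota i : ℝ) - 𝒢 ≤ (𝒪 c t).seen i + 1 then
        (𝒪 c t).prev i = true ∧ (c (Sum.inl t) : ℝ) < 1 - α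
      else (𝒪 c t).prev i = true ∨ (c (Sum.inl t) : ℝ) < α) ∧
      ∀ j, I.A i j ≤ (𝒪 c t).cap j := by
  rw [decision_some I P α δ T a c h]
  unfold gpDecide graceWidth
  by_cases h1 : (𝒪 c t).closing = true ∨
    ((𝒪 c t).quota i : ℝ) - I.abar * n * graceLen α δ ≤ (𝒪 c t).seen i + 1
  · rw [if_pos h1]
    rcases h1 with h1 | h1 <;> simp [h1]
  · rw [if_neg h1]
    push Not at h1
    have h2 : (𝒪 c t).closing = false := by simpa using h1.1
    simp [h2, not_le.2 h1.2]

section Init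

variable (c : Coins n)

theorem opened_init_cap (j : Fin L) : (𝒪 c (segLen T)).cap j = I.ρ j * T := by
  simp [opened, gpOpen, gpState_of_le I P α δ T a c le_rfl, gpState]

theorem opened_init_prev (i : Fin n) : (𝒪 c (segLen T)).prev i = false := by
  simp [opened, gpOpen, gpState_of_le I P α δ T a c le_rfl, gpState]

theorem opened_init_seen (i : Fin n) : (𝒪 c (segLen T)).seen i = 0 := by
  simp [opened, gpOpen]

theorem opened_init_rej (i : Fin n) : (𝒪 c (segLen T)).rej i = 0 := by
  simp [opened, gpOpen]

theorem opened_init_quota (hN : 0 < segLen T) (i : Fin n) :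
    (𝒪 c (segLen T)).quota i = segSample I P T a c 1 i := by
  simp [opened, gpOpen, gpState_of_le I P α δ T a c le_rfl, gpState, Nat.div_self hN]

end Init

theorem opened_closing_iff (c : Coins n) (t : ℕ) :
    (𝒪 c t).closing = true ↔
      (gpState I P α δ T a c t).closing = true ∨ ∃ j, (𝒪 c t).cap j ≤ 𝒢 := by
  unfold opened gpOpen graceWidth
  split_ifs <;> simp

theorem opened_init_closing (c : Coins n) :
    (𝒪 c (segLen T)).closing = true ↔ ∃ j, (𝒪 c (segLen T)).cap j ≤ 𝒢 := by
  rw [opened_closing_iff, gpState_of_le I P α δ T a c le_rfl]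
  simp [gpState]

section Step

variable (c : Coins n) {t : ℕ}

theorem opened_succ_cap (ht : segLen T ≤ t) (j : Fin L) :
    (𝒪 c (t + 1)).cap j = (𝒪 c t).cap j -
      (match a t with | none => 0 | some i => if 𝒟 c t = true then I.A i j else 0) := by
  rw [opened, gpState_succ I P α δ T a c ht, gpOpen]
  cases h : a t with
  | none => split_ifs <;> simp [gpUpdate]
  | some i => split_ifs with h1 h2 <;> simp_all [gpUpdate]

theorem opened_succ_closing (ht : segLen T ≤ t) :
    (𝒪 c (t + 1)).closing = true ↔ (𝒪 c t).closing = true ∨ ∃ j, (𝒪 c (t + 1)).cap j ≤ 𝒢 := by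
  rw [opened_closing_iff, gpState_succ I P α δ T a c ht]
  cases h : a t <;> simp [gpUpdate]

theorem opened_succ_prev (ht : segLen T ≤ t) (i : Fin n) :
    (𝒪 c (t + 1)).prev i = if a t = some i then 𝒟 c t else (𝒪 c t).prev i := by
  rw [opened, gpState_succ I P α δ T a c ht, gpOpen]
  cases h : a t with
  | none => split_ifs <;> simp_all [gpUpdate]
  | some k =>
    by_cases hk : k = i
    · subst hk; split_ifs <;> simp_all [gpUpdate]
    · split_ifs <;> simp_all [gpUpdate, Function.update_of_ne (Ne.symm hk)]

theorem opened_succ_seen (ht : segLen T ≤ t) (i : Fin n) :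
    (𝒪 c (t + 1)).seen i = if segLen T ∣ t + 1 then 0
      else if a t = some i then (𝒪 c t).seen i + 1 else (𝒪 c t).seen i := by
  rw [opened, gpState_succ I P α δ T a c ht, gpOpen]
  cases h : a t with
  | none => split_ifs <;> simp_all [gpUpdate]
  | some k =>
    by_cases hk : k = i
    · subst hk; split_ifs <;> simp_all [gpUpdate]
    · split_ifs <;> simp_all [gpUpdate, Function.update_of_ne (Ne.symm hk)]

theorem opened_succ_rej (ht : segLen T ≤ t) (i : Fin n) :
    (𝒪 c (t + 1)).rej i = if segLen T ∣ t + 1 then 0 else rejNext I P α δ T a c t i := by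
  rw [opened, gpState_succ I P α δ T a c ht, gpOpen, rejNext]
  cases h : a t with
  | none => by_cases h1 : segLen T ∣ t + 1 <;> simp [gpUpdate, h1]
  | some k =>
    by_cases h1 : segLen T ∣ t + 1
    · simp [h1]
    · by_cases hk : k = i
      · subst hk; simp [gpUpdate, h1]
      · simp [gpUpdate, h1, hk, Function.update_of_ne (Ne.symm hk)]

theorem opened_succ_quota (ht : segLen T ≤ t) (i : Fin n) :
    (𝒪 c (t + 1)).quota i = if segLen T ∣ t + 1
      then rejNext I P α δ T a c t i + segSample I P T a c ((t + 1) / segLen T) i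
      else (𝒪 c t).quota i := by
  rw [opened, gpState_succ I P α δ T a c ht, gpOpen, rejNext]
  cases h : a t with
  | none => by_cases h1 : segLen T ∣ t + 1 <;> simp [gpUpdate, h1]
  | some k =>
    by_cases h1 : segLen T ∣ t + 1
    · by_cases hk : k = i
      · subst hk; simp [gpUpdate, h1]
      · simp [gpUpdate, h1, hk, Function.update_of_ne (Ne.symm hk)]
    · simp [gpUpdate, h1]

end Step

theorem lt_cap_of_not_closing (c : Coins n) {t : ℕ} (h : (𝒪 c t).closing = false) (j : Fin L) :
    𝒢 < (𝒪 c t).cap j := by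
  by_contra hj
  have : (𝒪 c t).closing = true :=
    (opened_closing_iff I P α δ T a c t).2 (Or.inr ⟨j, not_lt.1 hj⟩)
  simp [this] at h

theorem closing_mono (c : Coins n) {s t : ℕ} (hs : segLen T ≤ s) (hst : s ≤ t)
    (h : (𝒪 c s).closing = true) : (𝒪 c t).closing = true := by
  induction t, hst using Nat.le_induction with
  | base => exact h
  | succ t hst ih => exact (opened_succ_closing I P α δ T a c (hs.trans hst)).2 (Or.inl ih)

/-- Capacities never increase, so the resource that triggered the closing period remains scarce. -/
theorem exists_cap_le_of_closing (c : Coins n) {t : ℕ} (ht : segLen T ≤ t)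
    (h : (𝒪 c t).closing = true) : ∃ j, (𝒪 c t).cap j ≤ 𝒢 := by
  induction t, ht using Nat.le_induction with
  | base => exact (opened_init_closing I P α δ T a c).1 h
  | succ t ht ih =>
    rcases (opened_succ_closing I P α δ T a c ht).1 h with h | h
    · obtain ⟨j, hj⟩ := ih h
      refine ⟨j, le_trans ?_ hj⟩
      rw [opened_succ_cap I P α δ T a c ht]
      have := I.A_nonneg
      rcases a t with _ | i
      · simp
      · simp only [sub_le_self_iff]
        split_ifs <;> simp [this]
    · exact h

/-- A type `i` customer arrives in period `t` and is accepted. -/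
def acceptEvent (i : Fin n) (t : ℕ) : Set (Coins n) := {c | a t = some i ∧ 𝒟 c t = true}

/-- A type `i` customer arrives in an increasing grace period, the previous one was rejected. -/
def waitEvent (i : Fin n) (t : ℕ) : Set (Coins n) :=
  {c | a t = some i ∧ (𝒪 c t).closing = false ∧
    ((𝒪 c t).seen i : ℝ) + 1 < (𝒪 c t).quota i - 𝒢 ∧ (𝒪 c t).prev i = false}

/-- A type `i` customer arrives when the target of the segment has been passed, and the previous one
was accepted. -/
def tailEvent (i : Fin n) (t : ℕ) : Set (Coins n) :=
  {c | a t = some i ∧ (𝒪 c t).quota i < (𝒪 c t).seen i + 1 ∧ (𝒪 c t).prev i = true}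

/-- Number of periods in `[segLen T, t)` in which the event happens. -/
def occ (E : ℕ → Set (Coins n)) (c : Coins n) (t : ℕ) : ℝ :=
  ∑ s ∈ Finset.Ico (segLen T) t, (E s).indicator 1 c

theorem occ_init (E : ℕ → Set (Coins n)) (c : Coins n) : occ T E c (segLen T) = 0 := by
  simp [occ]

theorem occ_succ (E : ℕ → Set (Coins n)) (c : Coins n) {t : ℕ} (ht : segLen T ≤ t) :
    occ T E c (t + 1) = occ T E c t + (E t).indicator 1 c := by
  simp [occ, Finset.sum_Ico_succ_top ht]

theorem occ_mono (E : ℕ → Set (Coins n)) (c : Coins n) {s t : ℕ} (h : s ≤ t) :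
    occ T E c s ≤ occ T E c t :=
  Finset.sum_le_sum_of_subset_of_nonneg (Finset.Ico_subset_Ico le_rfl h)
    fun _ _ _ => Set.indicator_nonneg (fun _ _ => zero_le_one) _

theorem occ_nonneg (E : ℕ → Set (Coins n)) (c : Coins n) (t : ℕ) : 0 ≤ occ T E c t :=
  Finset.sum_nonneg fun _ _ => Set.indicator_nonneg (fun _ _ => zero_le_one) _

/-- Number of type `i` customers in the periods `s, …, t - 1`. -/
def arrivalsIn (a : ℕ → Arrival n) (i : Fin n) (s t : ℕ) : ℝ :=
  ∑ u ∈ Finset.Ico s t, if a u = some i then 1 else 0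

theorem cap_eq (c : Coins n) {t : ℕ} (ht : segLen T ≤ t) (j : Fin L) :
    (𝒪 c t).cap j =
      I.ρ j * T - ∑ i, I.A i j * occ T (acceptEvent I P α δ T a i) c t := by
  induction t, ht using Nat.le_induction with
  | base => simp [occ_init, opened_init_cap I P α δ T a]
  | succ t ht ih =>
    rw [opened_succ_cap I P α δ T a c ht, ih]
    simp only [occ_succ T _ c ht, mul_add, Finset.sum_add_distrib]
    rw [← sub_sub]
    congr 1
    cases h : a t with
    | none => simp [acceptEvent, h]
    | some k =>
      rw [Finset.sum_eq_single k]
      · by_cases hd : 𝒟 c t = true <;> simp [acceptEvent, h, hd, Set.indicator]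
      · intro i _ hi
        simp [acceptEvent, h, hi.symm, Set.indicator]
      · simp

theorem cap_nonneg (c : Coins n) {t : ℕ} (ht : segLen T ≤ t) (j : Fin L) :
    0 ≤ (𝒪 c t).cap j := by
  induction t, ht using Nat.le_induction with
  | base =>
    rw [opened_init_cap I P α δ T a]
    have := I.ρ_pos j
    positivity
  | succ t ht ih =>
    rw [opened_succ_cap I P α δ T a c ht]
    cases h : a t with
    | none => simpa using ih
    | some k =>
      by_cases hd : 𝒟 c t = true
      · simpa [hd] using ((decision_iff I P α δ T a c h).1 hd).2 j
      · simpa [hd] using ih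

end Dynamics

/-! ### Potential arguments relating acceptances, targets and carried-over rejections. -/

section Invariants

variable {n L : ℕ} (I : Problem n L) (P : OGDParams) (α δ : ℝ) (T : ℕ) (a : ℕ → Arrival n)

local notation "𝒪" => opened I P α δ T a
local notation "𝒟" => decision I P α δ T a
local notation "𝒢" => graceWidth I α δ

/-- Before closing, every capacity exceeds `graceWidth ≥ abar`, so the capacity check passes and
only the coin rule matters. -/
theorem decision_of_not_closing (hG : I.abar ≤ 𝒢) (c : Coins n) {t : ℕ} {i : Fin n}
    (h : a t = some i) (hc : (𝒪 c t).closing = false)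
    (hs : ((𝒪 c t).seen i : ℝ) + 1 < (𝒪 c t).quota i - 𝒢) :
    𝒟 c t = true ↔ (𝒪 c t).prev i = true ∨ (c (Sum.inl t) : ℝ) < α := by
  rw [decision_iff I P α δ T a c h, if_neg (by simp only [hc, Bool.false_eq_true, false_or, not_le]; exact hs)]
  refine and_iff_left fun j => (I.A_le i j).trans (hG.trans ?_)
  exact (lt_cap_of_not_closing I P α δ T a c hc j).le

theorem prev_of_decision_of_quota_lt (hG : 0 ≤ 𝒢) (c : Coins n) {t : ℕ} {i : Fin n}
    (h : a t = some i) (hs : (𝒪 c t).quota i < (𝒪 c t).seen i + 1) (hd : 𝒟 c t = true) :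
    (𝒪 c t).prev i = true ∧ (c (Sum.inl t) : ℝ) < 1 - α := by
  have h1 := ((decision_iff I P α δ T a c h).1 hd).1
  rw [if_pos] at h1
  · exact h1
  · right
    have : ((𝒪 c t).quota i : ℝ) < (𝒪 c t).seen i + 1 := by exact_mod_cast hs
    linarith

theorem sum_Icc_div_succ (f : ℕ → ℝ) {N : ℕ} (t : ℕ) :
    ∑ k ∈ Finset.Icc 1 ((t + 1) / N), f k =
      ∑ k ∈ Finset.Icc 1 (t / N), f k + if N ∣ t + 1 then f ((t + 1) / N) else 0 := by
  rw [Nat.succ_div]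
  split_ifs with h
  · rw [Finset.sum_Icc_succ_top (Nat.le_add_left _ _)]
  · simp

/-- The left side is a potential: acceptances so far, rejections to be carried over, and the open
part of the target. A customer within the target turns one unit of the open part into an acceptance
or a carried rejection. Beyond the target an acceptance is a tail event. A new segment adds at most
its sample. -/
theorem accepted_add_le (hN : 0 < segLen T) (hG : 0 ≤ 𝒢) (i : Fin n) (c : Coins n) {t : ℕ}
    (ht : segLen T ≤ t) :
    occ T (acceptEvent I P α δ T a i) c t + (𝒪 c t).rej i +
        max 0 (((𝒪 c t).quota i : ℝ) - (𝒪 c t).seen i) ≤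
      ∑ k ∈ Finset.Icc 1 (t / segLen T), (segSample I P T a c k i : ℝ) +
        occ T (tailEvent I P α δ T a i) c t := by
  induction t, ht using Nat.le_induction with
  | base =>
    simp [occ_init, opened_init_rej, opened_init_seen, opened_init_quota I P α δ T a c hN,
      Nat.div_self hN]
  | succ t ht ih =>
    have key : occ T (acceptEvent I P α δ T a i) c (t + 1) + rejNext I P α δ T a c t i +
        max 0 (((𝒪 c t).quota i : ℝ) -
          (if a t = some i then (𝒪 c t).seen i + 1 else (𝒪 c t).seen i : ℕ)) ≤
      ∑ k ∈ Finset.Icc 1 (t / segLen T), (segSample I P T a c k i : ℝ) +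
        occ T (tailEvent I P α δ T a i) c (t + 1) := by
      rw [occ_succ T _ c ht, occ_succ T _ c ht]
      by_cases h : a t = some i
      · rw [rejNext]
        by_cases hq : (𝒪 c t).seen i + 1 ≤ (𝒪 c t).quota i
        · have hq' : ((𝒪 c t).seen i : ℝ) + 1 ≤ (𝒪 c t).quota i := by exact_mod_cast hq
          have hte : c ∉ tailEvent I P α δ T a i t := fun hc => by
            have := hc.2.1
            omega
          rw [max_eq_right (by linarith)] at ih
          by_cases hd : 𝒟 c t = true
          · have hae : c ∈ acceptEvent I P α δ T a i t := ⟨h, hd⟩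
            simp only [h, hq, hd, Set.indicator_of_mem hae, Set.indicator_of_notMem hte]
            simp only [if_true, Bool.true_eq_false, false_and, and_false, if_false, Pi.one_apply]
            push_cast
            rw [max_eq_right (by linarith)]
            linarith
          · have hae : c ∉ acceptEvent I P α δ T a i t := fun hc => hd hc.2
            simp only [h, hq, hd, Set.indicator_of_notMem hae, Set.indicator_of_notMem hte]
            simp only [if_true, and_true]
            push_cast
            rw [max_eq_right (by linarith)]
            linarith
        · have hq' : ((𝒪 c t).quota i : ℝ) < (𝒪 c t).seen i + 1 := by exact_mod_cast not_le.1 hq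
          have h0 := le_max_left 0 (((𝒪 c t).quota i : ℝ) - (𝒪 c t).seen i)
          simp only [h, hq, and_false, if_false, if_true]
          push_cast
          rw [max_eq_left (by linarith)]
          by_cases hd : 𝒟 c t = true
          · have hae : c ∈ acceptEvent I P α δ T a i t := ⟨h, hd⟩
            have hte : c ∈ tailEvent I P α δ T a i t :=
              ⟨h, not_le.1 hq,
                (prev_of_decision_of_quota_lt I P α δ T a hG c h (not_le.1 hq) hd).1⟩
            simp only [Set.indicator_of_mem hae, Set.indicator_of_mem hte, Pi.one_apply]
            linarith
          · have hae : c ∉ acceptEvent I P α δ T a i t := fun hc => hd hc.2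
            have := Set.indicator_nonneg (s := tailEvent I P α δ T a i t)
              (fun _ _ => zero_le_one' ℝ) c
            simp only [Set.indicator_of_notMem hae]
            change _ ≤ _ + (_ + (tailEvent I P α δ T a i t).indicator (fun _ => (1 : ℝ)) c)
            linarith
      · have hae : c ∉ acceptEvent I P α δ T a i t := fun hc => h hc.1
        have hte : c ∉ tailEvent I P α δ T a i t := fun hc => h hc.1
        simp only [rejNext, h, false_and, if_false, Set.indicator_of_notMem hae,
          Set.indicator_of_notMem hte]
        linarith
    rw [opened_succ_rej I P α δ T a c ht, opened_succ_quota I P α δ T a c ht,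
      opened_succ_seen I P α δ T a c ht, sum_Icc_div_succ]
    by_cases hb : segLen T ∣ t + 1
    · simp only [if_pos hb]
      push_cast
      -- The new target consists of the carried rejections and the fresh sample. What was left open
      -- of the old target is discarded, which only lowers the potential.
      rw [max_eq_right (by rw [sub_zero]; positivity)]
      have := le_max_left 0 (((𝒪 c t).quota i : ℝ) -
          (if a t = some i then (𝒪 c t).seen i + 1 else (𝒪 c t).seen i : ℕ))
      linarith
    · simp only [if_neg hb, add_zero]
      exact key

theorem seen_eq (hN : 0 < segLen T) (i : Fin n) (c : Coins n) {t : ℕ} (ht : segLen T ≤ t) :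
    ((𝒪 c t).seen i : ℝ) = arrivalsIn a i (segLen T * (t / segLen T)) t := by
  induction t, ht using Nat.le_induction with
  | base => simp [opened_init_seen, Nat.div_self hN, arrivalsIn]
  | succ t ht ih =>
    rw [opened_succ_seen I P α δ T a c ht, Nat.succ_div]
    by_cases hb : segLen T ∣ t + 1
    · have : segLen T * (t / segLen T + 1) = t + 1 := by
        rw [← Nat.succ_div_of_dvd hb, Nat.mul_div_cancel' hb]
      simp [hb, this, arrivalsIn]
    · have h1 := Nat.mul_div_le t (segLen T)
      simp only [hb, if_false, add_zero, arrivalsIn]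
      rw [Finset.sum_Ico_succ_top h1]
      rw [arrivalsIn] at ih
      rw [← ih]
      split_ifs <;> push_cast <;> ring

/-- Along an open segment, the rejections among the first `quota` customers are those in the
increasing grace period and at most `graceWidth + 1` others. -/
theorem rejNext_le (hG : I.abar ≤ 𝒢) (i : Fin n) (c : Coins n) {t : ℕ}
    {w : ℝ} (hc : (𝒪 c t).closing = false)
    (h : ((𝒪 c t).rej i : ℝ) ≤ w +
      max 0 (min ((𝒪 c t).seen i : ℝ) ((𝒪 c t).quota i) - (𝒪 c t).quota i + 𝒢 + 1)) :
    (rejNext I P α δ T a c t i : ℝ) ≤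
      w + (waitEvent I P α δ T a i t).indicator 1 c +
      max 0 (min ((if a t = some i then (𝒪 c t).seen i + 1 else (𝒪 c t).seen i : ℕ) : ℝ)
        ((𝒪 c t).quota i) - (𝒪 c t).quota i + 𝒢 + 1) := by
  have h01 : (0 : ℝ) ≤ (waitEvent I P α δ T a i t).indicator 1 c :=
    Set.indicator_nonneg (fun _ _ => zero_le_one' ℝ) c
  have hmono : max 0 (min ((𝒪 c t).seen i : ℝ) ((𝒪 c t).quota i) - (𝒪 c t).quota i + 𝒢 + 1) ≤
      max 0 (min ((if a t = some i then (𝒪 c t).seen i + 1 else (𝒪 c t).seen i : ℕ) : ℝ)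
        ((𝒪 c t).quota i) - (𝒪 c t).quota i + 𝒢 + 1) := by
    gcongr
    split_ifs <;> simp
  rw [rejNext]
  by_cases hr : a t = some i ∧ 𝒟 c t = false ∧ (𝒪 c t).seen i + 1 ≤ (𝒪 c t).quota i
  · rw [if_pos hr]
    obtain ⟨ha, hd, hq⟩ := hr
    have hq' : ((𝒪 c t).seen i : ℝ) + 1 ≤ (𝒪 c t).quota i := by exact_mod_cast hq
    simp only [ha, if_true] at hmono ⊢
    push_cast at hmono ⊢
    by_cases hs : ((𝒪 c t).seen i : ℝ) + 1 < (𝒪 c t).quota i - 𝒢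
    -- In the increasing period an accepted predecessor forces acceptance, so this rejection is a
    -- waiting customer.
    · have hp : (𝒪 c t).prev i = false := by
        by_contra hp
        have := (decision_of_not_closing I P α δ T a hG c ha hc hs).2 (Or.inl (by simpa using hp))
        simp [this] at hd
      have hw : c ∈ waitEvent I P α δ T a i t := ⟨ha, hc, hs, hp⟩
      rw [Set.indicator_of_mem hw]
      simp only [Pi.one_apply]
      linarith
    · rw [min_eq_left hq']
      rw [min_eq_left (by linarith)] at h
      rcases max_cases 0 (((𝒪 c t).seen i : ℝ) - (𝒪 c t).quota i + 𝒢 + 1) with h2 | h2 <;>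
        have h3 := le_max_right 0 (((𝒪 c t).seen i : ℝ) + 1 - (𝒪 c t).quota i + 𝒢 + 1) <;>
        linarith
  · rw [if_neg hr]
    linarith

/-- The difference of the two `occ` terms counts the waiting customers since the start of the
segment. The maximum bounds the number of positions between `quota - graceWidth` and `quota` that
have been passed, all of which may be rejections. -/
theorem rej_le (hN : 0 < segLen T) (hG : I.abar ≤ 𝒢) (i : Fin n) (c : Coins n) {t : ℕ}
    (ht : segLen T ≤ t) (hc : (𝒪 c t).closing = false) :
    ((𝒪 c t).rej i : ℝ) ≤ occ T (waitEvent I P α δ T a i) c t -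
        occ T (waitEvent I P α δ T a i) c (segLen T * (t / segLen T)) +
      max 0 (min ((𝒪 c t).seen i : ℝ) ((𝒪 c t).quota i) - (𝒪 c t).quota i + 𝒢 + 1) := by
  induction t, ht using Nat.le_induction with
  | base => simp [occ_init, Nat.div_self hN, opened_init_rej]
  | succ t ht ih =>
    have hc' : (𝒪 c t).closing = false := by
      by_contra h
      have := (opened_succ_closing I P α δ T a c ht).2 (Or.inl (by simpa using h))
      simp [this] at hc
    have key := rejNext_le I P α δ T a hG i c hc' (ih hc')
    rw [opened_succ_rej I P α δ T a c ht, opened_succ_quota I P α δ T a c ht,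
      opened_succ_seen I P α δ T a c ht]
    by_cases hb : segLen T ∣ t + 1
    · simp [hb, Nat.mul_div_cancel' hb]
    · simp only [hb, if_false]
      rw [Nat.succ_div_of_not_dvd hb, occ_succ T _ c ht]
      linarith

theorem rejNext_le' (hN : 0 < segLen T) (hG : I.abar ≤ 𝒢) (i : Fin n) (c : Coins n) {t : ℕ}
    (ht : segLen T ≤ t) (hc : (𝒪 c t).closing = false) :
    (rejNext I P α δ T a c t i : ℝ) ≤ occ T (waitEvent I P α δ T a i) c (t + 1) -
        occ T (waitEvent I P α δ T a i) c (segLen T * (t / segLen T)) + (𝒢 + 1) := by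
  have key := rejNext_le I P α δ T a hG i c hc (rej_le I P α δ T a hN hG i c ht hc)
  rw [occ_succ T _ c ht]
  refine key.trans ?_
  have : max 0 (min ((if a t = some i then (𝒪 c t).seen i + 1 else (𝒪 c t).seen i : ℕ) : ℝ)
        ((𝒪 c t).quota i) - (𝒪 c t).quota i + 𝒢 + 1) ≤ 𝒢 + 1 := by
    refine max_le ?_ ?_
    · have := I.abar_pos
      linarith
    · linarith [min_le_right ((if a t = some i then (𝒪 c t).seen i + 1 else (𝒪 c t).seen i : ℕ) : ℝ)
        ((𝒪 c t).quota i)]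
  linarith

theorem segSample_le (c : Coins n) (k : ℕ) (i : Fin n) :
    segSample I P T a c k i ≤ numArrivals a i (segLen T) :=
  (Finset.card_filter_le _ _).trans (by simp)

theorem segSample_le_quota (hN : 0 < segLen T) (i : Fin n) (c : Coins n) {t : ℕ}
    (ht : segLen T ≤ t) : segSample I P T a c (t / segLen T) i ≤ (𝒪 c t).quota i := by
  induction t, ht using Nat.le_induction with
  | base => simp [opened_init_quota I P α δ T a c hN, Nat.div_self hN]
  | succ t ht ih =>
    rw [opened_succ_quota I P α δ T a c ht]
    by_cases hb : segLen T ∣ t + 1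
    · simp [hb]
    · rw [if_neg hb, Nat.succ_div_of_not_dvd hb]
      exact ih

theorem numArrivals_eq (i : Fin n) (t : ℕ) : (numArrivals a i t : ℝ) = arrivalsIn a i 0 t := by
  rw [numArrivals, Nat.count_eq_card_filter_range, arrivalsIn, Finset.range_eq_Ico]
  simp

/-- Counterpart of `accepted_add_le`. What is lost for good is the part of a target left open at the
end of a segment. The term `quota - segSample` is the debt inherited from the preceding segment.
Keeping it on the left makes the estimate close: at a boundary it cancels the inherited part of the
open target, so that one segment costs only its arrival deviation and its own rejections, and debts
do not accumulate over the segments. -/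
theorem le_accepted_add (hN : 0 < segLen T) (hG : I.abar ≤ 𝒢) (i : Fin n) (c : Coins n) {t : ℕ}
    (ht : segLen T ≤ t) (hc : (𝒪 c t).closing = false) :
    ∑ k ∈ Finset.Icc 1 (t / segLen T), (segSample I P T a c k i : ℝ) -
        occ T (acceptEvent I P α δ T a i) c t -
        max 0 (((𝒪 c t).quota i : ℝ) - (𝒪 c t).seen i) - (𝒪 c t).rej i +
        ((𝒪 c t).quota i - (segSample I P T a c (t / segLen T) i : ℝ)) ≤
      (t / segLen T : ℕ) * (𝒢 + 1) +
        ∑ k ∈ Finset.Ico 1 (t / segLen T),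
          |arrivalsIn a i (segLen T * k) (segLen T * (k + 1)) - arrivalsIn a i 0 (segLen T)| +
        occ T (waitEvent I P α δ T a i) c (segLen T * (t / segLen T)) := by
  have hG0 : 0 ≤ 𝒢 := I.abar_pos.le.trans hG
  induction t, ht using Nat.le_induction with
  | base =>
    simp [occ_init, opened_init_rej, opened_init_seen, opened_init_quota I P α δ T a c hN,
      Nat.div_self hN]
    linarith
  | succ t ht ih =>
    have hc' : (𝒪 c t).closing = false := by
      by_contra h
      have := (opened_succ_closing I P α δ T a c ht).2 (Or.inl (by simpa using h))
      simp [this] at hc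
    replace ih := ih hc'
    set sn : ℕ := if a t = some i then (𝒪 c t).seen i + 1 else (𝒪 c t).seen i with hsn
    have key : occ T (acceptEvent I P α δ T a i) c t +
        max 0 (((𝒪 c t).quota i : ℝ) - (𝒪 c t).seen i) + (𝒪 c t).rej i ≤
        occ T (acceptEvent I P α δ T a i) c (t + 1) +
        max 0 (((𝒪 c t).quota i : ℝ) - sn) + rejNext I P α δ T a c t i := by
      rw [occ_succ T _ c ht]
      have h01 : (0 : ℝ) ≤ (acceptEvent I P α δ T a i t).indicator 1 c :=
        Set.indicator_nonneg (fun _ _ => zero_le_one' ℝ) c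
      by_cases h : a t = some i
      · rw [hsn, if_pos h, rejNext]
        push_cast
        by_cases hq : (𝒪 c t).seen i + 1 ≤ (𝒪 c t).quota i
        · have hq' : ((𝒪 c t).seen i : ℝ) + 1 ≤ (𝒪 c t).quota i := by exact_mod_cast hq
          rw [max_eq_right (by linarith), max_eq_right (by linarith)]
          by_cases hd : 𝒟 c t = true
          · have hae : c ∈ acceptEvent I P α δ T a i t := ⟨h, hd⟩
            rw [Set.indicator_of_mem hae]
            simp only [hd, Bool.true_eq_false, false_and, and_false, if_false, Pi.one_apply]
            linarith
          · simp only [h, hq, hd, and_self, if_true]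
            linarith
        · have hq' : ((𝒪 c t).quota i : ℝ) < (𝒪 c t).seen i + 1 := by exact_mod_cast not_le.1 hq
          have hq2 : ((𝒪 c t).quota i : ℝ) ≤ (𝒪 c t).seen i := by
            exact_mod_cast Nat.lt_succ_iff.1 (not_le.1 hq)
          simp only [hq, and_false, if_false]
          rw [max_eq_left (by linarith), max_eq_left (by linarith)]
          linarith
      · rw [hsn, if_neg h, rejNext]
        simp only [h, false_and, if_false]
        linarith
    rw [opened_succ_rej I P α δ T a c ht, opened_succ_quota I P α δ T a c ht,
      opened_succ_seen I P α δ T a c ht, sum_Icc_div_succ]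
    by_cases hb : segLen T ∣ t + 1
    · have hdiv := Nat.succ_div_of_dvd hb
      have hmul : segLen T * (t / segLen T + 1) = t + 1 := by
        rw [← hdiv, Nat.mul_div_cancel' hb]
      have h1 : 1 ≤ t / segLen T := (Nat.one_le_div_iff hN).2 ht
      simp only [if_pos hb, hdiv]
      rw [Finset.sum_Ico_succ_top h1, hmul]
      push_cast
      rw [max_eq_right (by rw [sub_zero]; positivity)]
      have hr := rejNext_le' I P α δ T a hN hG i c ht hc'
      have hs : (sn : ℝ) = arrivalsIn a i (segLen T * (t / segLen T)) (t + 1) := by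
        rw [arrivalsIn, Finset.sum_Ico_succ_top (Nat.mul_div_le t (segLen T)), ← arrivalsIn,
          ← seen_eq I P α δ T a hN i c ht, hsn]
        split_ifs <;> push_cast <;> ring
      have hB : (segSample I P T a c (t / segLen T) i : ℝ) ≤ arrivalsIn a i 0 (segLen T) := by
        rw [← numArrivals_eq]
        exact_mod_cast segSample_le I P T a c _ i
      have hD := neg_abs_le
        (arrivalsIn a i (segLen T * (t / segLen T)) (t + 1) - arrivalsIn a i 0 (segLen T))
      have hD0 := abs_nonneg
        (arrivalsIn a i (segLen T * (t / segLen T)) (t + 1) - arrivalsIn a i 0 (segLen T))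
      rw [← hs] at hD hD0 ⊢
      -- The sample never exceeds the number of arrivals in the estimation phase, so a target is
      -- left open only because of inherited debt or because fewer customers came than in that
      -- phase.
      have hm : max 0 (((𝒪 c t).quota i : ℝ) - sn) ≤
          max 0 ((𝒪 c t).quota i - (segSample I P T a c (t / segLen T) i : ℝ)) +
            |(sn : ℝ) - arrivalsIn a i 0 (segLen T)| := by
        refine max_le (by positivity) ?_
        have := le_max_right 0
          ((𝒪 c t).quota i - (segSample I P T a c (t / segLen T) i : ℝ))
        linarith
      have hqB : (segSample I P T a c (t / segLen T) i : ℝ) ≤ (𝒪 c t).quota i := by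
        exact_mod_cast segSample_le_quota I P α δ T a hN i c ht
      rw [max_eq_right (sub_nonneg.2 hqB)] at hm
      linarith
    · simp only [if_neg hb, add_zero]
      rw [Nat.succ_div_of_not_dvd hb]
      linarith

end Invariants

/-! ### Independence of the coins and the past of a period. -/

section CoinMeasure

variable {n L : ℕ}

instance : IsProbabilityMeasure (coinLaw n) := by
  unfold coinLaw
  infer_instance

instance (I : Problem n L) : IsProbabilityMeasure I.arrivalLaw := by
  unfold Problem.arrivalLaw
  infer_instance

/-- The `σ`-algebra of the binomial samples and of the decisions made before period `t`. -/
abbrev coinPast (n t : ℕ) : MeasurableSpace (Coins n) :=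
  ⨆ k ∈ {k : ℕ ⊕ (ℕ × Fin n × ℕ) | ∀ s, k = Sum.inl s → s < t},
    MeasurableSpace.comap (fun c : Coins n => c k) inferInstance

theorem coinPast_le (t : ℕ) : coinPast n t ≤ (inferInstance : MeasurableSpace (Coins n)) :=
  iSup₂_le fun k _ => (measurable_pi_apply k).comap_le

theorem coinPast_mono {s t : ℕ} (h : s ≤ t) : coinPast n s ≤ coinPast n t :=
  biSup_mono fun _ hk u hu => (hk u hu).trans_le h

theorem measurable_coin {t : ℕ} {k : ℕ ⊕ (ℕ × Fin n × ℕ)} (hk : ∀ s, k = Sum.inl s → s < t) :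
    Measurable[coinPast n t] fun c : Coins n => c k :=
  measurable_iff_comap_le.2 (le_iSup₂_of_le k hk le_rfl)

theorem iIndepFun_coins : ProbabilityTheory.iIndepFun
    (fun (k : ℕ ⊕ (ℕ × Fin n × ℕ)) (c : Coins n) => c k) (coinLaw n) :=
  ProbabilityTheory.iIndepFun_infinitePi (X := fun _ x => x) fun _ => measurable_id

theorem coinLaw_preimage (k : ℕ ⊕ (ℕ × Fin n × ℕ)) {U : Set unitInterval} (hU : MeasurableSet U) :
    (coinLaw n).real {c | c k ∈ U} = (volume : Measure unitInterval).real U := by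
  have := (measurePreserving_eval_infinitePi
    (fun _ : ℕ ⊕ (ℕ × Fin n × ℕ) => (volume : Measure unitInterval)) k).measure_preimage
    hU.nullMeasurableSet
  rw [Measure.real, Measure.real, ← this]
  rfl

theorem volume_lt {p : ℝ} (h0 : 0 ≤ p) (h1 : p ≤ 1) :
    (volume : Measure unitInterval).real {x | (x : ℝ) < p} = p := by
  have : {x : unitInterval | (x : ℝ) < p} = Set.Iio ⟨p, h0, h1⟩ := by
    ext x
    simp [← Subtype.coe_lt_coe]
  rw [this, Measure.real, unitInterval.volume_Iio]
  simp [h0]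

theorem measurableSet_coin_lt (p : ℝ) : MeasurableSet {x : unitInterval | (x : ℝ) < p} :=
  measurableSet_lt measurable_subtype_coe measurable_const

theorem coin_lt (k : ℕ ⊕ (ℕ × Fin n × ℕ)) {p : ℝ} (h0 : 0 ≤ p) (h1 : p ≤ 1) :
    (coinLaw n).real {c | (c k : ℝ) < p} = p :=
  (coinLaw_preimage k (measurableSet_coin_lt p)).trans (volume_lt h0 h1)

/-- The coin of period `t` is independent of the past. -/
theorem real_inter_coin {t : ℕ} {A : Set (Coins n)} (hA : MeasurableSet[coinPast n t] A)
    {U : Set unitInterval} (hU : MeasurableSet U) :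
    (coinLaw n).real (A ∩ {c | c (Sum.inl t) ∈ U}) =
      (coinLaw n).real A * (volume : Measure unitInterval).real U := by
  have hi := ProbabilityTheory.indep_iSup_of_disjoint
    (m := fun k : ℕ ⊕ (ℕ × Fin n × ℕ) =>
      MeasurableSpace.comap (fun c : Coins n => c k) inferInstance)
    (fun k => (measurable_pi_apply k).comap_le) (iIndepFun_coins (n := n))
    (S := {k | ∀ s, k = Sum.inl s → s < t}) (T := {Sum.inl t}) (by
      rw [Set.disjoint_singleton_right]
      intro h
      exact lt_irrefl _ (h t rfl))
  have := (ProbabilityTheory.Indep_iff _ _ _).1 hi A {c | c (Sum.inl t) ∈ U} hA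
    ((le_iSup₂ (f := fun (k : ℕ ⊕ (ℕ × Fin n × ℕ)) (_ : k ∈ ({Sum.inl t} : Set _)) =>
      MeasurableSpace.comap (fun c : Coins n => c k) inferInstance)
      (Sum.inl t) (Set.mem_singleton _)) _ ⟨U, hU, rfl⟩)
  rw [Measure.real, this, ENNReal.toReal_mul, ← coinLaw_preimage (Sum.inl t) hU]
  rfl

theorem real_inter_coin_lt {t : ℕ} {A : Set (Coins n)} (hA : MeasurableSet[coinPast n t] A)
    {p : ℝ} (h0 : 0 ≤ p) (h1 : p ≤ 1) :
    (coinLaw n).real (A ∩ {c | (c (Sum.inl t) : ℝ) < p}) = (coinLaw n).real A * p :=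
  (real_inter_coin hA (measurableSet_coin_lt p)).trans (by rw [volume_lt h0 h1])

theorem real_inter_coin_ge {t : ℕ} {A : Set (Coins n)} (hA : MeasurableSet[coinPast n t] A)
    {p : ℝ} (h0 : 0 ≤ p) (h1 : p ≤ 1) :
    (coinLaw n).real (A ∩ {c | ¬ (c (Sum.inl t) : ℝ) < p}) = (coinLaw n).real A * (1 - p) := by
  refine (real_inter_coin hA (measurableSet_coin_lt p).compl).trans ?_
  rw [probReal_compl_eq_one_sub (measurableSet_coin_lt p), volume_lt h0 h1]

/-- Post-composition of a function all of whose preimages are measurable and a countably valued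
function. -/
theorem measurableSet_preimage_countable {Ω X Y Z : Type*} [Countable Y] {m : MeasurableSpace Ω}
    {f : Ω → X} {g : Ω → Y} (hf : ∀ S : Set X, MeasurableSet[m] {ω | f ω ∈ S})
    (hg : ∀ y, MeasurableSet[m] {ω | g ω = y}) (F : X → Y → Z) (S : Set Z) :
    MeasurableSet[m] {ω | F (f ω) (g ω) ∈ S} := by
  have : {ω | F (f ω) (g ω) ∈ S} = ⋃ y, {ω | f ω ∈ {x | F x y ∈ S}} ∩ {ω | g ω = y} := by
    ext ω
    simp
  rw [this]
  exact MeasurableSet.iUnion fun y => (hf _).inter (hg y)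

end CoinMeasure

/-! ### The state before a period depends on earlier decision coins and the samples only. -/

section StateMeasurable

variable {n L : ℕ} (I : Problem n L) (P : OGDParams) (α δ : ℝ) (T : ℕ) (a : ℕ → Arrival n)

local notation "𝒪" => opened I P α δ T a
local notation "𝒟" => decision I P α δ T a
local notation "𝒢" => graceWidth I α δ

theorem measurable_segSample (t k : ℕ) (i : Fin n) :
    Measurable[coinPast n t] fun c : Coins n => segSample I P T a c k i := by
  unfold segSample
  simp only [Finset.card_filter]
  refine Finset.measurable_sum _ fun l _ => ?_
  refine Measurable.ite ?_ measurable_const measurable_const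
  exact measurable_coin (t := t) (k := Sum.inr (k, i, l)) (by simp) (measurableSet_coin_lt _)

/-- The bookkeeping at the beginning of a period with given binomial samples. -/
def openWith (t : ℕ) (s : GPState n L) (y : Fin n → ℕ) : GPState n L :=
  let s' : GPState n L :=
    if segLen T ∣ t then
      { s with
        quota := fun i => s.rej i + y i
        seen := fun _ => 0
        rej := fun _ => 0 }
    else s
  { s' with
    closing := s'.closing || decide (∃ j, s'.cap j - I.abar * n * graceLen α δ ≤ 0) }

/-- The decision on a customer in terms of the two comparisons of its coin. -/
def decideWith (s : GPState n L) (b : Bool × Bool) : Arrival n → Bool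
  | none => false
  | some i =>
    (if (s.closing ||
        decide ((s.quota i : ℝ) - I.abar * n * graceLen α δ ≤ ((s.seen i + 1 : ℕ) : ℝ))) = true
      then s.prev i && b.1 else s.prev i || b.2) && decide (∀ j, I.A i j ≤ s.cap j)

theorem opened_eq_openWith (c : Coins n) (t : ℕ) :
    𝒪 c t = openWith I α δ T t (gpState I P α δ T a c t)
      (fun i => segSample I P T a c (t / segLen T) i) := rfl

theorem decision_eq_decideWith (c : Coins n) (t : ℕ) :
    𝒟 c t = decideWith I α δ (𝒪 c t)
      (decide ((c (Sum.inl t) : ℝ) < 1 - α), decide ((c (Sum.inl t) : ℝ) < α)) (a t) := by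
  cases h : a t with
  | none => exact decision_none I P α δ T a c h
  | some i => rw [decision_some I P α δ T a c h]; rfl

theorem measurableSet_comparisons {t u : ℕ} (h : t < u) (b : Bool × Bool) :
    MeasurableSet[coinPast n u] {c : Coins n |
      (decide ((c (Sum.inl t) : ℝ) < 1 - α), decide ((c (Sum.inl t) : ℝ) < α)) = b} := by
  have hm : Measurable[coinPast n u] fun c : Coins n => (c (Sum.inl t) : ℝ) :=
    measurable_subtype_coe.comp (measurable_coin (by simpa using h))
  have h1 : ∀ p : ℝ, MeasurableSet[coinPast n u] {c : Coins n | (c (Sum.inl t) : ℝ) < p} :=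
    fun p => hm measurableSet_Iio
  have h2 : ∀ (p : ℝ) (b : Bool),
      MeasurableSet[coinPast n u] {c : Coins n | decide ((c (Sum.inl t) : ℝ) < p) = b} := by
    intro p b
    cases b
    · simp only [decide_eq_false_iff_not]
      exact (h1 p).compl
    · simp only [decide_eq_true_eq]
      exact h1 p
  simp only [Prod.ext_iff]
  exact (h2 _ _).inter (h2 _ _)

theorem measurableSet_opened_aux {t : ℕ}
    (h : ∀ S : Set (GPState n L), MeasurableSet[coinPast n t] {c | gpState I P α δ T a c t ∈ S})
    (S : Set (GPState n L)) : MeasurableSet[coinPast n t] {c | 𝒪 c t ∈ S} := by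
  simp only [opened_eq_openWith]
  refine measurableSet_preimage_countable h (fun y => ?_) _ _
  have : {c : Coins n | (fun i => segSample I P T a c (t / segLen T) i) = y} =
      ⋂ i, {c | segSample I P T a c (t / segLen T) i = y i} := by
    ext c
    simp [funext_iff]
  rw [this]
  exact MeasurableSet.iInter fun i =>
    measurable_segSample I P T a t _ i (measurableSet_singleton _)

/-- The state space has real coordinates and no chosen `σ`-algebra. Arbitrary sets `S` are
admissible because each period uses the coins only through countably many outcomes: the sampled
numbers and the two comparisons of its decision coin. -/
theorem measurableSet_gpState (t : ℕ) (S : Set (GPState n L)) :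
    MeasurableSet[coinPast n t] {c | gpState I P α δ T a c t ∈ S} := by
  induction t generalizing S with
  | zero =>
    simp only [gpState]
    exact MeasurableSet.const _
  | succ t ih =>
    by_cases ht : t < segLen T
    · simp only [gpState, if_pos ht]
      exact coinPast_mono t.le_succ _ (ih S)
    · simp only [gpState_succ I P α δ T a _ (not_lt.1 ht), decision_eq_decideWith]
      exact measurableSet_preimage_countable
        (fun S => coinPast_mono t.le_succ _ (measurableSet_opened_aux I P α δ T a ih S))
        (measurableSet_comparisons α t.lt_succ_self)
        (fun s b => gpUpdate I s (a t) (decideWith I α δ s b (a t))) S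

theorem measurableSet_opened {t u : ℕ} (h : t ≤ u) (p : GPState n L → Prop) :
    MeasurableSet[coinPast n u] {c | p (𝒪 c t)} :=
  coinPast_mono h _ (measurableSet_opened_aux I P α δ T a (measurableSet_gpState I P α δ T a t)
    {s | p s})

theorem measurableSet_decision {t u : ℕ} (h : t < u) (p : GPState n L → Bool → Prop) :
    MeasurableSet[coinPast n u] {c | p (𝒪 c t) (𝒟 c t)} := by
  simp only [decision_eq_decideWith]
  exact measurableSet_preimage_countable
    (fun S => measurableSet_opened I P α δ T a h.le (· ∈ S))
    (measurableSet_comparisons α h)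
    (fun s b => p s (decideWith I α δ s b (a t))) {q | q}

end StateMeasurable

/-! ### The closing grace period and the probability of a change of decision. -/

section Closing

variable {n L : ℕ} (I : Problem n L) (P : OGDParams) (α δ : ℝ) (T : ℕ) (a : ℕ → Arrival n)

local notation "𝒪" => opened I P α δ T a
local notation "𝒟" => decision I P α δ T a
local notation "𝒢" => graceWidth I α δ

/-- Number of type `i` customers before period `t` in the closing grace period. -/
def closedCount (c : Coins n) (i : Fin n) (t : ℕ) : ℕ :=
  ∑ s ∈ Finset.Ico (segLen T) t, if a s = some i ∧ (𝒪 c s).closing = true then 1 else 0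

/-- Number of type `i` customers accepted before period `t` in the closing grace period. -/
def closedAccepted (c : Coins n) (i : Fin n) (t : ℕ) : ℕ :=
  ∑ s ∈ Finset.Ico (segLen T) t,
    if a s = some i ∧ (𝒪 c s).closing = true ∧ 𝒟 c s = true then 1 else 0

local notation "ℋ" => closedCount I P α δ T a
local notation "𝒞" => closedAccepted I P α δ T a

theorem closedCount_succ (c : Coins n) (i : Fin n) {t : ℕ} (ht : segLen T ≤ t) :
    ℋ c i (t + 1) =
      ℋ c i t + if a t = some i ∧ (𝒪 c t).closing = true then 1 else 0 :=
  Finset.sum_Ico_succ_top ht _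

theorem closedAccepted_succ (c : Coins n) (i : Fin n) {t : ℕ} (ht : segLen T ≤ t) :
    𝒞 c i (t + 1) = 𝒞 c i t +
      if a t = some i ∧ (𝒪 c t).closing = true ∧ 𝒟 c t = true then 1 else 0 :=
  Finset.sum_Ico_succ_top ht _

theorem closedAccepted_le (c : Coins n) (i : Fin n) (t : ℕ) : 𝒞 c i t ≤ ℋ c i t := by
  refine Finset.sum_le_sum fun s _ => ?_
  split_ifs <;> simp_all

theorem closedCount_eq_zero (c : Coins n) (i : Fin n) {t : ℕ} (h : (𝒪 c t).closing = false) :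
    ℋ c i t = 0 := by
  refine Finset.sum_eq_zero fun s hs => if_neg ?_
  rintro ⟨-, h1⟩
  obtain ⟨h2, h3⟩ := Finset.mem_Ico.1 hs
  simp [closing_mono I P α δ T a c h2 h3.le h1] at h

theorem closing_of_closedCount_pos (c : Coins n) (i : Fin n) {t : ℕ} (h : 0 < ℋ c i t) :
    (𝒪 c t).closing = true := by
  by_contra hc
  rw [closedCount_eq_zero I P α δ T a c i (by simpa using hc)] at h
  exact lt_irrefl _ h

theorem prev_of_decision_of_closing (c : Coins n) {t : ℕ} {i : Fin n}
    (h : a t = some i) (hs : (𝒪 c t).closing = true) (hd : 𝒟 c t = true) :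
    (𝒪 c t).prev i = true ∧ (c (Sum.inl t) : ℝ) < 1 - α := by
  have h1 := ((decision_iff I P α δ T a c h).1 hd).1
  rwa [if_pos (Or.inl hs)] at h1

/-- A rejection in the closing period is final for its type, so if the last customer was accepted,
so were all closing customers before. Before closing, both counts are zero. -/
theorem closedAccepted_eq (c : Coins n) (i : Fin n) {t : ℕ} (ht : segLen T ≤ t)
    (hp : (𝒪 c t).prev i = true) : 𝒞 c i t = ℋ c i t := by
  induction t, ht using Nat.le_induction with
  | base => simp [closedAccepted, closedCount]
  | succ t ht ih =>
    rw [opened_succ_prev I P α δ T a c ht] at hp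
    rw [closedAccepted_succ I P α δ T a c i ht, closedCount_succ I P α δ T a c i ht]
    by_cases h : a t = some i
    · rw [if_pos h] at hp
      by_cases hc : (𝒪 c t).closing = true
      · rw [ih (prev_of_decision_of_closing I P α δ T a c h hc hp).1]
        simp [h, hc, hp]
      · have h0 := closedCount_eq_zero I P α δ T a c i (by simpa using hc)
        have h1 := closedAccepted_le I P α δ T a c i t
        simp [hc]
        omega
    · rw [if_neg h] at hp
      rw [ih hp]
      simp [h]

/-- The period found is the arrival of the accepted customer number `M + 1` in the closing period;
its conditions are those of `longRun`. -/
theorem exists_of_lt_closedAccepted (c : Coins n) (i : Fin n) {t M : ℕ} (ht : segLen T ≤ t)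
    (h : M < 𝒞 c i t) : ∃ s ∈ Finset.Ico (segLen T) t, a s = some i ∧ ℋ c i s = M ∧
      (𝒪 c s).closing = true ∧ (𝒪 c s).prev i = true := by
  induction t, ht using Nat.le_induction with
  | base => simp [closedAccepted] at h
  | succ t ht ih =>
    by_cases h1 : M < 𝒞 c i t
    · obtain ⟨s, hs, h2⟩ := ih h1
      exact ⟨s, Finset.Ico_subset_Ico le_rfl t.le_succ hs, h2⟩
    · rw [closedAccepted_succ I P α δ T a c i ht] at h
      by_cases h2 : a t = some i ∧ (𝒪 c t).closing = true ∧ 𝒟 c t = true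
      · obtain ⟨h3, h4, h5⟩ := h2
        have h6 := (prev_of_decision_of_closing I P α δ T a c h3 h4 h5).1
        refine ⟨t, by simpa using ht, h3, ?_, h4, h6⟩
        rw [← closedAccepted_eq I P α δ T a c i ht h6]
        simp only [h3, h4, h5, and_self, if_true] at h
        omega
      · rw [if_neg h2] at h
        omega

/-- The last customer before closing found more than `graceWidth` units and took at most `abar`.
Every closing acceptance takes at most another `abar`. -/
theorem lt_cap_add (hρ : ∀ j, 𝒢 - I.abar < I.ρ j * T) (c : Coins n) {t : ℕ}
    (ht : segLen T ≤ t) (j : Fin L) :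
    𝒢 - I.abar < (𝒪 c t).cap j + I.abar * ∑ i, (𝒞 c i t : ℝ) := by
  induction t, ht using Nat.le_induction with
  | base => simpa [closedAccepted, opened_init_cap I P α δ T a] using hρ j
  | succ t ht ih =>
    have hpos := I.abar_pos
    have hmono : ∑ i, (𝒞 c i t : ℝ) ≤ ∑ i, (𝒞 c i (t + 1) : ℝ) := by
      refine Finset.sum_le_sum fun i _ => ?_
      rw [closedAccepted_succ I P α δ T a c i ht]
      exact_mod_cast Nat.le_add_right _ _
    have hmul := mul_le_mul_of_nonneg_left hmono hpos.le
    rw [opened_succ_cap I P α δ T a c ht]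
    cases h : a t with
    | none =>
      simp only [sub_zero]
      linarith
    | some k =>
      by_cases hd : 𝒟 c t = true
      · simp only [hd, if_true]
        have hA := I.A_le k j
        by_cases hc : (𝒪 c t).closing = true
        · have : ∑ i, (𝒞 c i (t + 1) : ℝ) = ∑ i, (𝒞 c i t : ℝ) + 1 := by
            simp only [closedAccepted_succ I P α δ T a c _ ht, h, hc, hd, Nat.cast_add,
              Finset.sum_add_distrib, Option.some.injEq, and_true]
            simp
          rw [this, mul_add]
          linarith
        · have h1 := lt_cap_of_not_closing I P α δ T a c (by simpa using hc) j
          have h2 : 0 ≤ I.abar * ∑ i, (𝒞 c i (t + 1) : ℝ) :=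
            mul_nonneg hpos.le (Finset.sum_nonneg fun _ _ => Nat.cast_nonneg _)
          linarith
      · simp only [hd]
        simp only [Bool.false_eq_true, if_false, sub_zero]
        linarith

theorem measurable_closedCount (i : Fin n) (t : ℕ) :
    Measurable[coinPast n t] fun c => ℋ c i t := by
  unfold closedCount
  refine Finset.measurable_sum _ fun s hs => ?_
  refine Measurable.ite ?_ measurable_const measurable_const
  exact measurableSet_opened I P α δ T a (Finset.mem_Ico.1 hs).2.le
    (fun s' => a s = some i ∧ s'.closing = true)

/-- The closing grace period has started and the number of type `i` customers in it is in `M + S`. -/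
def closedEvent (i : Fin n) (M : ℕ) (S : Set ℕ) (t : ℕ) : Set (Coins n) :=
  {c | (M ≤ ℋ c i t ∧ ℋ c i t - M ∈ S) ∧ (𝒪 c t).closing = true}

theorem measurableSet_closedEvent (i : Fin n) (M : ℕ) (S : Set ℕ) (t : ℕ) :
    MeasurableSet[coinPast n t] (closedEvent I P α δ T a i M S t) :=
  (measurable_closedCount I P α δ T a i t
    (.of_discrete : MeasurableSet {h : ℕ | M ≤ h ∧ h - M ∈ S})).inter
    (measurableSet_opened I P α δ T a le_rfl fun s => s.closing = true)

theorem measurableSet_prev (i : Fin n) (b : Bool) (t : ℕ) :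
    MeasurableSet[coinPast n t] {c | (𝒪 c t).prev i = b} :=
  measurableSet_opened I P α δ T a le_rfl fun s => s.prev i = b

/-- The probability that the first `M` customers in the closing grace period are all accepted. -/
theorem closedEvent_inter_prev_le (hα : α ∈ Set.Ioo (0 : ℝ) 1) (i : Fin n) (S : Set ℕ) {t : ℕ}
    (ht : segLen T ≤ t) (M : ℕ) :
    (coinLaw n).real (closedEvent I P α δ T a i M S t ∩ {c | (𝒪 c t).prev i = true}) ≤
      (1 - α) ^ M * (coinLaw n).real (closedEvent I P α δ T a i M S t) := by
  have hα0 : 0 ≤ 1 - α := by linarith [hα.2]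
  have hα1 : 1 - α ≤ 1 := by linarith [hα.1]
  induction t, ht using Nat.le_induction generalizing M with
  | base =>
    cases M with
    | zero => simpa using measureReal_mono Set.inter_subset_left
    | succ M =>
      have : closedEvent I P α δ T a i (M + 1) S (segLen T) = ∅ := by
        ext c
        simp [closedEvent, closedCount]
      simp [this]
  | succ t ht ih =>
    cases M with
    | zero => simpa using measureReal_mono Set.inter_subset_left
    | succ M =>
      by_cases h : a t = some i
      -- Acceptance of the current customer requires a previous acceptance and a coin below `1 - α`.
      -- This coin is independent of the past, which yields one more factor `1 - α`.
      · have h1 : closedEvent I P α δ T a i (M + 1) S (t + 1) ∩ {c | (𝒪 c (t + 1)).prev i = true} ⊆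
            closedEvent I P α δ T a i M S t ∩ {c | (𝒪 c t).prev i = true} ∩
              {c | (c (Sum.inl t) : ℝ) < 1 - α} := by
          rintro c ⟨⟨⟨h2, h3⟩, -⟩, h4⟩
          have hc : (𝒪 c t).closing = true := by
            by_contra hc
            rw [closedCount_succ I P α δ T a c i ht,
              closedCount_eq_zero I P α δ T a c i (by simpa using hc)] at h2
            simp [hc] at h2
          simp only [closedCount_succ I P α δ T a c i ht, h, hc, and_self, if_true] at h2 h3
          have h5 : 𝒟 c t = true := by
            simpa [opened_succ_prev I P α δ T a c ht, h] using h4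
          obtain ⟨h6, h7⟩ := prev_of_decision_of_closing I P α δ T a c h hc h5
          refine ⟨⟨⟨⟨by omega, ?_⟩, hc⟩, h6⟩, h7⟩
          rwa [Nat.add_sub_add_right] at h3
        -- The count and `M` grow together, so the excess over `M` stays in `S`. The choice `S =
        -- {0}` isolates a single arrival, and `S = Set.univ` means at least `M` customers.
        have h2 : closedEvent I P α δ T a i M S t ⊆
            closedEvent I P α δ T a i (M + 1) S (t + 1) := by
          rintro c ⟨⟨h2, h3⟩, hc⟩
          refine ⟨?_, closing_mono I P α δ T a c ht t.le_succ hc⟩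
          simp only [closedCount_succ I P α δ T a c i ht, h, hc, and_self, if_true]
          rw [Nat.add_sub_add_right]
          exact ⟨by omega, h3⟩
        calc _ ≤ _ := measureReal_mono h1
          _ = _ * (1 - α) := real_inter_coin_lt
            ((measurableSet_closedEvent I P α δ T a i M S t).inter
              (measurableSet_prev I P α δ T a i true t)) hα0 hα1
          _ ≤ (1 - α) ^ M * (coinLaw n).real (closedEvent I P α δ T a i M S t) * (1 - α) := by
            gcongr
            exact ih M
          _ ≤ (1 - α) ^ M * (coinLaw n).real
                (closedEvent I P α δ T a i (M + 1) S (t + 1)) * (1 - α) :=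
            mul_le_mul_of_nonneg_right (mul_le_mul_of_nonneg_left (measureReal_mono h2)
              (pow_nonneg hα0 M)) hα0
          _ = _ := by ring
      · have h1 : closedEvent I P α δ T a i (M + 1) S (t + 1) =
            closedEvent I P α δ T a i (M + 1) S t := by
          ext c
          simp only [closedEvent, closedCount_succ I P α δ T a c i ht, h, false_and, if_false,
            add_zero, Set.mem_ofPred_eq]
          refine and_congr_right fun h2 => ?_
          have h3 := closing_of_closedCount_pos I P α δ T a c i (t := t) (by omega)
          simp [h3, closing_mono I P α δ T a c ht t.le_succ h3]
        have h2 : {c | (𝒪 c (t + 1)).prev i = true} = {c | (𝒪 c t).prev i = true} := by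
          ext c
          simp [opened_succ_prev I P α δ T a c ht, h]
        rw [h1, h2]
        exact ih (M + 1)

theorem measurableSet_of_coinPast {t : ℕ} {A : Set (Coins n)} (h : MeasurableSet[coinPast n t] A) :
    MeasurableSet A :=
  coinPast_le t _ h

theorem integral_occ {E : ℕ → Set (Coins n)} (hE : ∀ t, MeasurableSet (E t)) (t : ℕ) :
    ∫ c, occ T E c t ∂coinLaw n = ∑ s ∈ Finset.Ico (segLen T) t, (coinLaw n).real (E s) := by
  unfold occ
  have h (s : ℕ) : Integrable (fun c => (E s).indicator (1 : Coins n → ℝ) c) (coinLaw n) :=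
    (integrable_const (1 : ℝ)).indicator (hE s)
  rw [integral_finsetSum _ fun s _ => h s]
  exact Finset.sum_congr rfl fun s _ => integral_indicator_one (hE s)

theorem integrable_occ {E : ℕ → Set (Coins n)} (hE : ∀ t, MeasurableSet (E t)) (t : ℕ) :
    Integrable (fun c => occ T E c t) (coinLaw n) :=
  integrable_finsetSum _ fun s _ => (integrable_const (1 : ℝ)).indicator (hE s)

/-- At the arrival of a type `i` customer, the closing grace period has started, and it has already
seen exactly `M` customers of this type, all of them accepted. -/
def longRun (i : Fin n) (M t : ℕ) : Set (Coins n) :=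
  {c | a t = some i ∧ ℋ c i t = M ∧ (𝒪 c t).closing = true ∧ (𝒪 c t).prev i = true}

theorem measurableSet_longRun (i : Fin n) (M t : ℕ) :
    MeasurableSet (longRun I P α δ T a i M t) := by
  by_cases h : a t = some i
  · simp only [longRun, h, true_and]
    exact measurableSet_of_coinPast (t := t) <|
      (measurable_closedCount I P α δ T a i t (measurableSet_singleton M)).inter
      (measurableSet_opened I P α δ T a le_rfl fun s => s.closing = true ∧ s.prev i = true)
  · simp [longRun, h]

/-- On each coin outcome there is at most one period in which a type `i` customer arrives after
exactly `M` closing customers of this type. Hence the probabilities of these arrivals add up to at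
most one, and the bound does not depend on the number of periods. -/
theorem sum_longRun_le (hα : α ∈ Set.Ioo (0 : ℝ) 1) (i : Fin n) (M t : ℕ) :
    ∑ s ∈ Finset.Ico (segLen T) t, (coinLaw n).real (longRun I P α δ T a i M s) ≤
      (1 - α) ^ M := by
  have hα0 : 0 ≤ 1 - α := by linarith [hα.2]
  set E : ℕ → Set (Coins n) := fun s =>
    {c | a s = some i} ∩ closedEvent I P α δ T a i M {0} s with hE
  have hEm : ∀ s, MeasurableSet (E s) := fun s => (MeasurableSet.const _).inter
    (measurableSet_of_coinPast (measurableSet_closedEvent I P α δ T a i M {0} s))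
  have h1 : ∀ s ∈ Finset.Ico (segLen T) t,
      (coinLaw n).real (longRun I P α δ T a i M s) ≤ (1 - α) ^ M * (coinLaw n).real (E s) := by
    intro s hs
    by_cases h : a s = some i
    · simp only [hE, h, Set.ofPred_true, Set.univ_inter]
      refine le_trans (measureReal_mono ?_) (closedEvent_inter_prev_le I P α δ T a hα i {0}
        (Finset.mem_Ico.1 hs).1 M)
      rintro c ⟨-, h2, h3, h4⟩
      exact ⟨⟨⟨h2.ge, by simp [h2]⟩, h3⟩, h4⟩
    · simp only [longRun, h, false_and, Set.ofPred_false, measureReal_empty]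
      positivity
  -- The second summand records that the one possible period may still lie ahead; it vanishes when
  -- that period is used.
  have h2 : ∀ c t, segLen T ≤ t → occ T E c t + (if ℋ c i t ≤ M then 1 else 0) ≤ 1 := by
    intro c t ht
    induction t, ht using Nat.le_induction with
    | base => simp [occ_init, closedCount]
    | succ t ht ih =>
      rw [occ_succ T _ c ht, closedCount_succ I P α δ T a c i ht]
      by_cases h3 : c ∈ E t
      · obtain ⟨h4, ⟨h5, h6⟩, h7⟩ := id h3
        have h4 : a t = some i := h4
        have h6 : ℋ c i t - M = 0 := h6
        rw [if_pos (by omega)] at ih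
        have h8 : ¬ (ℋ c i t + (if a t = some i ∧ (𝒪 c t).closing = true then 1 else 0) ≤ M) := by
          rw [if_pos ⟨h4, h7⟩]
          omega
        rw [Set.indicator_of_mem h3, if_neg h8]
        simpa using ih
      · rw [Set.indicator_of_notMem h3, add_zero]
        refine le_trans (add_le_add_right ?_ _) ih
        split_ifs <;> first | omega | norm_num
  calc _ ≤ ∑ s ∈ Finset.Ico (segLen T) t, (1 - α) ^ M * (coinLaw n).real (E s) :=
        Finset.sum_le_sum h1
    _ = (1 - α) ^ M * ∫ c, occ T E c t ∂coinLaw n := by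
      rw [integral_occ T hEm, Finset.mul_sum]
    _ ≤ (1 - α) ^ M * ∫ _, 1 ∂coinLaw n := by
      refine mul_le_mul_of_nonneg_left (integral_mono (integrable_occ T hEm t)
        (integrable_const _) fun c => ?_) (by positivity)
      rcases le_total (segLen T) t with ht | ht
      · have := h2 c t ht
        split_ifs at this <;> linarith
      · simp [occ, Finset.Ico_eq_empty_of_le ht]
    _ = (1 - α) ^ M := by simp

/-- No type other than `i` has more than `M` customers accepted in the closing grace period. -/
def shortRuns (i : Fin n) (M : ℕ) : Set (Coins n) :=
  (⋃ k ∈ {k | k ≠ i}, ⋃ s ∈ Finset.Ico (segLen T) T, longRun I P α δ T a k M s)ᶜ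

theorem measurableSet_shortRuns (i : Fin n) (M : ℕ) :
    MeasurableSet (shortRuns I P α δ T a i M) :=
  (MeasurableSet.biUnion (Set.to_countable _) fun k _ => Finset.measurableSet_biUnion _ fun s _ =>
    measurableSet_longRun I P α δ T a k M s).compl

theorem le_real_shortRuns (hα : α ∈ Set.Ioo (0 : ℝ) 1) (i : Fin n) (M : ℕ) :
    1 - n * (1 - α) ^ M ≤ (coinLaw n).real (shortRuns I P α δ T a i M) := by
  have hm := (measurableSet_shortRuns I P α δ T a i M).of_compl
  rw [← compl_compl (shortRuns I P α δ T a i M), probReal_compl_eq_one_sub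
    (measurableSet_shortRuns I P α δ T a i M).compl]
  refine sub_le_sub_left ?_ _
  calc _ ≤ (coinLaw n).real (⋃ k ∈ (Finset.univ : Finset (Fin n)),
        ⋃ s ∈ Finset.Ico (segLen T) T, longRun I P α δ T a k M s) := by
        refine measureReal_mono ?_ (measure_ne_top _ _)
        rw [shortRuns, compl_compl]
        exact Set.biUnion_mono (by simp) fun _ _ => subset_rfl
    _ ≤ ∑ k : Fin n, (coinLaw n).real
        (⋃ s ∈ Finset.Ico (segLen T) T, longRun I P α δ T a k M s) :=
        measureReal_biUnion_finset_le _ _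
    _ ≤ ∑ k : Fin n, (1 - α) ^ M := Finset.sum_le_sum fun k _ =>
        (measureReal_biUnion_finset_le _ _).trans (sum_longRun_le I P α δ T a hα k M T)
    _ = n * (1 - α) ^ M := by simp

/-- The coin alone causes a rejection with probability `α * P(B)`, where `B` is acceptance of the
previous customer. Lack of capacity adds at most `P(A ∩ B)`, where `A` says that type `i` has had at
least `m` closing customers. Since `P(A ∩ B) ≤ (1 - α) ^ m * P(A)`, most of `A` lies outside `B` and
lowers `P(B)` enough to compensate. Thus the bound is exactly `α`, with no additional error. -/
theorem real_shortRuns_inter_le (hα : α ∈ Set.Ioo (0 : ℝ) 1) (hG : I.abar ≤ 𝒢)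
    (hρ : ∀ j, 𝒢 - I.abar < I.ρ j * T) {M m : ℕ} (hm : I.abar * (m + 1 + (n - 1) * M) ≤ 𝒢)
    (hmα : (1 - α) ^ m * (1 + α) ≤ α) {i : Fin n} {t : ℕ} (ht : segLen T ≤ t) (htT : t < T)
    (h : a t = some i) :
    (coinLaw n).real (shortRuns I P α δ T a i M ∩
      {c | (𝒪 c t).prev i = true ∧ 𝒟 c t = false}) ≤ α := by
  have hα0 : 0 ≤ 1 - α := by linarith [hα.2]
  have hα1 : 1 - α ≤ 1 := by linarith [hα.1]
  set A : Set (Coins n) := closedEvent I P α δ T a i m Set.univ t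
  set B : Set (Coins n) := {c | (𝒪 c t).prev i = true}
  have hA : MeasurableSet[coinPast n t] A := measurableSet_closedEvent I P α δ T a i m Set.univ t
  have hB : MeasurableSet[coinPast n t] B := measurableSet_prev I P α δ T a i true t
  have hsub : shortRuns I P α δ T a i M ∩ {c | (𝒪 c t).prev i = true ∧ 𝒟 c t = false} ⊆
      (B ∩ {c | ¬ (c (Sum.inl t) : ℝ) < 1 - α}) ∪ (A ∩ B) := by
    rintro c ⟨hE, hp, hd⟩
    by_cases hz : (c (Sum.inl t) : ℝ) < 1 - α
    · refine Or.inr ⟨?_, hp⟩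
      -- If the coin is below `1 - α` after an acceptance, both rules accept, so only the capacity
      -- check can have failed.
      have hcap : ¬ ∀ j, I.A i j ≤ (𝒪 c t).cap j := by
        intro hcap
        have : 𝒟 c t = true := by
          rw [decision_iff I P α δ T a c h]
          refine ⟨?_, hcap⟩
          split_ifs
          · exact ⟨hp, hz⟩
          · exact Or.inl hp
        simp [this] at hd
      push Not at hcap
      obtain ⟨j, hj⟩ := hcap
      have hcl : (𝒪 c t).closing = true := by
        by_contra hcl
        have := lt_cap_of_not_closing I P α δ T a c (by simpa using hcl) j
        linarith [I.A_le i j]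
      have hothers : ∀ k ∈ Finset.univ.erase i, (𝒞 c k t : ℝ) ≤ M := by
        intro k hk
        by_contra hM
        obtain ⟨s, hs, h1⟩ := exists_of_lt_closedAccepted I P α δ T a c k (M := M) ht
          (by exact_mod_cast not_le.1 hM)
        refine hE ?_
        simp only [Set.mem_iUnion]
        exact ⟨k, Finset.ne_of_mem_erase hk, s, Finset.Ico_subset_Ico le_rfl htT.le hs, h1⟩
      have hsum : ∑ k, (𝒞 c k t : ℝ) ≤ 𝒞 c i t + (n - 1) * M := by
        rw [← Finset.add_sum_erase _ _ (Finset.mem_univ i)]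
        gcongr
        refine (Finset.sum_le_card_nsmul _ _ _ hothers).trans_eq ?_
        have : 1 ≤ n := i.pos
        simp [Finset.card_erase_of_mem, Nat.cast_sub this]
      have h1 := lt_cap_add I P α δ T a hρ c ht j
      have h2 := mul_le_mul_of_nonneg_left hsum I.abar_pos.le
      -- Of the width, `(n - 1) * M` acceptances are reserved for the other types, and one `abar`
      -- each for the customer that triggered closing and for the rejected request. The remaining
      -- `m` can only have gone to type `i`, up to the one unit lost in the strict inequality.
      have h3 : I.abar * (m : ℝ) < I.abar * ((𝒞 c i t : ℝ) + 1) := by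
        have := I.A_le i j
        linarith
      have h4 : m < 𝒞 c i t + 1 := by
        exact_mod_cast lt_of_mul_lt_mul_left h3 I.abar_pos.le
      refine ⟨⟨?_, trivial⟩, hcl⟩
      have := closedAccepted_le I P α δ T a c i t
      omega
    · exact Or.inl ⟨hp, hz⟩
  have h1 := real_inter_coin_ge hB hα0 hα1
  have h2 := closedEvent_inter_prev_le I P α δ T a hα i Set.univ ht m
  have h3 : (coinLaw n).real B + (coinLaw n).real (A \ B) ≤ 1 := by
    rw [← measureReal_union (Set.disjoint_sdiff_right)
      (measurableSet_of_coinPast (hA.diff hB))]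
    exact measureReal_le_one
  have h4 := measureReal_inter_add_sdiff (μ := coinLaw n) (s := A)
    (measurableSet_of_coinPast hB)
  have h5 := (measureReal_mono (μ := coinLaw n) hsub).trans (measureReal_union_le _ _)
  rw [h1] at h5
  set q := (coinLaw n).real A
  have hq : 0 ≤ q := measureReal_nonneg
  change (coinLaw n).real (A ∩ B) ≤ (1 - α) ^ m * q at h2
  have h6 : (coinLaw n).real B * (1 - (1 - α)) ≤
      (1 - (q - (coinLaw n).real (A ∩ B))) * α := by
    rw [sub_sub_cancel]
    exact mul_le_mul_of_nonneg_right (by linarith) hα.1.le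
  have h7 := mul_le_mul_of_nonneg_right h2 (by linarith [hα.1] : 0 ≤ 1 + α)
  have h8 := mul_le_mul_of_nonneg_right hmα hq
  nlinarith

theorem real_accept_after_reject_le (hα : α ∈ Set.Ioo (0 : ℝ) 1) {i : Fin n} {t : ℕ}
    (h : a t = some i) :
    (coinLaw n).real {c | (𝒪 c t).prev i = false ∧ 𝒟 c t = true} ≤ α := by
  refine (measureReal_mono ?_).trans_eq (coin_lt (n := n) (Sum.inl t) hα.1.le hα.2.le)
  rintro c ⟨hp, hd⟩
  have := ((decision_iff I P α δ T a c h).1 hd).1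
  split_ifs at this <;> simp_all

theorem exists_change (c : Coins n) {i : Fin n} {b : Bool} {s t : ℕ} (hs : segLen T ≤ s)
    (hst : s ≤ t) (h1 : (𝒪 c s).prev i = b) (h2 : (𝒪 c t).prev i = !b) :
    ∃ u ∈ Finset.Ico s t, a u = some i ∧ (𝒪 c u).prev i = b ∧ 𝒟 c u = !b := by
  induction t, hst using Nat.le_induction with
  | base => simp_all
  | succ t hst ih =>
    by_cases h3 : (𝒪 c t).prev i = !b
    · obtain ⟨u, hu, h4⟩ := ih h3
      exact ⟨u, Finset.Ico_subset_Ico le_rfl t.le_succ hu, h4⟩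
    · rw [opened_succ_prev I P α δ T a c (hs.trans hst)] at h2
      split_ifs at h2 with h4
      swap
      · exact absurd h2 h3
      exact ⟨t, by simpa using hst, h4, by simpa using h3, h2⟩

/-- Different decisions at the two ends force a change at some customer in between, and a union
bound over these customers applies. -/
theorem real_le_of_change {E : Set (Coins n)} {i : Fin n} {b : Bool} {s t : ℕ} {β : ℝ}
    (hβ : ∀ u ∈ Finset.Ico s t, a u = some i →
      (coinLaw n).real (E ∩ {c | (𝒪 c u).prev i = b ∧ 𝒟 c u = !b}) ≤ β)
    (hs : segLen T ≤ s) (hst : s ≤ t) {F : Set (Coins n)}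
    (hF : ∀ c ∈ F, c ∈ E ∧ (𝒪 c s).prev i = b ∧ (𝒪 c t).prev i = !b) :
    (coinLaw n).real F ≤ β * {u ∈ Finset.Ico s t | a u = some i}.card := by
  calc _ ≤ (coinLaw n).real (⋃ u ∈ {u ∈ Finset.Ico s t | a u = some i},
        E ∩ {c | (𝒪 c u).prev i = b ∧ 𝒟 c u = !b}) := by
        refine measureReal_mono (fun c hc => ?_) (measure_ne_top _ _)
        obtain ⟨h1, h2, h3⟩ := hF c hc
        obtain ⟨u, hu, h4, h5⟩ := exists_change I P α δ T a c hs hst h2 h3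
        simp only [Set.mem_iUnion]
        exact ⟨u, Finset.mem_filter.2 ⟨hu, h4⟩, h1, h5⟩
    _ ≤ _ := measureReal_biUnion_finset_le _ _
    _ ≤ _ := Finset.sum_le_card_nsmul _ _ β fun u hu => by
        obtain ⟨h1, h2⟩ := Finset.mem_filter.1 hu
        exact hβ u h1 h2
    _ = _ := by rw [nsmul_eq_mul, mul_comm]

end Closing

/-! ### Fairness for large horizons. -/

section Fairness

variable {n L : ℕ}

theorem arrivalTime_mem (a : ℕ → Arrival n) (i : Fin n) {u T : ℕ} (h : u < numArrivals a i T) :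
    a (arrivalTime a i u) = some i :=
  Nat.nth_mem (p := fun t => a t = some i) u fun hf => h.trans_le (Nat.count_le_card hf T)

theorem arrivalTime_lt (a : ℕ → Arrival n) (i : Fin n) {u T : ℕ} (h : u < numArrivals a i T) :
    arrivalTime a i u < T :=
  Nat.nth_lt_of_lt_count h

theorem arrivalTime_lt_arrivalTime (a : ℕ → Arrival n) (i : Fin n) {u v T : ℕ} (huv : u < v)
    (h : v < numArrivals a i T) : arrivalTime a i u < arrivalTime a i v :=
  Nat.nth_lt_nth' huv fun hf => h.trans_le (Nat.count_le_card hf T)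

/-- The window may begin later than just after customer `u`, because it is cut off at the end of the
estimation phase. -/
theorem card_arrivals_between (a : ℕ → Arrival n) (i : Fin n) {u v T s : ℕ} (huv : u < v)
    (h : v < numArrivals a i T) (hs : arrivalTime a i u + 1 ≤ s) :
    ({w ∈ Finset.Ico s (arrivalTime a i v + 1) | a w = some i}.card : ℝ) ≤ v - u := by
  have hc : ∀ u < numArrivals a i T,
      {w ∈ Finset.range (arrivalTime a i u + 1) | a w = some i}.card = u + 1 := by
    intro u hu
    rw [← Nat.count_eq_card_filter_range]
    exact Nat.count_nth_succ fun hf => hu.trans_le (Nat.count_le_card hf T)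
  have hlt := arrivalTime_lt_arrivalTime a i huv h
  have h1 : {w ∈ Finset.Ico s (arrivalTime a i v + 1) | a w = some i} ⊆
      {w ∈ Finset.range (arrivalTime a i v + 1) | a w = some i} \
        {w ∈ Finset.range (arrivalTime a i u + 1) | a w = some i} := by
    intro w
    simp only [Finset.mem_filter, Finset.mem_Ico, Finset.mem_sdiff, Finset.mem_range]
    rintro ⟨⟨h1, h2⟩, h3⟩
    exact ⟨⟨h2, h3⟩, fun h4 => by omega⟩
  have h2 := Finset.card_le_card h1
  rw [Finset.card_sdiff_of_subset, hc v h, hc u (huv.trans h)] at h2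
  · have h3 : ({w ∈ Finset.Ico s (arrivalTime a i v + 1) | a w = some i}.card : ℝ) ≤
        ((v + 1 - (u + 1) : ℕ) : ℝ) := by exact_mod_cast h2
    rwa [Nat.add_sub_add_right, Nat.cast_sub huv.le] at h3
  · intro w
    simp only [Finset.mem_filter, Finset.mem_range]
    rintro ⟨h1, h2⟩
    exact ⟨by omega, h2⟩

/-- The two orders of `u` and `v` differ. A change from rejection to acceptance is bounded without
any exceptional event; a change from acceptance to rejection needs `shortRuns`, because capacity may
be the cause. -/
theorem isFair_of_le (I : Problem n L) (P : OGDParams) {α δ ε : ℝ} (T : ℕ)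
    (hα : α ∈ Set.Ioo (0 : ℝ) 1) {M m : ℕ}
    (hG : 0 < n → I.abar ≤ graceWidth I α δ)
    (hρ : 0 < n → ∀ j, graceWidth I α δ - I.abar < I.ρ j * T)
    (hm : 0 < n → I.abar * (m + 1 + (n - 1) * M) ≤ graceWidth I α δ)
    (hmα : (1 - α) ^ m * (1 + α) ≤ α) (hε : n * (1 - α) ^ M ≤ ε) :
    IsFair (gpEnhancedBPCOGD I P α δ T) T α ε := by
  intro a i
  have hn : 0 < n := i.pos
  refine ⟨shortRuns I P α δ T a i M, measurableSet_shortRuns I P α δ T a i M,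
    le_trans (by linarith) (le_real_shortRuns I P α δ T a hα i M), fun u v hu hv => ?_⟩
  have halg : ∀ c t, gpEnhancedBPCOGD I P α δ T a c t =
      (decide (segLen T ≤ t) && decision I P α δ T a c t) := fun _ _ => rfl
  simp only [halg]
  by_cases htv : segLen T ≤ arrivalTime a i v
  swap
  · simp [htv, hα.1.le, mul_nonneg]
  have hav := arrivalTime_mem a i hv
  have hau := arrivalTime_mem a i hu
  rcases lt_trichotomy u v with huv | rfl | huv
  · have hlt := arrivalTime_lt_arrivalTime a i huv hv
    refine (real_le_of_change I P α δ T a (i := i) (b := false)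
      -- If `u` arrives in the estimation phase, the chain starts at `segLen T`, where the previous
      -- decision counts as a rejection.
      (s := max (segLen T) (arrivalTime a i u + 1)) (t := arrivalTime a i v + 1) (β := α)
      (E := Set.univ) (fun w _ hw => ?_) (le_max_left _ _) (max_le (by omega) (by omega)) ?_).trans ?_
    · rw [Set.univ_inter]
      exact real_accept_after_reject_le I P α δ T a hα hw
    · rintro c ⟨-, h1, h2⟩
      refine ⟨trivial, ?_, ?_⟩
      · rcases le_or_gt (segLen T) (arrivalTime a i u) with h3 | h3
        · rw [max_eq_right (by omega), opened_succ_prev I P α δ T a c h3, if_pos hau]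
          simpa [h3] using h2
        · rw [max_eq_left (by omega), opened_init_prev]
      · rw [opened_succ_prev I P α δ T a c htv, if_pos hav]
        simpa [htv] using h1
    · refine mul_le_mul_of_nonneg_left ?_ hα.1.le
      refine (card_arrivals_between a i huv hv (le_max_right _ _)).trans ?_
      rw [abs_sub_comm]
      exact le_abs_self _
  · have : {c | (decide (segLen T ≤ arrivalTime a i u) &&
        decision I P α δ T a c (arrivalTime a i u)) = true ∧
        (decide (segLen T ≤ arrivalTime a i u) &&
        decision I P α δ T a c (arrivalTime a i u)) = false} = ∅ := by
      ext c
      simp only [Set.mem_ofPred_eq, Set.mem_empty_iff_false, iff_false]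
      rintro ⟨h1, h2⟩
      simp [h1] at h2
    rw [this]
    simp
  · have hlt := arrivalTime_lt_arrivalTime a i huv hu
    refine (real_le_of_change I P α δ T a (i := i) (b := true)
      (s := arrivalTime a i v + 1) (t := arrivalTime a i u + 1) (β := α)
      (E := shortRuns I P α δ T a i M) (fun w hw haw => ?_) (by omega) (by omega) ?_).trans ?_
    · obtain ⟨h1, h2⟩ := Finset.mem_Ico.1 hw
      have := arrivalTime_lt a i hu
      exact real_shortRuns_inter_le I P α δ T a hα (hG hn) (hρ hn) (hm hn) hmα
        (by omega) (by omega) haw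
    · rintro c ⟨hE, h1, h2⟩
      refine ⟨hE, ?_, ?_⟩
      · rw [opened_succ_prev I P α δ T a c htv, if_pos hav]
        simpa [htv] using h1
      · rw [opened_succ_prev I P α δ T a c (by omega), if_pos hau]
        simpa [htv.trans hlt.le] using h2
    · refine mul_le_mul_of_nonneg_left ?_ hα.1.le
      exact (card_arrivals_between a i huv hu le_rfl).trans (le_abs_self _)

theorem graceLen_eq (α : ℝ) (T : ℕ) :
    graceLen α (1 / (T : ℝ)) = (-Real.log (1 - α))⁻¹ * Real.log T := by
  rw [graceLen, Real.logb, one_div, Real.log_inv, inv_neg]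
  ring

theorem neg_log_pos {α : ℝ} (hα : α ∈ Set.Ioo (0 : ℝ) 1) : 0 < (-Real.log (1 - α))⁻¹ :=
  inv_pos.2 (neg_pos.2 (Real.log_neg (by linarith [hα.2]) (by linarith [hα.1])))

theorem tendsto_graceLen {α : ℝ} (hα : α ∈ Set.Ioo (0 : ℝ) 1) :
    Tendsto (fun T : ℕ => graceLen α (1 / (T : ℝ))) atTop atTop := by
  simp only [graceLen_eq]
  exact (Real.tendsto_log_atTop.comp tendsto_natCast_atTop_atTop).const_mul_atTop (neg_log_pos hα)

theorem eventually_mul_graceLen_lt (α C : ℝ) {ρ : ℝ} (hρ : 0 < ρ) :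
    ∀ᶠ T : ℕ in atTop, C * graceLen α (1 / (T : ℝ)) < ρ * T := by
  have h1 : (fun x : ℝ => C * (-Real.log (1 - α))⁻¹ * Real.log x) =o[atTop] fun x : ℝ => x :=
    Real.isLittleO_log_id_atTop.const_mul_left _
  have h2 := (h1.comp_tendsto tendsto_natCast_atTop_atTop).bound (half_pos hρ)
  filter_upwards [h2, eventually_gt_atTop 0] with T hT hT0
  have hT0' : (0 : ℝ) < T := by exact_mod_cast hT0
  simp only [Function.comp_apply, Real.norm_eq_abs, abs_of_pos hT0'] at hT
  rw [graceLen_eq, ← mul_assoc]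
  have := le_abs_self (C * (-Real.log (1 - α))⁻¹ * Real.log T)
  nlinarith [mul_pos hρ hT0']

theorem eventually_abar_le_graceWidth (I : Problem n L) {α : ℝ} (hα : α ∈ Set.Ioo (0 : ℝ) 1)
    (hn : 0 < n) : ∀ᶠ T : ℕ in atTop, I.abar ≤ graceWidth I α (1 / (T : ℝ)) := by
  filter_upwards [(tendsto_graceLen hα).eventually_ge_atTop 1] with T hT
  have h1 : (1 : ℝ) ≤ n := by exact_mod_cast hn
  rw [graceWidth, mul_assoc]
  exact le_mul_of_one_le_right I.abar_pos.le (one_le_mul_of_one_le_of_one_le h1 hT)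

theorem eventually_isFair (I : Problem n L) (P : OGDParams) {α : ℝ}
    (hα : α ∈ Set.Ioo (0 : ℝ) 1) :
    ∀ᶠ T : ℕ in atTop,
      IsFair (gpEnhancedBPCOGD I P α (1 / (T : ℝ)) T) T α (1 / (T : ℝ)) := by
  have hα0 : 0 < 1 - α := by linarith [hα.2]
  have hα1 : 1 - α < 1 := by linarith [hα.1]
  rcases n.eq_zero_or_pos with rfl | hn
  · exact Eventually.of_forall fun T a i => i.elim0
  have hn' : (1 : ℝ) ≤ n := by exact_mod_cast hn
  have hn0 : (0 : ℝ) < n := by linarith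
  obtain ⟨m, hm⟩ : ∃ m : ℕ, (1 - α) ^ m < α / (1 + α) :=
    exists_pow_lt_of_lt_one (div_pos hα.1 (by linarith [hα.1])) hα1
  have hmα : (1 - α) ^ m * (1 + α) ≤ α :=
    ((lt_div_iff₀ (by linarith [hα.1])).1 hm).le
  have hγ := tendsto_graceLen hα
  have hsmall : Tendsto (fun T : ℕ => (1 - α) ^ (graceLen α (1 / (T : ℝ)) / (2 * n)))
      atTop (nhds 0) :=
    (tendsto_rpow_atTop_of_base_lt_one _ (by linarith) hα1).comp
      (hγ.atTop_div_const (by positivity))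
  have hρ : ∀ᶠ T : ℕ in atTop, ∀ j, I.abar * n * graceLen α (1 / (T : ℝ)) < I.ρ j * T :=
    eventually_all.2 fun j => eventually_mul_graceLen_lt α _ (I.ρ_pos j)
  filter_upwards [eventually_abar_le_graceWidth I hα hn, hρ,
    hγ.eventually_ge_atTop (2 * (m + 1)), eventually_gt_atTop 0,
    hsmall.eventually_lt_const (div_pos hα0 hn0)] with T h1 h2 h3 h4 h5
  set γ := graceLen α (1 / (T : ℝ))
  have hT : (0 : ℝ) < 1 / (T : ℝ) := by positivity
  have hγ0 : 0 ≤ γ := by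
    have : (0 : ℝ) ≤ 2 * (m + 1) := by positivity
    linarith
  have hpow : (1 - α) ^ γ = 1 / (T : ℝ) := Real.rpow_logb hα0 hα1.ne hT
  -- With this `M` the other types use at most `(n - 1) * M ≤ n * γ - γ / 2`, and the remaining `γ /
  -- 2` covers `m + 1`. The excess `γ / (2 * n)` over `γ` gives a factor tending to zero, which
  -- beats `n` and the rounding factor `1 / (1 - α)`.
  refine isFair_of_le I P T hα (M := ⌊(1 + 1 / (2 * n)) * γ⌋₊) (m := m) (fun _ => h1)
    (fun _ j => ?_) (fun _ => ?_) hmα ?_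
  · have := h2 j
    have := I.abar_pos
    rw [graceWidth]
    linarith
  · rw [graceWidth, mul_assoc]
    refine mul_le_mul_of_nonneg_left ?_ I.abar_pos.le
    have h6 : (⌊(1 + 1 / (2 * (n : ℝ))) * γ⌋₊ : ℝ) ≤ (1 + 1 / (2 * n)) * γ :=
      Nat.floor_le (by positivity)
    have h7 := mul_le_mul_of_nonneg_left h6 (by linarith : (0 : ℝ) ≤ n - 1)
    have h8 : ((n : ℝ) - 1) * ((1 + 1 / (2 * n)) * γ) = n * γ - γ / 2 - γ / (2 * n) := by
      field_simp
      ring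
    have h9 : 0 ≤ γ / (2 * n) := by positivity
    linarith
  · have h6 : (1 + 1 / (2 * (n : ℝ))) * γ - 1 ≤ (⌊(1 + 1 / (2 * (n : ℝ))) * γ⌋₊ : ℝ) :=
      (Nat.sub_one_lt_floor _).le
    calc (n : ℝ) * (1 - α) ^ ⌊(1 + 1 / (2 * (n : ℝ))) * γ⌋₊
        = n * (1 - α) ^ (⌊(1 + 1 / (2 * (n : ℝ))) * γ⌋₊ : ℝ) := by rw [Real.rpow_natCast]
      _ ≤ n * (1 - α) ^ ((1 + 1 / (2 * (n : ℝ))) * γ - 1) := by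
        refine mul_le_mul_of_nonneg_left ?_ hn0.le
        exact Real.rpow_le_rpow_of_exponent_ge hα0 hα1.le h6
      _ = n * ((1 - α) ^ γ * (1 - α) ^ (γ / (2 * n)) / (1 - α)) := by
        rw [Real.rpow_sub_one hα0.ne', ← Real.rpow_add hα0]
        congr 3
        ring
      _ ≤ n * (1 / (T : ℝ) * ((1 - α) / n) / (1 - α)) := by
        rw [hpow]
        gcongr
      _ = 1 / (T : ℝ) := by
        field_simp

end Fairness

/-! ### Waiting times and the pathwise comparison with the auxiliary revenue. -/

section Pathwise

variable {n L : ℕ} (I : Problem n L) (P : OGDParams) (α δ : ℝ) (T : ℕ) (a : ℕ → Arrival n)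

local notation "𝒪" => opened I P α δ T a
local notation "𝒟" => decision I P α δ T a
local notation "𝒢" => graceWidth I α δ

theorem indicator_one_nonneg (E : Set (Coins n)) (c : Coins n) :
    (0 : ℝ) ≤ E.indicator 1 c :=
  Set.indicator_nonneg (fun _ _ => zero_le_one' ℝ) c

theorem indicator_one_le (E : Set (Coins n)) (c : Coins n) : E.indicator 1 c ≤ (1 : ℝ) :=
  Set.indicator_le_self' (fun _ _ => zero_le_one' ℝ) c

/-- Type `i` waits for an acceptance in an increasing grace period. -/
def pendingEvent (i : Fin n) (t : ℕ) : Set (Coins n) :=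
  {c | (𝒪 c t).closing = false ∧ ((𝒪 c t).seen i : ℝ) + 1 < (𝒪 c t).quota i - 𝒢 ∧
    (𝒪 c t).prev i = false}

/-- A favourable coin ends the wait: from then on every customer of the increasing period is
accepted. So there is at most one such coin per segment, and the indicator records that the one of
the current segment may still come. -/
theorem occ_wait_inter_le (hN : 0 < segLen T) (hG : I.abar ≤ 𝒢) (i : Fin n) (c : Coins n) {t : ℕ}
    (ht : segLen T ≤ t) :
    occ T (fun s => waitEvent I P α δ T a i s ∩ {c | (c (Sum.inl s) : ℝ) < α}) c t +
      (pendingEvent I P α δ T a i t).indicator 1 c ≤ (t / segLen T : ℕ) := by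
  induction t, ht using Nat.le_induction with
  | base =>
    simp only [occ_init, Nat.div_self hN, zero_add, Nat.cast_one]
    exact indicator_one_le _ c
  | succ t ht ih =>
    rw [occ_succ T _ c ht]
    set H := waitEvent I P α δ T a i t ∩ {c | (c (Sum.inl t) : ℝ) < α}
    have hHp : H.indicator (1 : Coins n → ℝ) c ≤ (pendingEvent I P α δ T a i t).indicator 1 c :=
      Set.indicator_le_indicator_of_subset (fun c hc => hc.1.2) (fun _ => zero_le_one' ℝ) c
    by_cases hb : segLen T ∣ t + 1
    · rw [Nat.succ_div_of_dvd hb, Nat.cast_succ]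
      have := indicator_one_le (pendingEvent I P α δ T a i (t + 1)) c
      linarith
    · rw [Nat.succ_div_of_not_dvd hb]
      by_cases hp : c ∈ pendingEvent I P α δ T a i (t + 1)
      · obtain ⟨h1, h2, h3⟩ := id hp
        have hc : (𝒪 c t).closing = false := by
          by_contra h
          have := (opened_succ_closing I P α δ T a c ht).2 (Or.inl (by simpa using h))
          simp [this] at h1
        have hs : ((𝒪 c t).seen i : ℝ) + 1 < (𝒪 c t).quota i - 𝒢 := by
          rw [opened_succ_seen I P α δ T a c ht, opened_succ_quota I P α δ T a c ht,
            if_neg hb, if_neg hb] at h2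
          split_ifs at h2
          · push_cast at h2
            linarith
          · exact h2
        rw [opened_succ_prev I P α δ T a c ht] at h3
        by_cases h : a t = some i
        · rw [if_pos h] at h3
          have h4 := mt (decision_of_not_closing I P α δ T a hG c h hc hs).2 (by simp [h3])
          push Not at h4
          have h5 : c ∈ pendingEvent I P α δ T a i t := ⟨hc, hs, by simpa using h4.1⟩
          have h6 : c ∉ H := fun h => not_lt.2 h4.2 h.2
          rw [Set.indicator_of_mem h5] at ih
          rw [Set.indicator_of_mem hp, Set.indicator_of_notMem h6]
          linarith
        · rw [if_neg h] at h3
          have h5 : c ∈ pendingEvent I P α δ T a i t := ⟨hc, hs, h3⟩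
          have h6 : c ∉ H := fun h' => h h'.1.1
          rw [Set.indicator_of_mem h5] at ih
          rw [Set.indicator_of_mem hp, Set.indicator_of_notMem h6]
          linarith
      · rw [Set.indicator_of_notMem hp]
        linarith

/-- Type `i` may still be accepted after the target of the segment. -/
def liveEvent (i : Fin n) (t : ℕ) : Set (Coins n) :=
  {c | (𝒪 c t).seen i < (𝒪 c t).quota i ∨ (𝒪 c t).prev i = true}

/-- Beyond the target, the first rejecting coin stops acceptances of the type until the next
segment, so it occurs at most once per segment. -/
theorem occ_tail_inter_le (hN : 0 < segLen T) (hG : 0 ≤ 𝒢) (i : Fin n) (c : Coins n) {t : ℕ}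
    (ht : segLen T ≤ t) :
    occ T (fun s => tailEvent I P α δ T a i s ∩ {c | ¬ (c (Sum.inl s) : ℝ) < 1 - α}) c t +
      (liveEvent I P α δ T a i t).indicator 1 c ≤ (t / segLen T : ℕ) := by
  induction t, ht using Nat.le_induction with
  | base =>
    simp only [occ_init, Nat.div_self hN, zero_add, Nat.cast_one]
    exact indicator_one_le _ c
  | succ t ht ih =>
    rw [occ_succ T _ c ht]
    set H := tailEvent I P α δ T a i t ∩ {c | ¬ (c (Sum.inl t) : ℝ) < 1 - α}
    have hHp : H.indicator (1 : Coins n → ℝ) c ≤ (liveEvent I P α δ T a i t).indicator 1 c :=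
      Set.indicator_le_indicator_of_subset (fun c hc => Or.inr hc.1.2.2)
        (fun _ => zero_le_one' ℝ) c
    by_cases hb : segLen T ∣ t + 1
    · rw [Nat.succ_div_of_dvd hb, Nat.cast_succ]
      have := indicator_one_le (liveEvent I P α δ T a i (t + 1)) c
      linarith
    · rw [Nat.succ_div_of_not_dvd hb]
      by_cases hp : c ∈ liveEvent I P α δ T a i (t + 1)
      · have h1 : c ∉ H := by
          rintro ⟨⟨h2, h3, -⟩, h5⟩
          rcases hp with h6 | h6
          · rw [opened_succ_seen I P α δ T a c ht, opened_succ_quota I P α δ T a c ht,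
              if_neg hb, if_neg hb, if_pos h2] at h6
            omega
          · rw [opened_succ_prev I P α δ T a c ht, if_pos h2] at h6
            exact h5 (prev_of_decision_of_quota_lt I P α δ T a hG c h2 h3 h6).2
        have h2 : c ∈ liveEvent I P α δ T a i t := by
          by_contra h3
          simp only [liveEvent, Set.mem_ofPred_eq, not_or, not_lt] at h3
          rcases hp with h6 | h6
          · rw [opened_succ_seen I P α δ T a c ht, opened_succ_quota I P α δ T a c ht,
              if_neg hb, if_neg hb] at h6
            split_ifs at h6 <;> omega
          · rw [opened_succ_prev I P α δ T a c ht] at h6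
            split_ifs at h6 with h7
            · exact h3.2 (prev_of_decision_of_quota_lt I P α δ T a hG c h7 (by omega) h6).1
            · exact h3.2 h6
        rw [Set.indicator_of_mem h2] at ih
        rw [Set.indicator_of_mem hp, Set.indicator_of_notMem h1]
        linarith
      · rw [Set.indicator_of_notMem hp]
        linarith

theorem measurableSet_waitEvent (i : Fin n) (t : ℕ) :
    MeasurableSet[coinPast n t] (waitEvent I P α δ T a i t) :=
  measurableSet_opened I P α δ T a le_rfl fun s => a t = some i ∧ s.closing = false ∧
    (s.seen i : ℝ) + 1 < s.quota i - 𝒢 ∧ s.prev i = false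

theorem measurableSet_tailEvent (i : Fin n) (t : ℕ) :
    MeasurableSet[coinPast n t] (tailEvent I P α δ T a i t) :=
  measurableSet_opened I P α δ T a le_rfl fun s => a t = some i ∧
    s.quota i < s.seen i + 1 ∧ s.prev i = true

theorem measurableSet_inl_lt (t : ℕ) (p : ℝ) :
    MeasurableSet {c : Coins n | (c (Sum.inl t) : ℝ) < p} :=
  measurableSet_lt (measurable_subtype_coe.comp (measurable_pi_apply _)) measurable_const

/-- As in Wald's identity: the current coin is independent of the waiting event, so `α` times the
expected number of waiting customers is the expected number of favourable coins, which is at most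
the number of segments. -/
theorem integral_occ_wait_le (hα : α ∈ Set.Ioo (0 : ℝ) 1) (hN : 0 < segLen T)
    (hG : I.abar ≤ 𝒢) (i : Fin n) {t : ℕ} (ht : segLen T ≤ t) :
    ∫ c, occ T (waitEvent I P α δ T a i) c t ∂coinLaw n ≤ (t / segLen T : ℕ) / α := by
  have hm : ∀ s, MeasurableSet (waitEvent I P α δ T a i s) := fun s =>
    measurableSet_of_coinPast (measurableSet_waitEvent I P α δ T a i s)
  have hm' : ∀ s, MeasurableSet
      (waitEvent I P α δ T a i s ∩ {c | (c (Sum.inl s) : ℝ) < α}) := fun s =>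
    (hm s).inter (measurableSet_inl_lt s α)
  rw [le_div_iff₀ hα.1, integral_occ T hm, Finset.sum_mul]
  calc _ = ∑ s ∈ Finset.Ico (segLen T) t, (coinLaw n).real
        (waitEvent I P α δ T a i s ∩ {c | (c (Sum.inl s) : ℝ) < α}) :=
        Finset.sum_congr rfl fun s _ => (real_inter_coin_lt
          (measurableSet_waitEvent I P α δ T a i s) hα.1.le hα.2.le).symm
    _ = _ := (integral_occ T hm' t).symm
    _ ≤ ∫ _, ((t / segLen T : ℕ) : ℝ) ∂coinLaw n := by
      refine integral_mono (integrable_occ T hm' t) (integrable_const _) fun c => ?_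
      have := occ_wait_inter_le I P α δ T a hN hG i c ht
      have := indicator_one_nonneg (pendingEvent I P α δ T a i t) c
      linarith
    _ = _ := by simp

theorem integral_occ_tail_le (hα : α ∈ Set.Ioo (0 : ℝ) 1) (hN : 0 < segLen T)
    (hG : 0 ≤ 𝒢) (i : Fin n) {t : ℕ} (ht : segLen T ≤ t) :
    ∫ c, occ T (tailEvent I P α δ T a i) c t ∂coinLaw n ≤ (t / segLen T : ℕ) / α := by
  have hm : ∀ s, MeasurableSet (tailEvent I P α δ T a i s) := fun s =>
    measurableSet_of_coinPast (measurableSet_tailEvent I P α δ T a i s)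
  have hm' : ∀ s, MeasurableSet
      (tailEvent I P α δ T a i s ∩ {c | ¬ (c (Sum.inl s) : ℝ) < 1 - α}) := fun s =>
    (hm s).inter (measurableSet_inl_lt s (1 - α)).compl
  rw [le_div_iff₀ hα.1, integral_occ T hm, Finset.sum_mul]
  calc _ = ∑ s ∈ Finset.Ico (segLen T) t, (coinLaw n).real
        (tailEvent I P α δ T a i s ∩ {c | ¬ (c (Sum.inl s) : ℝ) < 1 - α}) :=
        Finset.sum_congr rfl fun s _ => by
          rw [real_inter_coin_ge (measurableSet_tailEvent I P α δ T a i s)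
            (by linarith [hα.2]) (by linarith [hα.1]), sub_sub_cancel]
    _ = _ := (integral_occ T hm' t).symm
    _ ≤ ∫ _, ((t / segLen T : ℕ) : ℝ) ∂coinLaw n := by
      refine integral_mono (integrable_occ T hm' t) (integrable_const _) fun c => ?_
      have := occ_tail_inter_le I P α δ T a hN hG i c ht
      have := indicator_one_nonneg (liveEvent I P α δ T a i t) c
      linarith
    _ = _ := by simp

theorem auxAccepted_le (i : Fin n) : auxAccepted I P T a i ≤ segLen T :=
  (Finset.card_filter_le _ _).trans (by simp)

/-- Total deviation of the binomial samples of type `i` from their mean. -/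
def sampleDev (c : Coins n) (i : Fin n) : ℝ :=
  ∑ k ∈ Finset.Icc 1 (T / segLen T), |(segSample I P T a c k i : ℝ) - auxAccepted I P T a i|

/-- Total deviation of the type `i` arrivals of the segments from those of the first one. -/
def arrivalDev (i : Fin n) : ℝ :=
  ∑ k ∈ Finset.Ico 1 (T / segLen T),
    |arrivalsIn a i (segLen T * k) (segLen T * (k + 1)) - arrivalsIn a i 0 (segLen T)|

theorem sampleDev_nonneg (c : Coins n) (i : Fin n) : 0 ≤ sampleDev I P T a c i :=
  Finset.sum_nonneg fun _ _ => abs_nonneg _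

theorem arrivalDev_nonneg (i : Fin n) : 0 ≤ arrivalDev T a i :=
  Finset.sum_nonneg fun _ _ => abs_nonneg _

theorem abs_sum_segSample_sub_le (c : Coins n) (i : Fin n) {k : ℕ} (hk : k ≤ T / segLen T) :
    |∑ k ∈ Finset.Icc 1 k, (segSample I P T a c k i : ℝ) - k * auxAccepted I P T a i| ≤
      sampleDev I P T a c i := by
  have : ∑ k ∈ Finset.Icc 1 k, (segSample I P T a c k i : ℝ) - k * auxAccepted I P T a i =
      ∑ k ∈ Finset.Icc 1 k, ((segSample I P T a c k i : ℝ) - auxAccepted I P T a i) := by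
    simp [Finset.sum_sub_distrib]
  rw [this]
  exact (Finset.abs_sum_le_sum_abs _ _).trans
    (Finset.sum_le_sum_of_subset_of_nonneg (Finset.Icc_subset_Icc le_rfl hk)
      fun _ _ _ => abs_nonneg _)

/-- Upper bound for the periods that are lost by an early start of the closing grace period. -/
def lostPeriods (c : Coins n) : ℝ :=
  (∑ j, (I.ρ j)⁻¹) * (𝒢 + I.abar * ∑ i, (sampleDev I P T a c i +
    occ T (tailEvent I P α δ T a i) c T))

theorem lostPeriods_nonneg (hG : 0 ≤ 𝒢) (c : Coins n) : 0 ≤ lostPeriods I P α δ T a c := by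
  refine mul_nonneg (Finset.sum_nonneg fun j _ => (inv_pos.2 (I.ρ_pos j)).le) (add_nonneg hG ?_)
  exact mul_nonneg I.abar_pos.le (Finset.sum_nonneg fun i _ =>
    add_nonneg (sampleDev_nonneg I P T a c i) (occ_nonneg T _ c T))

/-- The auxiliary run respects the budget `ρ j * N`, so after `k` segments planned consumption is at
most `k * ρ j * N`. If a resource is nearly exhausted anyway, the rest of its capacity must have
gone into sample deviations and tail acceptances. -/
theorem sub_le_lostPeriods (hN : 0 < segLen T) (hG : 0 ≤ 𝒢)
    (haux : ∀ j, ∑ i, I.A i j * auxAccepted I P T a i ≤ I.ρ j * segLen T) (c : Coins n) {t : ℕ}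
    (ht : segLen T ≤ t) (htT : t ≤ T) (hc : (𝒪 c t).closing = true) :
    (T : ℝ) - (t / segLen T : ℕ) * segLen T ≤ lostPeriods I P α δ T a c := by
  obtain ⟨j, hj⟩ := exists_cap_le_of_closing I P α δ T a c ht hc
  rw [cap_eq I P α δ T a c ht] at hj
  set k := t / segLen T
  set S := ∑ i, (sampleDev I P T a c i + occ T (tailEvent I P α δ T a i) c T)
  have hS : ∀ i, 0 ≤ sampleDev I P T a c i + occ T (tailEvent I P α δ T a i) c T := fun i =>
    add_nonneg (sampleDev_nonneg I P T a c i) (occ_nonneg T _ c T)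
  have h1 : ∀ i, occ T (acceptEvent I P α δ T a i) c t ≤ k * auxAccepted I P T a i +
      (sampleDev I P T a c i + occ T (tailEvent I P α δ T a i) c T) := by
    intro i
    have h2 := accepted_add_le I P α δ T a hN hG i c ht
    have h3 := le_max_left 0 (((𝒪 c t).quota i : ℝ) - (𝒪 c t).seen i)
    have h4 := (abs_le.1 (abs_sum_segSample_sub_le I P T a c i
      (Nat.div_le_div_right (c := segLen T) htT))).2
    have h5 := occ_mono T (tailEvent I P α δ T a i) c htT
    have h6 : (0 : ℝ) ≤ (𝒪 c t).rej i := Nat.cast_nonneg _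
    linarith
  have h2 : ∑ i, I.A i j * occ T (acceptEvent I P α δ T a i) c t ≤
      k * (I.ρ j * segLen T) + I.abar * S := by
    calc _ ≤ ∑ i, (k * (I.A i j * auxAccepted I P T a i) + I.abar *
          (sampleDev I P T a c i + occ T (tailEvent I P α δ T a i) c T)) := by
          refine Finset.sum_le_sum fun i _ => ?_
          have h3 := mul_le_mul_of_nonneg_left (h1 i) (I.A_nonneg i j)
          have h4 := mul_le_mul_of_nonneg_right (I.A_le i j) (hS i)
          linarith
      _ ≤ _ := by
        rw [Finset.sum_add_distrib, ← Finset.mul_sum, ← Finset.mul_sum]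
        have := mul_le_mul_of_nonneg_left (haux j) (Nat.cast_nonneg (α := ℝ) k)
        linarith
  have h3 : I.ρ j * ((T : ℝ) - k * segLen T) ≤ 𝒢 + I.abar * S := by linarith
  have h4 : 0 ≤ 𝒢 + I.abar * S :=
    add_nonneg hG (mul_nonneg I.abar_pos.le (Finset.sum_nonneg fun i _ => hS i))
  calc _ ≤ (I.ρ j)⁻¹ * (𝒢 + I.abar * S) := by
        rwa [inv_mul_eq_div, le_div_iff₀ (I.ρ_pos j), mul_comm]
    -- The scarce resource depends on the coins; summing over all resources makes the bound uniform.
    _ ≤ _ := mul_le_mul_of_nonneg_right (Finset.single_le_sum (f := fun j => (I.ρ j)⁻¹)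
        (fun j _ => (inv_pos.2 (I.ρ_pos j)).le) (Finset.mem_univ j)) h4

/-- Selects the period at which the two estimates meet: `le_accepted_add` holds up to it, and
closing, if it occurs before the horizon, begins right after it. -/
theorem exists_last_not_closing (c : Coins n) {t : ℕ} (ht : segLen T ≤ t) :
    t = segLen T ∨ (𝒪 c (segLen T)).closing = true ∨ ∃ s ∈ Finset.Ico (segLen T) t,
      (𝒪 c s).closing = false ∧ (s + 1 = t ∨ s + 1 < t ∧ (𝒪 c (s + 1)).closing = true) := by
  induction t, ht using Nat.le_induction with
  | base => exact Or.inl rfl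
  | succ t ht ih =>
    right
    rcases ih with rfl | h | ⟨s, hs, h1, h2⟩
    · by_cases h : (𝒪 c (segLen T)).closing = true
      · exact Or.inl h
      · exact Or.inr ⟨segLen T, by simp, by simpa using h, Or.inl rfl⟩
    · exact Or.inl h
    · right
      by_cases h : (𝒪 c t).closing = true
      · refine ⟨s, Finset.Ico_subset_Ico le_rfl t.le_succ hs, h1, Or.inr ?_⟩
        rcases h2 with h2 | h2
        · rw [h2]
          exact ⟨t.lt_succ_self, h⟩
        · exact ⟨h2.1.trans t.lt_succ_self, h2.2⟩
      · exact ⟨t, by simpa using ht, by simpa using h, Or.inl rfl⟩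

/-- Obtained from `le_accepted_add` and `rej_le`. The current segment may be unfinished; its open
target minus the inherited debt is at most its sample, hence the term `segLen T`. -/
theorem sum_segSample_le (hN : 0 < segLen T) (hG : I.abar ≤ 𝒢) (i : Fin n) (c : Coins n) {t : ℕ}
    (ht : segLen T ≤ t) (htT : t ≤ T) (hc : (𝒪 c t).closing = false) :
    ∑ k ∈ Finset.Icc 1 (t / segLen T), (segSample I P T a c k i : ℝ) ≤
      occ T (acceptEvent I P α δ T a i) c t + segLen T +
        ((T / segLen T : ℕ) + 1) * (𝒢 + 1) + arrivalDev T a i +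
        occ T (waitEvent I P α δ T a i) c T := by
  have h1 := le_accepted_add I P α δ T a hN hG i c ht hc
  have h2 := rej_le I P α δ T a hN hG i c ht hc
  have h3 : max 0 (min ((𝒪 c t).seen i : ℝ) ((𝒪 c t).quota i) - (𝒪 c t).quota i + 𝒢 + 1) ≤
      𝒢 + 1 := by
    refine max_le ?_ ?_
    · have := I.abar_pos
      linarith
    · linarith [min_le_right ((𝒪 c t).seen i : ℝ) ((𝒪 c t).quota i)]
  have h4 : max 0 (((𝒪 c t).quota i : ℝ) - (𝒪 c t).seen i) ≤ (𝒪 c t).quota i :=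
    max_le (Nat.cast_nonneg _) (sub_le_self _ (Nat.cast_nonneg _))
  have h5 : (segSample I P T a c (t / segLen T) i : ℝ) ≤ segLen T := by
    exact_mod_cast (segSample_le I P T a c _ i).trans (Nat.count_le _)
  have h6 := occ_mono T (waitEvent I P α δ T a i) c htT
  have hk : t / segLen T ≤ T / segLen T := Nat.div_le_div_right htT
  have h7 : ∑ k ∈ Finset.Ico 1 (t / segLen T),
      |arrivalsIn a i (segLen T * k) (segLen T * (k + 1)) - arrivalsIn a i 0 (segLen T)| ≤
      arrivalDev T a i :=
    Finset.sum_le_sum_of_subset_of_nonneg (Finset.Ico_subset_Ico le_rfl hk)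
      fun _ _ _ => abs_nonneg _
  have h8 : ((t / segLen T : ℕ) : ℝ) * (𝒢 + 1) ≤ (T / segLen T : ℕ) * (𝒢 + 1) := by
    have : (0 : ℝ) ≤ 𝒢 + 1 := by linarith [I.abar_pos]
    gcongr
  linarith

/-- Upper bound for the lost revenue. -/
def lostRevenue (c : Coins n) : ℝ :=
  (∑ i, I.r i) * (segLen T + lostPeriods I P α δ T a c) +
    ∑ i, I.r i * (segLen T + ((T / segLen T : ℕ) + 1) * (𝒢 + 1) + arrivalDev T a i +
      occ T (waitEvent I P α δ T a i) c T + sampleDev I P T a c i)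

theorem le_accepted_add_lostRevenue (hN : 0 < segLen T) (hT : segLen T < T) (hG : I.abar ≤ 𝒢)
    (haux : ∀ j, ∑ i, I.A i j * auxAccepted I P T a i ≤ I.ρ j * segLen T) (c : Coins n) :
    (T : ℝ) / segLen T * ∑ i, I.r i * auxAccepted I P T a i ≤
      ∑ i, I.r i * occ T (acceptEvent I P α δ T a i) c T + lostRevenue I P α δ T a c := by
  have hG0 : 0 ≤ 𝒢 := I.abar_pos.le.trans hG
  have hN' : (0 : ℝ) < segLen T := by exact_mod_cast hN
  have hR : ∑ i, I.r i * auxAccepted I P T a i ≤ (∑ i, I.r i) * segLen T := by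
    rw [Finset.sum_mul]
    refine Finset.sum_le_sum fun i _ => mul_le_mul_of_nonneg_left ?_ (I.r_nonneg i)
    exact_mod_cast auxAccepted_le I P T a i
  have hr : 0 ≤ ∑ i, I.r i := Finset.sum_nonneg fun i _ => I.r_nonneg i
  have hlost := lostPeriods_nonneg I P α δ T a hG0 c
  -- Auxiliary revenue per period is at most `∑ i, r i`, so the periods outside the first `k`
  -- segment lengths are charged at this rate.
  have hsplit : ∀ k : ℕ, (T : ℝ) - k * segLen T ≤ segLen T + lostPeriods I P α δ T a c →
      (T : ℝ) / segLen T * ∑ i, I.r i * auxAccepted I P T a i ≤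
        k * ∑ i, I.r i * auxAccepted I P T a i +
          (∑ i, I.r i) * (segLen T + lostPeriods I P α δ T a c) := by
    intro k hk
    have h1 : (T : ℝ) / segLen T * ∑ i, I.r i * auxAccepted I P T a i =
        k * ∑ i, I.r i * auxAccepted I P T a i +
        ((T : ℝ) - k * segLen T) * ((∑ i, I.r i * auxAccepted I P T a i) / segLen T) := by
      field_simp
      ring
    have h2 : 0 ≤ (∑ i, I.r i * auxAccepted I P T a i) / segLen T :=
      div_nonneg (Finset.sum_nonneg fun i _ => mul_nonneg (I.r_nonneg i) (Nat.cast_nonneg _)) hN'.le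
    have h3 : (∑ i, I.r i * auxAccepted I P T a i) / segLen T ≤ ∑ i, I.r i :=
      (div_le_iff₀ hN').2 hR
    rw [h1, add_le_add_iff_left]
    calc _ ≤ (segLen T + lostPeriods I P α δ T a c) *
          ((∑ i, I.r i * auxAccepted I P T a i) / segLen T) := by gcongr
      _ ≤ (segLen T + lostPeriods I P α δ T a c) * ∑ i, I.r i := by gcongr
      _ = _ := mul_comm _ _
  have hnn : 0 ≤ ∑ i, I.r i * (segLen T + ((T / segLen T : ℕ) + 1) * (𝒢 + 1) + arrivalDev T a i +
      occ T (waitEvent I P α δ T a i) c T + sampleDev I P T a c i) := by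
    refine Finset.sum_nonneg fun i _ => mul_nonneg (I.r_nonneg i) ?_
    have h1 := arrivalDev_nonneg T a i
    have h2 := occ_nonneg T (waitEvent I P α δ T a i) c T
    have h3 := sampleDev_nonneg I P T a c i
    positivity
  have hacc : 0 ≤ ∑ i, I.r i * occ T (acceptEvent I P α δ T a i) c T :=
    Finset.sum_nonneg fun i _ => mul_nonneg (I.r_nonneg i) (occ_nonneg T _ c T)
  rw [lostRevenue]
  rcases exists_last_not_closing I P α δ T a c hT.le with h | h | ⟨t, ht, hc, h⟩
  · exact absurd h hT.ne'
  -- Closing from the start: `k = 0`, and the whole horizon is charged to the estimation phase and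
  -- the lost periods.
  · have h1 := sub_le_lostPeriods I P α δ T a hN hG0 haux c le_rfl hT.le h
    rw [Nat.div_self hN, Nat.cast_one, one_mul] at h1
    have h2 := hsplit 0 (by simp only [Nat.cast_zero, zero_mul, sub_zero]; linarith)
    simp only [Nat.cast_zero, zero_mul, zero_add] at h2
    linarith
  · obtain ⟨ht1, ht2⟩ := Finset.mem_Ico.1 ht
    have hk : (T : ℝ) - (t / segLen T : ℕ) * segLen T ≤
        segLen T + lostPeriods I P α δ T a c := by
      rcases h with h | ⟨h1, h2⟩
      · have h3 : T ≤ (t / segLen T) * segLen T + segLen T :=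
          h.symm.trans_le (Nat.lt_div_mul_add hN)
        have h4 : (T : ℝ) ≤ (t / segLen T : ℕ) * segLen T + segLen T := by exact_mod_cast h3
        linarith
      · have h3 := sub_le_lostPeriods I P α δ T a hN hG0 haux c (by omega) h1.le h2
        have h4 : (t + 1) / segLen T ≤ t / segLen T + 1 := by
          rw [Nat.succ_div]
          split_ifs <;> omega
        have h5 : (((t + 1) / segLen T : ℕ) : ℝ) * segLen T ≤
            ((t / segLen T : ℕ) + 1) * segLen T := by
          exact_mod_cast Nat.mul_le_mul_right _ h4
        linarith
    refine (hsplit _ hk).trans ?_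
    have h1 : ((t / segLen T : ℕ) : ℝ) * ∑ i, I.r i * auxAccepted I P T a i ≤
        ∑ i, I.r i * (occ T (acceptEvent I P α δ T a i) c T +
          (segLen T + ((T / segLen T : ℕ) + 1) * (𝒢 + 1) + arrivalDev T a i +
          occ T (waitEvent I P α δ T a i) c T + sampleDev I P T a c i)) := by
      rw [Finset.mul_sum]
      refine Finset.sum_le_sum fun i _ => ?_
      rw [mul_left_comm]
      refine mul_le_mul_of_nonneg_left ?_ (I.r_nonneg i)
      have h2 := (abs_le.1 (abs_sum_segSample_sub_le I P T a c i
        (Nat.div_le_div_right (c := segLen T) ht2.le))).1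
      have h3 := sum_segSample_le I P α δ T a hN hG i c ht1 ht2.le hc
      have h4 := occ_mono T (acceptEvent I P α δ T a i) c ht2.le
      linarith
    simp only [mul_add (I.r _) (occ _ _ _ _) (_ + _), Finset.sum_add_distrib] at h1
    linarith

end Pathwise

/-! ### Dependence on the first `T` arrivals only, and joint measurability. -/

section Prefix

variable {n L : ℕ}

/-- The arrival sequence with the given first `T` arrivals and no further ones. -/
def extendArrivals (T : ℕ) (b : Fin T → Arrival n) (t : ℕ) : Arrival n :=
  if h : t < T then b ⟨t, h⟩ else none

theorem extendArrivals_restrict (T : ℕ) (a : ℕ → Arrival n) {t : ℕ} (ht : t < T) :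
    extendArrivals T (fun s => a s) t = a t := by
  simp [extendArrivals, ht]

/-- The function factors through the finitely many arrival prefixes of length `T`, so measurability
in the coins for each arrival sequence is enough. -/
theorem measurable_prod_of_prefix (T : ℕ) {f : (ℕ → Arrival n) × Coins n → ℝ}
    (hf : ∀ a a' c, (∀ t < T, a t = a' t) → f (a, c) = f (a', c))
    (hm : ∀ a, Measurable fun c => f (a, c)) : Measurable f := by
  have h1 : Measurable fun q : (Fin T → Arrival n) × Coins n => f (extendArrivals T q.1, q.2) :=
    measurable_from_prod_countable_right fun b => hm (extendArrivals T b)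
  have h2 : Measurable fun q : (ℕ → Arrival n) × Coins n => ((fun s : Fin T => q.1 s), q.2) := by
    fun_prop
  convert! h1.comp h2 using 1
  ext ⟨a, c⟩
  exact hf _ _ _ fun t ht => (extendArrivals_restrict T a ht).symm

theorem measurable_of_prefix (T : ℕ) {f : (ℕ → Arrival n) → ℝ}
    (hf : ∀ a a', (∀ t < T, a t = a' t) → f a = f a') : Measurable f := by
  have h1 : Measurable fun b : Fin T → Arrival n => f (extendArrivals T b) :=
    measurable_of_countable _
  have h2 : Measurable fun a : ℕ → Arrival n => (fun s : Fin T => a s) := by fun_prop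
  convert! h1.comp h2 using 1
  ext a
  exact hf _ _ fun t ht => (extendArrivals_restrict T a ht).symm

theorem numArrivals_congr {a a' : ℕ → Arrival n} {T t : ℕ} (h : ∀ t < T, a t = a' t)
    (ht : t ≤ T) (i : Fin n) : numArrivals a i t = numArrivals a' i t := by
  simp only [numArrivals, Nat.count_eq_card_filter_range]
  congr 1
  refine Finset.filter_congr fun s hs => ?_
  rw [h s ((Finset.mem_range.1 hs).trans_le ht)]

theorem bpcState_congr (I : Problem n L) (P : OGDParams) (H : ℕ) {a a' : ℕ → Arrival n} {T t : ℕ}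
    (h : ∀ t < T, a t = a' t) (ht : t ≤ T) : bpcState I P H a t = bpcState I P H a' t := by
  induction t with
  | zero => rfl
  | succ t ih => rw [bpcState, bpcState, ih (by omega), h t ht]

theorem auxAccepted_congr (I : Problem n L) (P : OGDParams) {a a' : ℕ → Arrival n} {T T' : ℕ}
    (h : ∀ t < T', a t = a' t) (hT : segLen T ≤ T') (i : Fin n) :
    auxAccepted I P T a i = auxAccepted I P T a' i := by
  unfold auxAccepted
  congr 1
  refine Finset.filter_congr fun s hs => ?_
  have hs' := (Finset.mem_range.1 hs).trans_le hT
  rw [h s hs', bpcState_congr I P _ h hs'.le]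

theorem segSample_congr (I : Problem n L) (P : OGDParams) {a a' : ℕ → Arrival n} {T : ℕ}
    (h : ∀ t < T, a t = a' t) (hT : segLen T ≤ T) (c : Coins n) (k : ℕ) (i : Fin n) :
    segSample I P T a c k i = segSample I P T a' c k i := by
  unfold segSample
  rw [auxAccepted_congr I P h hT, numArrivals_congr h hT]

theorem gpState_congr (I : Problem n L) (P : OGDParams) (α δ : ℝ) {a a' : ℕ → Arrival n} {T t : ℕ}
    (h : ∀ t < T, a t = a' t) (hT : segLen T ≤ T) (c : Coins n) (ht : t ≤ T) :
    gpState I P α δ T a c t = gpState I P α δ T a' c t := by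
  induction t with
  | zero => rfl
  | succ t ih =>
    have h1 : opened I P α δ T a c t = opened I P α δ T a' c t := by
      rw [opened_eq_openWith, opened_eq_openWith, ih (by omega)]
      simp only [segSample_congr I P h hT]
    have h2 : decision I P α δ T a c t = decision I P α δ T a' c t := by
      rw [decision_eq_decideWith, decision_eq_decideWith, h1, h t ht]
    by_cases hN : segLen T ≤ t
    · rw [gpState_succ I P α δ T a c hN, gpState_succ I P α δ T a' c hN, h1, h2, h t ht]
    · simp only [gpState, if_pos (not_le.1 hN)]
      exact ih (by omega)

theorem gpEnhancedBPCOGD_congr (I : Problem n L) (P : OGDParams) (α δ : ℝ)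
    {a a' : ℕ → Arrival n} {T t : ℕ} (h : ∀ t < T, a t = a' t) (hT : segLen T ≤ T) (c : Coins n)
    (ht : t < T) :
    gpEnhancedBPCOGD I P α δ T a c t = gpEnhancedBPCOGD I P α δ T a' c t := by
  have h1 : opened I P α δ T a c t = opened I P α δ T a' c t := by
    rw [opened_eq_openWith, opened_eq_openWith, gpState_congr I P α δ h hT c ht.le]
    simp only [segSample_congr I P h hT]
  have h2 : decision I P α δ T a c t = decision I P α δ T a' c t := by
    rw [decision_eq_decideWith, decision_eq_decideWith, h1, h t ht]
  change (_ && decision I P α δ T a c t) = (_ && decision I P α δ T a' c t)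
  rw [h2]

theorem revenue_congr (I : Problem n L) {a a' : ℕ → Arrival n} {T : ℕ}
    (h : ∀ t < T, a t = a' t) {acc acc' : ℕ → Bool} (h' : ∀ t < T, acc t = acc' t) :
    revenue I a acc T = revenue I a' acc' T := by
  refine Finset.sum_congr rfl fun t ht => ?_
  rw [h t (Finset.mem_range.1 ht), h' t (Finset.mem_range.1 ht)]

theorem hindsight_congr (I : Problem n L) {a a' : ℕ → Arrival n} {T : ℕ}
    (h : ∀ t < T, a t = a' t) : hindsight I a T = hindsight I a' T := by
  simp only [hindsight, numArrivals_congr h le_rfl]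

end Prefix

/-! ### The hindsight linear program. -/

section Revenue

variable {n L : ℕ} (I : Problem n L)

/-- Number of accepted customers of type `i` in periods `0, …, T - 1`. -/
def numAccepted (a : ℕ → Arrival n) (acc : ℕ → Bool) (i : Fin n) (T : ℕ) : ℝ :=
  ∑ t ∈ Finset.range T, if a t = some i ∧ acc t = true then 1 else 0

theorem numAccepted_succ (a : ℕ → Arrival n) (acc : ℕ → Bool) (i : Fin n) (T : ℕ) :
    numAccepted a acc i (T + 1) = numAccepted a acc i T +
      if a T = some i ∧ acc T = true then 1 else 0 :=
  Finset.sum_range_succ _ _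

theorem numAccepted_nonneg (a : ℕ → Arrival n) (acc : ℕ → Bool) (i : Fin n) (T : ℕ) :
    0 ≤ numAccepted a acc i T :=
  Finset.sum_nonneg fun _ _ => by split_ifs <;> norm_num

theorem numAccepted_le (a : ℕ → Arrival n) (acc : ℕ → Bool) (i : Fin n) (T : ℕ) :
    numAccepted a acc i T ≤ numArrivals a i T := by
  rw [numArrivals_eq, arrivalsIn, ← Finset.range_eq_Ico]
  refine Finset.sum_le_sum fun t _ => ?_
  split_ifs <;> simp_all

theorem revenue_eq_sum (a : ℕ → Arrival n) (acc : ℕ → Bool) (T : ℕ) :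
    revenue I a acc T = ∑ i, I.r i * numAccepted a acc i T := by
  simp only [revenue, numAccepted, Finset.mul_sum]
  rw [Finset.sum_comm]
  refine Finset.sum_congr rfl fun t _ => ?_
  cases h : a t with
  | none => simp
  | some k =>
    rw [Finset.sum_eq_single k]
    · simp
    · intro i _ hi
      simp [hi.symm]
    · simp

theorem bddAbove_hindsight (a : ℕ → Arrival n) (T : ℕ) :
    ∀ v ∈ {v | ∃ x : Fin n → ℝ,
      (∀ i, 0 ≤ x i ∧ x i ≤ numArrivals a i T) ∧
      (∀ j, ∑ i, I.A i j * x i ≤ I.ρ j * T) ∧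
      v = ∑ i, I.r i * x i}, v ≤ (∑ i, I.r i) * T := by
  rintro v ⟨x, hx, -, rfl⟩
  rw [Finset.sum_mul]
  refine Finset.sum_le_sum fun i _ => mul_le_mul_of_nonneg_left ((hx i).2.trans ?_) (I.r_nonneg i)
  exact_mod_cast Nat.count_le _

theorem le_hindsight {a : ℕ → Arrival n} {T : ℕ} {x : Fin n → ℝ}
    (h : ∀ i, 0 ≤ x i ∧ x i ≤ numArrivals a i T) (h' : ∀ j, ∑ i, I.A i j * x i ≤ I.ρ j * T) :
    ∑ i, I.r i * x i ≤ hindsight I a T :=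
  le_csSup ⟨_, bddAbove_hindsight I a T⟩ ⟨x, h, h', rfl⟩

theorem zero_feasible (a : ℕ → Arrival n) (T : ℕ) :
    (∀ i : Fin n, 0 ≤ (0 : ℝ) ∧ (0 : ℝ) ≤ numArrivals a i T) ∧
      ∀ j, ∑ i, I.A i j * (0 : ℝ) ≤ I.ρ j * T := by
  refine ⟨fun i => ⟨le_rfl, Nat.cast_nonneg _⟩, fun j => ?_⟩
  have := I.ρ_pos j
  simp only [mul_zero, Finset.sum_const_zero]
  positivity

theorem hindsight_nonneg (a : ℕ → Arrival n) (T : ℕ) : 0 ≤ hindsight I a T := by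
  have h := zero_feasible I a T
  simpa using le_hindsight I (x := fun _ => 0) h.1 h.2

theorem hindsight_le {a : ℕ → Arrival n} {T : ℕ} {M : ℝ}
    (h : ∀ x : Fin n → ℝ, (∀ i, 0 ≤ x i ∧ x i ≤ numArrivals a i T) →
      (∀ j, ∑ i, I.A i j * x i ≤ I.ρ j * T) → ∑ i, I.r i * x i ≤ M) : hindsight I a T ≤ M := by
  have h0 := zero_feasible I a T
  refine csSup_le ⟨_, fun _ => 0, h0.1, h0.2, rfl⟩ ?_
  rintro v ⟨x, h1, h2, rfl⟩
  exact h x h1 h2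

theorem hindsight_le_mul (a : ℕ → Arrival n) (T : ℕ) : hindsight I a T ≤ (∑ i, I.r i) * T :=
  hindsight_le I fun x h1 h2 => bddAbove_hindsight I a T _ ⟨x, h1, h2, rfl⟩

/-- Scaling a solution of the linear program for horizon `T` down to horizon `N`. -/
theorem hindsight_le_scaled (a : ℕ → Arrival n) {N T : ℕ} (hN : 0 < N) (hT : 0 < T) :
    hindsight I a T ≤ (T : ℝ) / N * (hindsight I a N +
      ∑ i, I.r i * |(N : ℝ) / T * numArrivals a i T - numArrivals a i N|) := by
  have hN' : (0 : ℝ) < N := by exact_mod_cast hN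
  have hT' : (0 : ℝ) < T := by exact_mod_cast hT
  refine hindsight_le I fun x h1 h2 => ?_
  -- Scaling keeps the capacity constraints; truncation restores the arrival constraint and costs at
  -- most the deviation of the arrivals from proportionality.
  have h3 : ∑ i, I.r i * min ((N : ℝ) / T * x i) (numArrivals a i N) ≤ hindsight I a N := by
    refine le_hindsight I (fun i => ⟨le_min (mul_nonneg (by positivity) (h1 i).1)
      (Nat.cast_nonneg _), min_le_right _ _⟩) fun j => ?_
    calc _ ≤ ∑ i, (N : ℝ) / T * (I.A i j * x i) := by
          refine Finset.sum_le_sum fun i _ => ?_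
          rw [mul_left_comm]
          exact mul_le_mul_of_nonneg_left (min_le_left _ _) (I.A_nonneg i j)
      _ ≤ (N : ℝ) / T * (I.ρ j * T) := by
          rw [← Finset.mul_sum]
          exact mul_le_mul_of_nonneg_left (h2 j) (by positivity)
      _ = I.ρ j * N := by
          field_simp
  have h4 : (N : ℝ) / T * ∑ i, I.r i * x i ≤ hindsight I a N +
      ∑ i, I.r i * |(N : ℝ) / T * numArrivals a i T - numArrivals a i N| := by
    refine le_trans ?_ (add_le_add_left h3 _)
    rw [Finset.mul_sum, ← Finset.sum_add_distrib]
    refine Finset.sum_le_sum fun i _ => ?_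
    rw [mul_left_comm, ← mul_add]
    refine mul_le_mul_of_nonneg_left ?_ (I.r_nonneg i)
    rw [min_add]
    have h5 : (N : ℝ) / T * x i ≤ (N : ℝ) / T * numArrivals a i T :=
      mul_le_mul_of_nonneg_left (h1 i).2 (by positivity)
    have h6 := le_abs_self ((N : ℝ) / T * numArrivals a i T - numArrivals a i N)
    have h7 := abs_nonneg ((N : ℝ) / T * numArrivals a i T - numArrivals a i N)
    exact le_min (by linarith) (by linarith)
  calc ∑ i, I.r i * x i = (T : ℝ) / N * ((N : ℝ) / T * ∑ i, I.r i * x i) := by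
        field_simp
    _ ≤ _ := mul_le_mul_of_nonneg_left h4 (by positivity)

end Revenue

/-! ### The auxiliary run, and revenue compared with the hindsight optimum. -/

section Base

variable {n L : ℕ} (I : Problem n L) (P : OGDParams)

/-- The stopping rule protects capacities: BPC-OGD sells only while every request fits. At `H =
segLen T` this makes the counts `auxAccepted` feasible. -/
theorem bpcOGD_cap (H : ℕ) (a : ℕ → Arrival n) (c : Coins n) (j : Fin L) (t : ℕ) :
    (bpcState I P H a t).cap j =
      I.ρ j * H - ∑ i, I.A i j * numAccepted a (bpcOGD I P H a c) i t ∧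
    0 ≤ (bpcState I P H a t).cap j := by
  induction t with
  | zero =>
    have := I.ρ_pos j
    constructor
    · simp [bpcState, numAccepted]
    · simp only [bpcState]
      positivity
  | succ t ih =>
    obtain ⟨h1, h2⟩ := ih
    simp only [numAccepted_succ, mul_add, Finset.sum_add_distrib, bpcState, bpcStep]
    by_cases hr : bpcRunning I (bpcState I P H a t) = true
    · rw [if_pos hr]
      simp only [h1, ← sub_sub]
      have hA : ∀ i, I.A i j ≤ (bpcState I P H a t).cap j := fun i => by
        simp only [bpcRunning, decide_eq_true_eq] at hr
        exact hr i j
      rw [h1] at hA h2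
      cases h : a t with
      | none => simpa [bpcUse] using h2
      | some k =>
        have hs : ∑ i, I.A i j * (if some k = some i ∧ bpcOGD I P H a c t = true then (1 : ℝ)
            else 0) = bpcUse I (bpcState I P H a t) (some k) j := by
          rw [Finset.sum_eq_single k]
          · simp [bpcOGD, hr, h, bpcUse]
          · intro i _ hi
            simp [hi.symm]
          · simp
        rw [hs]
        refine ⟨rfl, ?_⟩
        rw [bpcUse]
        split_ifs
        · linarith [hA k]
        · simpa using h2
    · rw [if_neg hr]
      have : bpcOGD I P H a c t = false := by
        simp only [bpcOGD, Bool.and_eq_false_iff]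
        exact Or.inl (by simpa using hr)
      simp only [this]
      simpa using ⟨h1, h2⟩

theorem numAccepted_bpcOGD (T : ℕ) (a : ℕ → Arrival n) (c : Coins n) (i : Fin n) :
    numAccepted a (bpcOGD I P (segLen T) a c) i (segLen T) = auxAccepted I P T a i := by
  simp only [numAccepted, auxAccepted, bpcOGD, Finset.card_filter]
  push_cast
  rfl

theorem sum_auxAccepted_le (T : ℕ) (a : ℕ → Arrival n) (j : Fin L) :
    ∑ i, I.A i j * auxAccepted I P T a i ≤ I.ρ j * segLen T := by
  obtain ⟨h1, h2⟩ := bpcOGD_cap I P (segLen T) a (fun _ => 0) j (segLen T)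
  simp only [numAccepted_bpcOGD] at h1
  linarith

theorem auxAccepted_le_numArrivals (T : ℕ) (a : ℕ → Arrival n) (i : Fin n) :
    auxAccepted I P T a i ≤ numArrivals a i (segLen T) := by
  rw [auxAccepted, numArrivals, Nat.count_eq_card_filter_range]
  exact Finset.card_le_card fun t => by
    simp only [Finset.mem_filter]
    exact fun h => ⟨h.1, h.2.1⟩

theorem regret_bpcOGD (T : ℕ) : regret I (bpcOGD I P (segLen T)) (segLen T) =
    (∫ a, hindsight I a (segLen T) ∂I.arrivalLaw) -
      ∫ a, ∑ i, I.r i * (auxAccepted I P T a i : ℝ) ∂I.arrivalLaw := by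
  simp only [regret, revenue_eq_sum, numAccepted_bpcOGD]
  congr 1
  have := integral_fun_fst (μ := I.arrivalLaw) (ν := coinLaw n)
    (fun a => ∑ i, I.r i * (auxAccepted I P T a i : ℝ))
  simpa using this

variable (α δ : ℝ) (T : ℕ) (a : ℕ → Arrival n)

theorem numAccepted_gpEnhancedBPCOGD (hT : segLen T ≤ T) (c : Coins n) (i : Fin n) :
    numAccepted a (gpEnhancedBPCOGD I P α δ T a c) i T =
      occ T (acceptEvent I P α δ T a i) c T := by
  rw [numAccepted, occ, Finset.range_eq_Ico, ← Finset.sum_Ico_consecutive _ (Nat.zero_le _) hT,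
    Finset.sum_eq_zero, zero_add]
  · refine Finset.sum_congr rfl fun t ht => ?_
    have h : gpEnhancedBPCOGD I P α δ T a c t =
      (decide (segLen T ≤ t) && decision I P α δ T a c t) := rfl
    simp only [h, (Finset.mem_Ico.1 ht).1, decide_true, Bool.true_and]
    by_cases h1 : a t = some i ∧ decision I P α δ T a c t = true
    · rw [if_pos h1, Set.indicator_of_mem (show c ∈ acceptEvent I P α δ T a i t from h1)]
      rfl
    · rw [if_neg h1, Set.indicator_of_notMem (show c ∉ acceptEvent I P α δ T a i t from h1)]
  · intro t ht
    refine if_neg ?_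
    rintro ⟨-, h⟩
    have := (Finset.mem_Ico.1 ht).2
    simp only [gpEnhancedBPCOGD, Bool.and_eq_true, decide_eq_true_eq] at h
    omega

theorem revenue_gpEnhancedBPCOGD (hT : segLen T ≤ T) (c : Coins n) :
    revenue I a (gpEnhancedBPCOGD I P α δ T a c) T =
      ∑ i, I.r i * occ T (acceptEvent I P α δ T a i) c T := by
  simp only [revenue_eq_sum, numAccepted_gpEnhancedBPCOGD I P α δ T a hT]

theorem revenue_gp_le_hindsight (hT : segLen T ≤ T) (c : Coins n) :
    revenue I a (gpEnhancedBPCOGD I P α δ T a c) T ≤ hindsight I a T := by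
  rw [revenue_eq_sum]
  refine le_hindsight I (fun i => ⟨numAccepted_nonneg _ _ _ _, numAccepted_le _ _ _ _⟩) fun j => ?_
  have h1 := cap_nonneg I P α δ T a c hT j
  rw [cap_eq I P α δ T a c hT] at h1
  simp only [numAccepted_gpEnhancedBPCOGD I P α δ T a hT]
  linarith

theorem revenue_gp_nonneg (hT : segLen T ≤ T) (c : Coins n) :
    0 ≤ revenue I a (gpEnhancedBPCOGD I P α δ T a c) T := by
  rw [revenue_gpEnhancedBPCOGD I P α δ T a hT]
  exact Finset.sum_nonneg fun i _ => mul_nonneg (I.r_nonneg i) (occ_nonneg _ _ _ _)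

theorem measurable_occ {E : ℕ → Set (Coins n)} (hE : ∀ t, MeasurableSet (E t)) (t : ℕ) :
    Measurable fun c => occ T E c t :=
  Finset.measurable_sum _ fun s _ => measurable_one.indicator (hE s)

theorem measurableSet_acceptEvent (i : Fin n) (t : ℕ) :
    MeasurableSet (acceptEvent I P α δ T a i t) :=
  measurableSet_of_coinPast (t := t + 1) <|
    measurableSet_decision I P α δ T a t.lt_succ_self fun _ b => a t = some i ∧ b = true

theorem measurable_revenue_gp (hT : segLen T ≤ T) :
    Measurable fun q : (ℕ → Arrival n) × Coins n =>
      revenue I q.1 (gpEnhancedBPCOGD I P α δ T q.1 q.2) T := by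
  refine measurable_prod_of_prefix T (fun a a' c h => revenue_congr I h fun t ht =>
    gpEnhancedBPCOGD_congr I P α δ h hT c ht) fun a => ?_
  simp only [revenue_gpEnhancedBPCOGD I P α δ T a hT]
  exact Finset.measurable_sum _ fun i _ => measurable_const.mul
    (measurable_occ T (measurableSet_acceptEvent I P α δ T a i) T)

theorem integrable_hindsight (T : ℕ) : Integrable (fun a => hindsight I a T) I.arrivalLaw := by
  refine Integrable.of_bound (measurable_of_prefix T fun a a' h =>
    hindsight_congr I h).aestronglyMeasurable ((∑ i, I.r i) * T) (ae_of_all _ fun a => ?_)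
  rw [Real.norm_eq_abs, abs_of_nonneg (hindsight_nonneg I a T)]
  exact hindsight_le_mul I a T

theorem integrable_revenue_gp (hT : segLen T ≤ T) :
    Integrable (fun q : (ℕ → Arrival n) × Coins n =>
      revenue I q.1 (gpEnhancedBPCOGD I P α δ T q.1 q.2) T) (I.arrivalLaw.prod (coinLaw n)) := by
  refine Integrable.of_bound (measurable_revenue_gp I P α δ T hT).aestronglyMeasurable
    ((∑ i, I.r i) * T) (ae_of_all _ fun q => ?_)
  rw [Real.norm_eq_abs, abs_of_nonneg (revenue_gp_nonneg I P α δ T q.1 hT q.2)]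
  exact (revenue_gp_le_hindsight I P α δ T q.1 hT q.2).trans (hindsight_le_mul I q.1 T)

/-- The accepted counts are feasible for the linear program. Nonnegativity turns the upper bound on
the regret into a bound on its absolute value. -/
theorem regret_gp_nonneg (hT : segLen T ≤ T) :
    0 ≤ regret I (gpEnhancedBPCOGD I P α δ T) T := by
  rw [regret, sub_nonneg]
  have h := integral_fun_fst (μ := I.arrivalLaw) (ν := coinLaw n) (fun a => hindsight I a T)
  simp only [probReal_univ, one_smul] at h
  rw [← h]
  exact integral_mono (integrable_revenue_gp I P α δ T hT)
    ((integrable_hindsight I T).comp_fst _) fun q => revenue_gp_le_hindsight I P α δ T q.1 hT q.2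

end Base

/-! ### Mean absolute deviations of samples and arrivals. -/

section Deviation

open ProbabilityTheory

theorem integral_abs_le_sqrt {Ω : Type*} [MeasurableSpace Ω] {μ : Measure Ω}
    [IsProbabilityMeasure μ] {X : Ω → ℝ} (hX : MemLp X 2 μ) :
    ∫ ω, |X ω| ∂μ ≤ √(∫ ω, X ω ^ 2 ∂μ) := by
  refine Real.le_sqrt_of_sq_le ?_
  have h1 := variance_eq_sub hX.abs
  have h2 := variance_nonneg (fun ω => |X ω|) μ
  have h3 : ∫ ω, |X ω| ^ 2 ∂μ = ∫ ω, X ω ^ 2 ∂μ := by simp only [sq_abs]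
  change Var[fun ω => |X ω|; μ] = ∫ ω, |X ω| ^ 2 ∂μ - (∫ ω, |X ω| ∂μ) ^ 2 at h1
  linarith

/-- The mean absolute deviation of a sum of independent `[0, 1]`-valued random variables. -/
theorem integral_abs_sum_sub_le {Ω ι : Type*} [MeasurableSpace Ω] {μ : Measure Ω}
    [IsProbabilityMeasure μ] {X : ι → Ω → ℝ} (hX : ∀ i, Measurable (X i))
    (h01 : ∀ i ω, X i ω ∈ Set.Icc (0 : ℝ) 1) (hi : iIndepFun X μ) (s : Finset ι) :
    ∫ ω, |∑ i ∈ s, X i ω - ∑ i ∈ s, ∫ ω, X i ω ∂μ| ∂μ ≤ √(s.card : ℝ) := by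
  have hL : ∀ i, MemLp (X i) 2 μ := fun i =>
    MemLp.of_bound (hX i).aestronglyMeasurable 1 (ae_of_all _ fun ω => by
      rw [Real.norm_eq_abs, abs_of_nonneg (h01 i ω).1]
      exact (h01 i ω).2)
  have hint : ∀ i, Integrable (X i) μ := fun i => (hL i).integrable (by norm_num)
  have hS : MemLp (∑ i ∈ s, X i) 2 μ := memLp_finsetSum' s fun i _ => hL i
  have h1 : Var[∑ i ∈ s, X i; μ] ≤ s.card := by
    rw [IndepFun.variance_sum (fun i _ => hL i) fun i _ j _ hij => hi.indepFun hij]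
    calc _ ≤ ∑ _i ∈ s, (1 : ℝ) := Finset.sum_le_sum fun i _ => by
          refine (variance_le_sq_of_bounded (ae_of_all _ (h01 i)) (hX i).aemeasurable).trans ?_
          norm_num
      _ = s.card := by simp
  have h2 : ∫ ω, ∑ i ∈ s, X i ω ∂μ = ∑ i ∈ s, ∫ ω, X i ω ∂μ :=
    integral_finsetSum _ fun i _ => hint i
  rw [variance_eq_integral hS.aemeasurable] at h1
  simp only [Finset.sum_apply] at h1
  rw [h2] at h1
  have hL' : MemLp (fun ω => ∑ i ∈ s, X i ω - ∑ i ∈ s, ∫ ω, X i ω ∂μ) 2 μ := by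
    have := hS.sub (memLp_const (∑ i ∈ s, ∫ ω, X i ω ∂μ))
    convert! this using 1
    ext ω
    simp
  exact (integral_abs_le_sqrt hL').trans (Real.sqrt_le_sqrt h1)

variable {n L : ℕ} (I : Problem n L)

theorem integral_abs_segSample_sub_le (P : OGDParams) (T : ℕ) (a : ℕ → Arrival n) (k : ℕ)
    (i : Fin n) :
    ∫ c, |(segSample I P T a c k i : ℝ) - auxAccepted I P T a i| ∂coinLaw n ≤ √(segLen T : ℝ) := by
  set Λ := numArrivals a i (segLen T)
  set u := auxAccepted I P T a i
  set q : ℝ := (u : ℝ) / Λ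
  have hu : u ≤ Λ := auxAccepted_le_numArrivals I P T a i
  have hq0 : 0 ≤ q := by positivity
  have hq1 : q ≤ 1 := div_le_one_of_le₀ (by exact_mod_cast hu) (Nat.cast_nonneg _)
  have hm : Measurable fun x : unitInterval => if (x : ℝ) < q then (1 : ℝ) else 0 :=
    Measurable.ite (measurableSet_coin_lt q) measurable_const measurable_const
  have hind : iIndepFun (fun (l : ℕ) (c : Coins n) =>
      if (c (Sum.inr (k, i, l)) : ℝ) < q then (1 : ℝ) else 0) (coinLaw n) :=
    (iIndepFun_coins.precomp (g := fun l : ℕ => Sum.inr (k, i, l)) fun l l' h => by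
      simpa using h).comp (fun _ x => if (x : ℝ) < q then (1 : ℝ) else 0) fun _ => hm
  have h := integral_abs_sum_sub_le (μ := coinLaw n) (X := fun (l : ℕ) (c : Coins n) =>
      if (c (Sum.inr (k, i, l)) : ℝ) < q then (1 : ℝ) else 0)
    (fun l => hm.comp (measurable_pi_apply _))
    (fun l c => by split_ifs <;> simp) hind (Finset.range Λ)
  have hE : ∀ l : ℕ, ∫ c : Coins n, (if (c (Sum.inr (k, i, l)) : ℝ) < q then (1 : ℝ) else 0)
      ∂coinLaw n = q := by
    intro l
    have hs : MeasurableSet {c : Coins n | (c (Sum.inr (k, i, l)) : ℝ) < q} :=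
      measurableSet_lt (measurable_subtype_coe.comp (measurable_pi_apply _)) measurable_const
    refine Eq.trans ?_ ((integral_indicator_one hs).trans (coin_lt _ hq0 hq1))
    simp [Set.indicator]
  -- This also holds without arrivals: then `u = 0`, and the quotient `q` is zero by convention.
  have hsum : (Λ : ℝ) * q = u := by
    rcases Nat.eq_zero_or_pos Λ with h0 | h0
    · have : u = 0 := by omega
      simp [h0, this]
    · have : (0 : ℝ) < Λ := by exact_mod_cast h0
      simp only [q]
      field_simp
  simp only [hE, Finset.sum_const, Finset.card_range, nsmul_eq_mul, hsum] at h
  have hS : ∀ c : Coins n, (segSample I P T a c k i : ℝ) =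
      ∑ l ∈ Finset.range Λ, if (c (Sum.inr (k, i, l)) : ℝ) < q then (1 : ℝ) else 0 := by
    intro c
    simp only [segSample, Finset.card_filter]
    push_cast
    rfl
  simp only [hS]
  refine h.trans (Real.sqrt_le_sqrt ?_)
  exact_mod_cast Nat.count_le _

theorem integral_sampleDev_le (P : OGDParams) (T : ℕ) (a : ℕ → Arrival n) (i : Fin n) :
    Integrable (fun c => sampleDev I P T a c i) (coinLaw n) ∧
      ∫ c, sampleDev I P T a c i ∂coinLaw n ≤ (T / segLen T : ℕ) * √(segLen T : ℝ) := by
  have hint : ∀ k, Integrable (fun c => |(segSample I P T a c k i : ℝ) - auxAccepted I P T a i|)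
      (coinLaw n) := by
    intro k
    have hm : Measurable fun c => (segSample I P T a c k i : ℝ) :=
      measurable_from_top.comp ((measurable_segSample I P T a 0 k i).mono (coinPast_le 0) le_rfl)
    refine Integrable.of_bound (hm.sub_const _).abs.aestronglyMeasurable (segLen T)
      (ae_of_all _ fun c => ?_)
    rw [Real.norm_eq_abs, abs_abs, abs_le]
    have h1 : (segSample I P T a c k i : ℝ) ≤ segLen T := by
      exact_mod_cast (segSample_le I P T a c k i).trans (Nat.count_le _)
    have h2 : (auxAccepted I P T a i : ℝ) ≤ segLen T := by exact_mod_cast auxAccepted_le I P T a i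
    have h3 : (0 : ℝ) ≤ segSample I P T a c k i := Nat.cast_nonneg _
    have h4 : (0 : ℝ) ≤ auxAccepted I P T a i := Nat.cast_nonneg _
    constructor <;> linarith
  refine ⟨integrable_finsetSum _ fun k _ => hint k, ?_⟩
  unfold sampleDev
  rw [integral_finsetSum _ fun k _ => hint k]
  refine (Finset.sum_le_card_nsmul _ _ _ fun k _ =>
    integral_abs_segSample_sub_le I P T a k i).trans_eq ?_
  simp

/-- Probability of an arrival of type `i`. -/
def arrivalProb (i : Fin n) : ℝ := ∫ x, (if x = some i then (1 : ℝ) else 0) ∂I.arrivalPMF.toMeasure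

theorem measurable_arrivalsIn (i : Fin n) (s t : ℕ) :
    Measurable fun a : ℕ → Arrival n => arrivalsIn a i s t :=
  measurable_of_prefix t fun a a' h => Finset.sum_congr rfl fun u hu => by
    rw [h u (Finset.mem_Ico.1 hu).2]

theorem arrivalsIn_mem (a : ℕ → Arrival n) (i : Fin n) (s t : ℕ) :
    0 ≤ arrivalsIn a i s t ∧ arrivalsIn a i s t ≤ (t - s : ℕ) := by
  constructor
  · exact Finset.sum_nonneg fun _ _ => by split_ifs <;> norm_num
  · refine (Finset.sum_le_card_nsmul _ _ 1 fun _ _ => by split_ifs <;> norm_num).trans_eq ?_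
    simp

theorem integrable_arrivalsIn (i : Fin n) (s t : ℕ) :
    Integrable (fun a => arrivalsIn a i s t) I.arrivalLaw :=
  Integrable.of_bound (measurable_arrivalsIn i s t).aestronglyMeasurable ((t - s : ℕ) : ℝ)
    (ae_of_all _ fun a => by
      rw [Real.norm_eq_abs, abs_of_nonneg (arrivalsIn_mem a i s t).1]
      exact (arrivalsIn_mem a i s t).2)

theorem integral_abs_arrivalsIn_sub_le (i : Fin n) (s t : ℕ) :
    ∫ a, |arrivalsIn a i s t - (t - s : ℕ) * arrivalProb I i| ∂I.arrivalLaw ≤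
      √((t - s : ℕ) : ℝ) := by
  have hm : Measurable fun x : Arrival n => if x = some i then (1 : ℝ) else 0 :=
    measurable_of_countable _
  have hind : iIndepFun (fun (u : ℕ) (a : ℕ → Arrival n) => if a u = some i then (1 : ℝ) else 0)
      I.arrivalLaw :=
    iIndepFun_infinitePi (X := fun _ x => if x = some i then (1 : ℝ) else 0) fun _ => hm
  have h := integral_abs_sum_sub_le (μ := I.arrivalLaw) (X := fun (u : ℕ) (a : ℕ → Arrival n) =>
      if a u = some i then (1 : ℝ) else 0)
    (fun u => hm.comp (measurable_pi_apply _))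
    (fun u a => by split_ifs <;> simp) hind (Finset.Ico s t)
  have hE : ∀ u : ℕ, ∫ a : ℕ → Arrival n, (if a u = some i then (1 : ℝ) else 0) ∂I.arrivalLaw =
      arrivalProb I i := by
    intro u
    have hp := measurePreserving_eval_infinitePi (fun _ : ℕ => I.arrivalPMF.toMeasure) u
    rw [arrivalProb, ← hp.map_eq, integral_map hp.aemeasurable hm.aestronglyMeasurable]
    rfl
  simp only [hE, Finset.sum_const, Nat.card_Ico, nsmul_eq_mul] at h
  exact h

theorem integrable_abs_arrivalsIn_sub (i : Fin n) (s t : ℕ) (x : ℝ) :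
    Integrable (fun a => |arrivalsIn a i s t - x|) I.arrivalLaw :=
  ((integrable_arrivalsIn I i s t).sub (integrable_const x)).abs

/-- Both arrival counts are compared with their common mean `N * arrivalProb`, each at a cost of
`√N`. -/
theorem integral_arrivalDev_le (T : ℕ) (i : Fin n) :
    Integrable (fun a => arrivalDev T a i) I.arrivalLaw ∧
      ∫ a, arrivalDev T a i ∂I.arrivalLaw ≤ (T / segLen T : ℕ) * (2 * √(segLen T : ℝ)) := by
  set N := segLen T
  have hint : ∀ k, Integrable (fun a => |arrivalsIn a i (N * k) (N * (k + 1)) -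
      arrivalsIn a i 0 N|) I.arrivalLaw := fun k =>
    ((integrable_arrivalsIn I i _ _).sub (integrable_arrivalsIn I i _ _)).abs
  refine ⟨integrable_finsetSum _ fun k _ => hint k, ?_⟩
  unfold arrivalDev
  rw [integral_finsetSum _ fun k _ => hint k]
  have hk : ∀ k ∈ Finset.Ico 1 (T / N), ∫ a, |arrivalsIn a i (N * k) (N * (k + 1)) -
      arrivalsIn a i 0 N| ∂I.arrivalLaw ≤ 2 * √(N : ℝ) := by
    intro k _
    have h1 := integral_abs_arrivalsIn_sub_le I i (N * k) (N * (k + 1))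
    have h2 := integral_abs_arrivalsIn_sub_le I i 0 N
    have h3 : N * (k + 1) - N * k = N := by rw [mul_add, mul_one, Nat.add_sub_cancel_left]
    rw [h3] at h1
    rw [Nat.sub_zero] at h2
    calc _ ≤ ∫ a, (|arrivalsIn a i (N * k) (N * (k + 1)) - N * arrivalProb I i| +
          |arrivalsIn a i 0 N - N * arrivalProb I i|) ∂I.arrivalLaw := by
          refine integral_mono (hint k) ((integrable_abs_arrivalsIn_sub I i _ _ _).add
            (integrable_abs_arrivalsIn_sub I i _ _ _)) fun a => ?_
          dsimp only
          rw [abs_sub_comm (arrivalsIn a i 0 N)]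
          exact abs_sub_le _ _ _
      _ ≤ _ := by
        rw [integral_add (integrable_abs_arrivalsIn_sub I i _ _ _)
          (integrable_abs_arrivalsIn_sub I i _ _ _)]
        linarith
  refine (Finset.sum_le_card_nsmul _ _ _ hk).trans ?_
  rw [Nat.card_Ico, nsmul_eq_mul]
  gcongr
  exact Nat.sub_le _ _

/-- Scaling by `N / T` turns the fluctuation `√T` of the whole horizon into at most `√N`, since `N ≤
T`. -/
theorem integral_abs_scaled_arrivals_le (i : Fin n) {N T : ℕ} (hN : 0 < N) (hNT : N ≤ T) :
    Integrable (fun a => |(N : ℝ) / T * numArrivals a i T - numArrivals a i N|) I.arrivalLaw ∧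
      ∫ a, |(N : ℝ) / T * numArrivals a i T - numArrivals a i N| ∂I.arrivalLaw ≤
        2 * √(N : ℝ) := by
  have hN' : (0 : ℝ) < N := by exact_mod_cast hN
  have hNT' : (N : ℝ) ≤ T := by exact_mod_cast hNT
  have hT' : (0 : ℝ) < T := hN'.trans_le hNT'
  simp only [numArrivals_eq]
  have hint : Integrable (fun a => |(N : ℝ) / T * arrivalsIn a i 0 T - arrivalsIn a i 0 N|)
      I.arrivalLaw :=
    (((integrable_arrivalsIn I i 0 T).const_mul _).sub (integrable_arrivalsIn I i 0 N)).abs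
  refine ⟨hint, ?_⟩
  have h1 := integral_abs_arrivalsIn_sub_le I i 0 T
  have h2 := integral_abs_arrivalsIn_sub_le I i 0 N
  rw [Nat.sub_zero] at h1 h2
  calc _ ≤ ∫ a, ((N : ℝ) / T * |arrivalsIn a i 0 T - T * arrivalProb I i| +
        |arrivalsIn a i 0 N - N * arrivalProb I i|) ∂I.arrivalLaw := by
        refine integral_mono hint (((integrable_abs_arrivalsIn_sub I i _ _ _).const_mul _).add
          (integrable_abs_arrivalsIn_sub I i _ _ _)) fun a => ?_
        dsimp only
        rw [abs_sub_comm (arrivalsIn a i 0 N)]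
        have h3 : (N : ℝ) / T * |arrivalsIn a i 0 T - T * arrivalProb I i| =
            |(N : ℝ) / T * arrivalsIn a i 0 T - N * arrivalProb I i| := by
          rw [← abs_of_nonneg (div_nonneg hN'.le hT'.le), ← abs_mul,
            abs_of_nonneg (div_nonneg hN'.le hT'.le), mul_sub]
          congr 2
          field_simp
        rw [h3]
        exact abs_sub_le _ _ _
    _ ≤ (N : ℝ) / T * √(T : ℝ) + √(N : ℝ) := by
      rw [integral_add ((integrable_abs_arrivalsIn_sub I i _ _ _).const_mul _)
        (integrable_abs_arrivalsIn_sub I i _ _ _), integral_const_mul]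
      gcongr
    _ ≤ 2 * √(N : ℝ) := by
      have h3 : (N : ℝ) / T * √(T : ℝ) ≤ √(N : ℝ) := by
        rw [div_mul_eq_mul_div, div_le_iff₀ hT']
        have h4 := Real.sqrt_le_sqrt hNT'
        have h5 := Real.mul_self_sqrt hN'.le
        have h6 := Real.mul_self_sqrt hT'.le
        calc (N : ℝ) * √(T : ℝ) = √(N : ℝ) * (√(N : ℝ) * √(T : ℝ)) := by
              rw [← mul_assoc, h5]
          _ ≤ √(N : ℝ) * (√(T : ℝ) * √(T : ℝ)) := by gcongr
          _ = √(N : ℝ) * T := by rw [h6]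
      linarith

end Deviation

/-! ### Expected losses and the order of the regret. -/

section Regret

variable {n L : ℕ} (I : Problem n L) (P : OGDParams) (α δ : ℝ) (T : ℕ)

/-- Bound for the expectation of `lostPeriods`. -/
def lostPeriodsBound : ℝ :=
  (∑ j, (I.ρ j)⁻¹) * (graceWidth I α δ + I.abar * (n * ((T / segLen T : ℕ) * √(segLen T : ℝ) +
    (T / segLen T : ℕ) / α)))

theorem integral_lostPeriods_le (hα : α ∈ Set.Ioo (0 : ℝ) 1) (hN : 0 < segLen T)
    (hT : segLen T ≤ T) (hG : 0 ≤ graceWidth I α δ) (a : ℕ → Arrival n) :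
    Integrable (fun c => lostPeriods I P α δ T a c) (coinLaw n) ∧
      ∫ c, lostPeriods I P α δ T a c ∂coinLaw n ≤ lostPeriodsBound I α δ T := by
  have hS := integral_sampleDev_le I P T a
  have hXi : ∀ i, Integrable (fun c => occ T (tailEvent I P α δ T a i) c T) (coinLaw n) :=
    fun i => integrable_occ T
      (fun s => measurableSet_of_coinPast (measurableSet_tailEvent I P α δ T a i s)) T
  have hX := fun i => integral_occ_tail_le I P α δ T a hα hN hG i hT
  have h0 : ∀ i, Integrable (fun c => sampleDev I P T a c i +
      occ T (tailEvent I P α δ T a i) c T) (coinLaw n) := fun i => (hS i).1.add (hXi i)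
  have h1 : Integrable (fun c => ∑ i, (sampleDev I P T a c i +
      occ T (tailEvent I P α δ T a i) c T)) (coinLaw n) :=
    integrable_finsetSum _ fun i _ => h0 i
  have h2 : Integrable (fun c => graceWidth I α δ + I.abar * ∑ i, (sampleDev I P T a c i +
      occ T (tailEvent I P α δ T a i) c T)) (coinLaw n) :=
    (integrable_const _).add (h1.const_mul _)
  refine ⟨h2.const_mul _, ?_⟩
  unfold lostPeriods lostPeriodsBound
  rw [integral_const_mul, integral_add (integrable_const _) (h1.const_mul _), integral_const_mul,
    integral_finsetSum _ fun i _ => h0 i]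
  simp only [integral_const, probReal_univ, one_smul]
  refine mul_le_mul_of_nonneg_left (add_le_add_right (mul_le_mul_of_nonneg_left ?_ I.abar_pos.le) _)
    (Finset.sum_nonneg fun j _ => (inv_pos.2 (I.ρ_pos j)).le)
  refine (Finset.sum_le_card_nsmul _ _ ((T / segLen T : ℕ) * √(segLen T : ℝ) +
    (T / segLen T : ℕ) / α) fun i _ => ?_).trans_eq
    (by rw [nsmul_eq_mul, Finset.card_univ, Fintype.card_fin])
  rw [integral_add (hS i).1 (hXi i)]
  exact add_le_add (hS i).2 (hX i)

theorem integral_lostRevenue_le (hα : α ∈ Set.Ioo (0 : ℝ) 1) (hN : 0 < segLen T)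
    (hT : segLen T ≤ T) (hG : I.abar ≤ graceWidth I α δ) (a : ℕ → Arrival n) :
    Integrable (fun c => lostRevenue I P α δ T a c) (coinLaw n) ∧
      ∫ c, lostRevenue I P α δ T a c ∂coinLaw n ≤
        (∑ i, I.r i) * (segLen T + lostPeriodsBound I α δ T) +
        ∑ i, I.r i * (segLen T + ((T / segLen T : ℕ) + 1) * (graceWidth I α δ + 1) +
          arrivalDev T a i + (T / segLen T : ℕ) / α +
          (T / segLen T : ℕ) * √(segLen T : ℝ)) := by
  have hP := integral_lostPeriods_le I P α δ T hα hN hT (I.abar_pos.le.trans hG) a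
  have hS := integral_sampleDev_le I P T a
  have hXi : ∀ i, Integrable (fun c => occ T (waitEvent I P α δ T a i) c T) (coinLaw n) :=
    fun i => integrable_occ T
      (fun s => measurableSet_of_coinPast (measurableSet_waitEvent I P α δ T a i s)) T
  have hX := fun i => integral_occ_wait_le I P α δ T a hα hN hG i hT
  have h1 : Integrable (fun c => (∑ i, I.r i) * (segLen T + lostPeriods I P α δ T a c))
      (coinLaw n) := ((integrable_const _).add hP.1).const_mul _
  have h2 : ∀ i, Integrable (fun c => segLen T +
      ((T / segLen T : ℕ) + 1) * (graceWidth I α δ + 1) + arrivalDev T a i +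
      occ T (waitEvent I P α δ T a i) c T) (coinLaw n) :=
    fun i => (integrable_const _).add (hXi i)
  have h3 : ∀ i, Integrable (fun c => I.r i * (segLen T +
      ((T / segLen T : ℕ) + 1) * (graceWidth I α δ + 1) + arrivalDev T a i +
      occ T (waitEvent I P α δ T a i) c T + sampleDev I P T a c i)) (coinLaw n) :=
    fun i => ((h2 i).add (hS i).1).const_mul _
  refine ⟨h1.add (integrable_finsetSum _ fun i _ => h3 i), ?_⟩
  unfold lostRevenue
  rw [integral_add h1 (integrable_finsetSum _ fun i _ => h3 i), integral_const_mul,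
    integral_add (integrable_const _) hP.1, integral_finsetSum _ fun i _ => h3 i]
  simp only [integral_const, probReal_univ, one_smul]
  refine add_le_add (mul_le_mul_of_nonneg_left (add_le_add_right hP.2 _)
    (Finset.sum_nonneg fun i _ => I.r_nonneg i)) (Finset.sum_le_sum fun i _ => ?_)
  rw [integral_const_mul, integral_add (h2 i) (hS i).1, integral_add (integrable_const _) (hXi i)]
  simp only [integral_const, probReal_univ, one_smul]
  exact mul_le_mul_of_nonneg_left (add_le_add (add_le_add_right (hX i) _) (hS i).2) (I.r_nonneg i)

theorem integrable_auxRevenue : Integrable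
    (fun a => ∑ i, I.r i * (auxAccepted I P T a i : ℝ)) I.arrivalLaw := by
  refine integrable_finsetSum _ fun i _ => Integrable.const_mul ?_ _
  refine Integrable.of_bound (measurable_of_prefix (segLen T) fun a a' h => by
    rw [auxAccepted_congr I P h le_rfl]).aestronglyMeasurable (segLen T : ℝ)
    (ae_of_all _ fun a => ?_)
  rw [Real.norm_eq_abs, abs_of_nonneg (Nat.cast_nonneg _)]
  exact_mod_cast auxAccepted_le I P T a i

/-- The pathwise comparison is integrated over the coins for fixed arrivals, where `arrivalDev` and
`auxAccepted` are constants, and then over the arrivals. -/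
theorem auxRevenue_le (hα : α ∈ Set.Ioo (0 : ℝ) 1) (hN : 0 < segLen T)
    (hT : segLen T < T) (hG : I.abar ≤ graceWidth I α δ) :
    (T : ℝ) / segLen T * ∫ a, ∑ i, I.r i * (auxAccepted I P T a i : ℝ) ∂I.arrivalLaw ≤
      (∫ q : (ℕ → Arrival n) × Coins n, revenue I q.1 (gpEnhancedBPCOGD I P α δ T q.1 q.2) T
        ∂(I.arrivalLaw.prod (coinLaw n))) +
      ((∑ i, I.r i) * (segLen T + lostPeriodsBound I α δ T) +
        (∑ i, I.r i) * (segLen T + ((T / segLen T : ℕ) + 1) * (graceWidth I α δ + 1) +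
          (T / segLen T : ℕ) * (2 * √(segLen T : ℝ)) + (T / segLen T : ℕ) / α +
          (T / segLen T : ℕ) * √(segLen T : ℝ))) := by
  have hrev := integrable_revenue_gp I P α δ T hT.le
  rw [integral_prod _ hrev, ← integral_const_mul]
  have hA := integral_arrivalDev_le I T
  have h1 : ∀ i, Integrable (fun a => (segLen T : ℝ) +
      ((T / segLen T : ℕ) + 1) * (graceWidth I α δ + 1) + arrivalDev T a i) I.arrivalLaw :=
    fun i => (integrable_const _).add (hA i).1
  have h1' : ∀ i, Integrable (fun a => (segLen T : ℝ) +
      ((T / segLen T : ℕ) + 1) * (graceWidth I α δ + 1) + arrivalDev T a i +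
      (T / segLen T : ℕ) / α) I.arrivalLaw :=
    fun i => (h1 i).add (integrable_const _)
  have h2 : ∀ i, Integrable (fun a => I.r i * (segLen T +
      ((T / segLen T : ℕ) + 1) * (graceWidth I α δ + 1) + arrivalDev T a i +
      (T / segLen T : ℕ) / α + (T / segLen T : ℕ) * √(segLen T : ℝ))) I.arrivalLaw :=
    fun i => ((h1' i).add (integrable_const _)).const_mul _
  have h3 := hrev.integral_prod_left
  have h4 : Integrable (fun a => (∑ i, I.r i) * (segLen T + lostPeriodsBound I α δ T) +
      ∑ i, I.r i * (segLen T + ((T / segLen T : ℕ) + 1) * (graceWidth I α δ + 1) +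
        arrivalDev T a i + (T / segLen T : ℕ) / α +
        (T / segLen T : ℕ) * √(segLen T : ℝ))) I.arrivalLaw :=
    (integrable_const _).add (integrable_finsetSum _ fun i _ => h2 i)
  calc _ ≤ ∫ a, ((∫ c, revenue I a (gpEnhancedBPCOGD I P α δ T a c) T ∂coinLaw n) +
        ((∑ i, I.r i) * (segLen T + lostPeriodsBound I α δ T) +
        ∑ i, I.r i * (segLen T + ((T / segLen T : ℕ) + 1) * (graceWidth I α δ + 1) +
          arrivalDev T a i + (T / segLen T : ℕ) / α +
          (T / segLen T : ℕ) * √(segLen T : ℝ)))) ∂I.arrivalLaw := by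
        refine integral_mono ((integrable_auxRevenue I P T).const_mul _) (h3.add h4) fun a => ?_
        have h5 := integral_lostRevenue_le I P α δ T hα hN hT.le hG a
        refine le_trans ?_ (add_le_add_right h5.2 _)
        have h6 : Integrable (fun c => revenue I a (gpEnhancedBPCOGD I P α δ T a c) T)
            (coinLaw n) := by
          simp only [revenue_gpEnhancedBPCOGD I P α δ T a hT.le]
          exact integrable_finsetSum _ fun i _ => (integrable_occ T
            (fun t => measurableSet_acceptEvent I P α δ T a i t) T).const_mul _
        rw [← integral_add h6 h5.1]
        calc _ = ∫ _, (T : ℝ) / segLen T * ∑ i, I.r i * (auxAccepted I P T a i : ℝ)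
              ∂coinLaw n := by simp
          _ ≤ _ := by
            refine integral_mono (integrable_const _) (h6.add h5.1) fun c => ?_
            simp only [revenue_gpEnhancedBPCOGD I P α δ T a hT.le]
            exact le_accepted_add_lostRevenue I P α δ T a hN hT hG (sum_auxAccepted_le I P T a) c
    _ ≤ _ := by
      rw [integral_add h3 h4, integral_add (integrable_const _)
        (integrable_finsetSum _ fun i _ => h2 i), integral_finsetSum _ fun i _ => h2 i]
      simp only [integral_const, probReal_univ, one_smul]
      refine add_le_add_right (add_le_add_right ?_ _) _
      rw [Finset.sum_mul]
      refine Finset.sum_le_sum fun i _ => ?_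
      rw [integral_const_mul, integral_add (h1' i) (integrable_const _),
        integral_add (h1 i) (integrable_const _), integral_add (integrable_const _) (hA i).1]
      simp only [integral_const, probReal_univ, one_smul]
      refine mul_le_mul_of_nonneg_left ?_ (I.r_nonneg i)
      linarith [(hA i).2]

theorem integral_hindsight_le (hN : 0 < segLen T) (hT : segLen T ≤ T) :
    ∫ a, hindsight I a T ∂I.arrivalLaw ≤ (T : ℝ) / segLen T *
      ((∫ a, hindsight I a (segLen T) ∂I.arrivalLaw) +
        (∑ i, I.r i) * (2 * √(segLen T : ℝ))) := by
  have hS := fun i => integral_abs_scaled_arrivals_le I i hN hT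
  have h1 : Integrable (fun a => ∑ i, I.r i *
      |(segLen T : ℝ) / T * numArrivals a i T - numArrivals a i (segLen T)|) I.arrivalLaw :=
    integrable_finsetSum _ fun i _ => (hS i).1.const_mul _
  refine (integral_mono (integrable_hindsight I T)
    (((integrable_hindsight I (segLen T)).add h1).const_mul _)
    fun a => hindsight_le_scaled I a hN (hN.trans_le hT)).trans ?_
  rw [integral_const_mul]
  refine mul_le_mul_of_nonneg_left ?_ (by positivity)
  refine (integral_add (integrable_hindsight I (segLen T)) h1).trans_le ?_
  rw [integral_finsetSum _ fun i _ => (hS i).1.const_mul _]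
  refine add_le_add_right ?_ _
  rw [Finset.sum_mul]
  refine Finset.sum_le_sum fun i _ => ?_
  rw [integral_const_mul]
  exact mul_le_mul_of_nonneg_left (hS i).2 (I.r_nonneg i)

/-- The expected auxiliary revenue is eliminated between `auxRevenue_le` and
`integral_hindsight_le`; the difference that remains is the regret of BPC-OGD at horizon `N`, scaled
by `T / N`. -/
theorem regret_gp_le (hα : α ∈ Set.Ioo (0 : ℝ) 1) (hN : 0 < segLen T)
    (hT : segLen T < T) (hG : I.abar ≤ graceWidth I α δ) :
    regret I (gpEnhancedBPCOGD I P α δ T) T ≤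
      (T : ℝ) / segLen T * (regret I (bpcOGD I P (segLen T)) (segLen T) +
        (∑ i, I.r i) * (2 * √(segLen T : ℝ))) +
      ((∑ i, I.r i) * (segLen T + lostPeriodsBound I α δ T) +
        (∑ i, I.r i) * (segLen T + ((T / segLen T : ℕ) + 1) * (graceWidth I α δ + 1) +
          (T / segLen T : ℕ) * (2 * √(segLen T : ℝ)) + (T / segLen T : ℕ) / α +
          (T / segLen T : ℕ) * √(segLen T : ℝ))) := by
  have h1 := auxRevenue_le I P α δ T hα hN hT hG
  have h2 := integral_hindsight_le I T hN hT.le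
  rw [regret, regret_bpcOGD]
  rw [mul_add] at h2 ⊢
  rw [mul_sub]
  linarith

theorem tendsto_rpow_two_thirds :
    Tendsto (fun T : ℕ => (T : ℝ) ^ (2 / 3 : ℝ)) atTop atTop :=
  (tendsto_rpow_atTop (by norm_num)).comp tendsto_natCast_atTop_atTop

theorem tendsto_segLen : Tendsto segLen atTop atTop :=
  tendsto_nat_floor_atTop.comp tendsto_rpow_two_thirds

theorem segLen_le (T : ℕ) : (segLen T : ℝ) ≤ (T : ℝ) ^ (2 / 3 : ℝ) :=
  Nat.floor_le (by positivity)

theorem segLen_lt {T : ℕ} (hT : 1 < T) : segLen T < T := by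
  have hT' : (1 : ℝ) < T := by exact_mod_cast hT
  have h := Real.rpow_lt_rpow_of_exponent_lt hT' (by norm_num : (2 / 3 : ℝ) < 1)
  rw [Real.rpow_one] at h
  exact_mod_cast (segLen_le T).trans_lt h

/-- The choice of the exponent: `T / √N` has the order of `N` when `N` is about `T ^ (2/3)`. The
factor `2` absorbs the rounding of `N`. -/
theorem div_segLen_mul_sqrt_le {T : ℕ} (hX : 2 ≤ (T : ℝ) ^ (2 / 3 : ℝ)) :
    (T : ℝ) / segLen T * √(segLen T : ℝ) ≤ 2 * (T : ℝ) ^ (2 / 3 : ℝ) := by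
  set X := (T : ℝ) ^ (2 / 3 : ℝ)
  have hfl : X - 1 < segLen T := Nat.sub_one_lt_floor X
  have hN : X / 4 ≤ segLen T := by linarith
  have hN0 : (0 : ℝ) < segLen T := by linarith
  have hs0 : 0 < √(segLen T : ℝ) := Real.sqrt_pos.2 hN0
  have hT0 : (0 : ℝ) ≤ T := Nat.cast_nonneg T
  have hsX : √X = (T : ℝ) ^ (1 / 3 : ℝ) := by
    rw [Real.sqrt_eq_rpow, ← Real.rpow_mul hT0]
    norm_num
  have h1 : (T : ℝ) ^ (1 / 3 : ℝ) ≤ 2 * √(segLen T : ℝ) := by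
    rw [← hsX]
    refine Real.sqrt_le_iff.2 ⟨by positivity, ?_⟩
    rw [mul_pow, Real.sq_sqrt hN0.le]
    linarith
  have h2 : (T : ℝ) = X * (T : ℝ) ^ (1 / 3 : ℝ) := by
    rw [← Real.rpow_add_of_nonneg hT0 (by norm_num) (by norm_num)]
    norm_num
  have h3 : (T : ℝ) / segLen T * √(segLen T : ℝ) = T / √(segLen T : ℝ) := by
    rw [div_mul_eq_mul_div, div_eq_div_iff hN0.ne' hs0.ne', mul_assoc,
      Real.mul_self_sqrt hN0.le]
  rw [h3, div_le_iff₀ hs0]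
  calc (T : ℝ) = X * (T : ℝ) ^ (1 / 3 : ℝ) := h2
    _ ≤ X * (2 * √(segLen T : ℝ)) := by gcongr
    _ = 2 * X * √(segLen T : ℝ) := by ring

theorem regret_isBigO (hα : α ∈ Set.Ioo (0 : ℝ) 1)
    (hP : (fun T : ℕ => regret I (bpcOGD I P T) T) =O[atTop] fun T : ℕ => √(T : ℝ)) :
    (fun T : ℕ => regret I (gpEnhancedBPCOGD I P α (1 / (T : ℝ)) T) T) =O[atTop]
      fun T : ℕ => (T : ℝ) ^ (2 / 3 : ℝ) * Real.log T := by
  -- Without customer types the grace width is zero and not at least `abar`, but then the regret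
  -- vanishes.
  rcases n.eq_zero_or_pos with rfl | hn
  · refine IsBigO.of_bound 0 ?_
    filter_upwards [eventually_gt_atTop 1] with T hT
    have h1 := regret_gp_nonneg I P α (1 / (T : ℝ)) T (segLen_lt hT).le
    have h2 : regret I (gpEnhancedBPCOGD I P α (1 / (T : ℝ)) T) T ≤ 0 := by
      rw [regret]
      have h3 : ∀ a, hindsight I a T = 0 := fun a =>
        le_antisymm (by simpa using hindsight_le_mul I a T) (hindsight_nonneg I a T)
      have h4 : 0 ≤ ∫ q : (ℕ → Arrival 0) × Coins 0,
          revenue I q.1 (gpEnhancedBPCOGD I P α (1 / (T : ℝ)) T q.1 q.2) T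
          ∂(I.arrivalLaw.prod (coinLaw 0)) := integral_nonneg
        (fun q => revenue_gp_nonneg I P α (1 / (T : ℝ)) T q.1 (segLen_lt hT).le q.2)
      simp only [h3, integral_zero]
      linarith
    rw [le_antisymm h2 h1]
    simp
  obtain ⟨b, hb0, hb⟩ := hP.exists_nonneg
  set R := ∑ i, I.r i
  have hR : 0 ≤ R := Finset.sum_nonneg fun i _ => I.r_nonneg i
  set S := ∑ j, (I.ρ j)⁻¹
  have hS : 0 ≤ S := Finset.sum_nonneg fun j _ => (inv_pos.2 (I.ρ_pos j)).le
  set g := I.abar * n * (-Real.log (1 - α))⁻¹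
  have hg : 0 ≤ g := mul_nonneg (mul_nonneg I.abar_pos.le (Nat.cast_nonneg n)) (neg_log_pos hα).le
  have habar := I.abar_pos
  have hα0 := hα.1
  -- The three summands bound the scaled regret and fluctuation of the auxiliary run, the loss from
  -- estimation and early closing, and the losses within segments, each divided by `X * ℓ`.
  refine IsBigO.of_bound (2 * (b + 2 * R) + (R * (1 + S * (g + I.abar * (n * (2 + 2 / α)))) +
    R * (1 + 3 * (g + 1) + 4 + 2 / α + 2))) ?_
  filter_upwards [tendsto_segLen.eventually hb.bound, eventually_abar_le_graceWidth I hα hn,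
    eventually_gt_atTop 1, tendsto_rpow_two_thirds.eventually_ge_atTop 2,
    (Real.tendsto_log_atTop.comp tendsto_natCast_atTop_atTop).eventually_ge_atTop 1,
    tendsto_segLen.eventually_ge_atTop 1] with T h1 hG hT hX hlog hN
  have hreg := regret_gp_le I P α (1 / (T : ℝ)) T hα hN (segLen_lt hT) hG
  have h0 := regret_gp_nonneg I P α (1 / (T : ℝ)) T (segLen_lt hT).le
  have hGeq : graceWidth I α (1 / (T : ℝ)) = g * Real.log T := by
    rw [graceWidth, graceLen_eq, ← mul_assoc]
  simp only [Function.comp_apply] at hlog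
  set X := (T : ℝ) ^ (2 / 3 : ℝ)
  set ℓ := Real.log T
  set N := segLen T
  set K := T / N
  have hX0 : 0 ≤ X := by linarith
  have hXl : X ≤ X * ℓ := le_mul_of_one_le_right hX0 hlog
  have hlX : ℓ ≤ X * ℓ := le_mul_of_one_le_left (by linarith) (by linarith)
  have hNX : (N : ℝ) ≤ X := segLen_le T
  have hN1 : (1 : ℝ) ≤ N := by exact_mod_cast hN
  have hs1 : 1 ≤ √(N : ℝ) := Real.one_le_sqrt.2 hN1
  have hTN : (T : ℝ) / N * √(N : ℝ) ≤ 2 * X := div_segLen_mul_sqrt_le hX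
  have hKT : (K : ℝ) ≤ (T : ℝ) / N := Nat.cast_div_le
  have hKs : (K : ℝ) * √(N : ℝ) ≤ 2 * X :=
    (mul_le_mul_of_nonneg_right hKT (by positivity)).trans hTN
  have hK : (K : ℝ) ≤ 2 * X := (le_mul_of_one_le_right (Nat.cast_nonneg K) hs1).trans hKs
  have hKα : (K : ℝ) / α ≤ 2 / α * X := by
    rw [div_mul_eq_mul_div]
    gcongr
  have hmain : (T : ℝ) / N * (regret I (bpcOGD I P N) N + R * (2 * √(N : ℝ))) ≤
      2 * (b + 2 * R) * X := by
    have h2 : regret I (bpcOGD I P N) N ≤ b * √(N : ℝ) := by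
      refine (le_abs_self _).trans ?_
      rwa [Real.norm_eq_abs, Real.norm_eq_abs, abs_of_nonneg (Real.sqrt_nonneg _)] at h1
    calc _ ≤ (T : ℝ) / N * (b * √(N : ℝ) + R * (2 * √(N : ℝ))) := by gcongr
      _ = (b + 2 * R) * ((T : ℝ) / N * √(N : ℝ)) := by ring
      _ ≤ (b + 2 * R) * (2 * X) := by gcongr
      _ = _ := by ring
  have hlost : lostPeriodsBound I α (1 / (T : ℝ)) T ≤
      S * (g + I.abar * (n * (2 + 2 / α))) * (X * ℓ) := by
    rw [lostPeriodsBound, hGeq, mul_assoc S]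
    refine mul_le_mul_of_nonneg_left ?_ hS
    have h2 : I.abar * (n * ((K : ℝ) * √(N : ℝ) + K / α)) ≤
        I.abar * (n * ((2 + 2 / α) * (X * ℓ))) := by
      gcongr
      calc (K : ℝ) * √(N : ℝ) + K / α ≤ (2 + 2 / α) * X := by linarith
        _ ≤ _ := by gcongr
    have h3 : g * ℓ ≤ g * (X * ℓ) := by gcongr
    calc _ ≤ g * (X * ℓ) + I.abar * (n * ((2 + 2 / α) * (X * ℓ))) := add_le_add h3 h2
      _ = _ := by ring
  -- A crude bound: `K` has order `T ^ (1/3)`, but `K ≤ 2 * X` suffices. The logarithm in the final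
  -- rate enters here and in `lostPeriodsBound`.
  have hgrace : ((K : ℝ) + 1) * (g * ℓ + 1) ≤ 3 * (g + 1) * (X * ℓ) := by
    calc ((K : ℝ) + 1) * (g * ℓ + 1) ≤ (3 * X) * ((g + 1) * ℓ) := by
          have h2 : (K : ℝ) + 1 ≤ 3 * X := by linarith
          have h3 : g * ℓ + 1 ≤ (g + 1) * ℓ := by linarith
          gcongr
      _ = _ := by ring
  have h2α : 2 / α * X ≤ 2 / α * (X * ℓ) := by gcongr
  have hXl0 : 0 ≤ X * ℓ := hX0.trans hXl
  rw [Real.norm_eq_abs, Real.norm_eq_abs, abs_of_nonneg h0, abs_of_nonneg hXl0]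
  refine hreg.trans ?_
  rw [hGeq, add_mul (2 * (b + 2 * R)), add_mul (R * _) (R * _)]
  refine add_le_add (hmain.trans (by gcongr)) (add_le_add ?_ ?_)
  · rw [mul_assoc R]
    refine mul_le_mul_of_nonneg_left ?_ hR
    linarith
  · rw [mul_assoc R]
    refine mul_le_mul_of_nonneg_left ?_ hR
    linarith

end Regret

end NetworkRM

end

theorem mainTheorem7 {n L : ℕ} (I : NetworkRM.Problem n L) (hI : I.GeneralPosition)
    (P : NetworkRM.OGDParams)
    (hP : (fun T : ℕ => NetworkRM.regret I (NetworkRM.bpcOGD I P T) T)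
      =O[atTop] fun T : ℕ => √(T : ℝ))
    (α : ℝ) (hα : α ∈ Set.Ioo (0 : ℝ) 1) :
    (∀ᶠ T : ℕ in atTop,
      NetworkRM.IsFair (NetworkRM.gpEnhancedBPCOGD I P α (1 / (T : ℝ)) T) T α (1 / (T : ℝ))) ∧
    (fun T : ℕ => NetworkRM.regret I (NetworkRM.gpEnhancedBPCOGD I P α (1 / (T : ℝ)) T) T)
      =O[atTop] fun T : ℕ => (T : ℝ) ^ (2 / 3 : ℝ) * Real.log T :=
  ⟨NetworkRM.eventually_isFair I P hα, NetworkRM.regret_isBigO I P α hα hP⟩
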